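/- Let $V$ be a complex vector space of dimension $8$, let $L_0(V)$ be the space of linear operators on $V$ of trace $0$, and let $\delta\in\bigwedge^8V^*$ be non-zero. Embed $\bigwedge^4V$ in $V^{\otimes 4}$ by $v_1\wedge\dots\wedge v_4=\sum_\sigma(-1)^\sigma v_{\sigma(1)}\otimes\dots\otimes v_{\sigma(4)}$, and let $T^{ijkl}$ denote the components of $T\in\bigwedge^4V$ in a basis $e_1,\dots,e_8$ of $V$, with dual basis $e^1,\dots,e^8$. On $\mathfrak g=L_0(V)\oplus\bigwedge^4V$ define an antisymmetric bilinear bracket as follows (summing over repeated indices). For $A,B\in L_0(V)$ and $T,T_1,T_2\in\bigwedge^4V$: $$[A,B]=AB-BA,$$ $$[A,T]^{ijkl}=A^i_sT^{sjkl}+A^j_sT^{iskl}+A^k_sT^{ijsl}+A^l_sT^{ijks}=-[T,A]^{ijkl}$$ (the usual action of $L_0(V)$ on $\bigwedge^4V$), and $[T_1,T_2]\in L_0(V)$ is given by $$[T_1,T_2]^k_m=-\tfrac1{288}\,\delta_{p_1q_1r_1s_1p_2q_2r_2m}\bigl(T_1^{p_1q_1r_1s_1}T_2^{p_2q_2r_2k}-T_2^{p_1q_1r_1s_1}T_1^{p_2q_2r_2k}\bigr).$$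 Then the following hold. 1. With this bracket $\mathfrak g$ is a complex Lie algebra, graded modulo $2$ by $\mathfrak g_0=L_0(V)$, $\mathfrak g_1=\bigwedge^4V$. 2. Let $\mathfrak d\subset L_0(V)$ be the subalgebra of operators that are diagonal in the basis $e_1,\dots,e_8$, and let $\varepsilon_k\in\mathfrak d^*$ be given by $\varepsilon_k(\mathrm{diag}(c_1,\dots,c_8))=c_k$. The Lie algebra $\mathfrak g$ is simple of type $E_7$, $\mathfrak d$ is a Cartan subalgebra of it, and its root system relative to $\mathfrak d$ is $$\Sigma=\{\varepsilon_i-\varepsilon_j\ (i\ne j)\}\cup\{\varepsilon_i+\varepsilon_j+\varepsilon_k+\varepsilon_l\ (i,j,k,l\text{ pairwise distinct})\}.$$ For $A\in\mathfrak d$ one has $[A,e_i\otimes e^j]=(\varepsilon_i-\varepsilon_j)(A)\,e_i\otimes e^j$ and $[A,e_i\wedge e_j\wedge e_k\wedge e_l]=(\varepsilon_i+\varepsilon_j+\varepsilon_k+\varepsilon_l)(A)\,e_i\wedge e_j\wedge e_k\wedge e_l$, and the root spaces of $\varepsilon_i-\varepsilon_j$ and of $\varepsilon_i+\varepsilon_j+\varepsilon_k+\varepsilon_l$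 are the lines spanned by $e_i\otimes e^j$ and by $e_i\wedge e_j\wedge e_k\wedge e_l$ respectively. 3. The subalgebra $\mathfrak g_0=L_0(V)$ is simple of type $A_7$, $\mathfrak d$ is a Cartan subalgebra of it, and its root system relative to $\mathfrak d$ is $\{\varepsilon_i-\varepsilon_j\ (i\neq j)\}$. 4. Let $G$ be a connected Lie group whose Lie algebra is (isomorphic, as a real Lie algebra, to) $\mathfrak g$, and let $G_0\subset G$ be the connected subgroup that corresponds to the subalgebra $\mathfrak g_0$, i.e. the subgroup generated by $\exp(\mathfrak g_0)$. For every $T\in\mathfrak g_1=\bigwedge^4V$, the orbit of $T$ under the adjoint action of $G_0$ on $\mathfrak g$ is contained in $\mathfrak g_1$ and equals the orbit of $T$ under the natural action of $\mathrm{SL}(V)$ on $\bigwedge^4V$. -/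

import Mathlib

open scoped Manifold ContDiff

noncomputable section

namespace FourVector

attribute [local instance 100] LieRing.ofAssociativeRing

universe u

variable {V : Type u} [AddCommGroup V] [Module ℂ V]

/-- `L₀(V)`: the operators of trace `0`, with the commutator bracket. -/
def L₀ (V : Type u) [AddCommGroup V] [Module ℂ V] : LieSubalgebra ℂ (Module.End ℂ V) :=
  { LinearMap.ker (LinearMap.trace ℂ V) with
    lie_mem' := by
      intro A B _ _
      simp [LieRing.of_associative_ring_bracket, LinearMap.trace_mul_comm ℂ A B] }

theorem mem_L₀ {A : Module.End ℂ V} : A ∈ L₀ V ↔ LinearMap.trace ℂ V A = 0 := Iff.rfl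

/-- The alternating map
`(v₁, …, v₄) ↦ A v₁ ∧ v₂ ∧ v₃ ∧ v₄ + ⋯ + v₁ ∧ v₂ ∧ v₃ ∧ A v₄`. -/
def actionAlt (A : Module.End ℂ V) : V [⋀^Fin 4]→ₗ[ℂ] ⋀[ℂ]^4 V :=
  { ∑ a : Fin 4, (exteriorPower.ιMulti ℂ 4).toMultilinearMap.compLinearMap
      (Function.update (fun _ => LinearMap.id) a A) with
    map_eq_zero_of_eq' := by
      intro v i j hv hij
      have key : ∀ a : Fin 4,
          (fun b => Function.update (fun _ : Fin 4 => (LinearMap.id : V →ₗ[ℂ] V)) a A b (v b)) =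
            Function.update v a (A (v a)) := by
        intro a
        funext b
        by_cases h : b = a
        · subst h; simp
        · simp [h]
      have hsum : (∑ a : Fin 4, exteriorPower.ιMulti ℂ 4 (Function.update v a (A (v a)))) = 0 := by
        rw [Finset.sum_eq_add i j hij]
        · have hsw : Function.update v j (A (v j)) =
              Function.update v i (A (v i)) ∘ Equiv.swap i j := by
            funext b
            by_cases h1 : b = i
            · subst h1; simp [hij, hij.symm, hv]
            · by_cases h2 : b = j
              · subst h2; simp [hv]
              · simp [h1, h2, Equiv.swap_apply_of_ne_of_ne h1 h2]
          rw [hsw, AlternatingMap.map_swap _ _ hij, add_neg_cancel]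
        · intro a _ ha
          exact AlternatingMap.map_eq_zero_of_eq _ _
            (by simp [Function.update_of_ne ha.1.symm, Function.update_of_ne ha.2.symm, hv]) hij
        · intro h; exact absurd (Finset.mem_univ _) h
        · intro h; exact absurd (Finset.mem_univ _) h
      simpa [sum_apply, MultilinearMap.compLinearMap_apply, key] using hsum }

/-- The usual action of an operator `A` on `⋀⁴V` (by a derivation). -/
def action (A : Module.End ℂ V) : ⋀[ℂ]^4 V →ₗ[ℂ] ⋀[ℂ]^4 V :=
  exteriorPower.alternatingMapLinearEquiv (actionAlt A)

/-- The component `T^{ijkl}` of a four-vector with respect to the basis `e`, where `⋀⁴V` is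
embedded in `V ⊗ V ⊗ V ⊗ V` by `v₁ ∧ … ∧ v₄ = ∑_σ sign(σ) v_{σ1} ⊗ … ⊗ v_{σ4}`; that is,
`(v₁ ∧ … ∧ v₄)^{i₁…i₄} = det (e^{i_a}(v_b))`. -/
def component (e : Module.Basis (Fin 8) ℂ V) (T : ⋀[ℂ]^4 V) (i : Fin 4 → Fin 8) : ℂ :=
  exteriorPower.pairingDual ℂ V 4 (exteriorPower.ιMulti ℂ 4 fun a => e.coord (i a)) T

/-- The matrix `[T₁, T₂]^k_m` (row `k`, column `m`) of the bracket of two four-vectors. -/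
def bracketMatrix (e : Module.Basis (Fin 8) ℂ V) (δ : V [⋀^Fin 8]→ₗ[ℂ] ℂ) (T₁ T₂ : ⋀[ℂ]^4 V) :
    Matrix (Fin 8) (Fin 8) ℂ :=
  Matrix.of fun k m => -(1 / 288) * ∑ p : Fin 4 → Fin 8, ∑ q : Fin 3 → Fin 8,
    δ (fun a => e (![p 0, p 1, p 2, p 3, q 0, q 1, q 2, m] a)) *
      (component e T₁ p * component e T₂ ![q 0, q 1, q 2, k] -
        component e T₂ p * component e T₁ ![q 0, q 1, q 2, k])

theorem trace_bracketMatrix (e : Module.Basis (Fin 8) ℂ V) (δ : V [⋀^Fin 8]→ₗ[ℂ] ℂ)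
    (T₁ T₂ : ⋀[ℂ]^4 V) : (bracketMatrix e δ T₁ T₂).trace = 0 := by
  let D : (Fin 4 → Fin 8) → (Fin 4 → Fin 8) → ℂ := fun p q =>
    δ (fun a => e (![p 0, p 1, p 2, p 3, q 0, q 1, q 2, q 3] a))
  have hD : ∀ p q, D q p = D p q := by
    intro p q
    have h := δ.map_perm (fun a => e (![p 0, p 1, p 2, p 3, q 0, q 1, q 2, q 3] a))
      (finRotate 8 ^ 4)
    have hs : Equiv.Perm.sign (finRotate 8 ^ 4) = 1 := by
      rw [map_pow, sign_finRotate]; decide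
    rw [hs, one_smul] at h
    refine Eq.trans ?_ h
    change δ _ = δ _
    congr 1
    funext a
    fin_cases a <;> rfl
  have hsnoc : ∀ f : (Fin 4 → Fin 8) → ℂ,
      ∑ m : Fin 8, ∑ q : Fin 3 → Fin 8, f ![q 0, q 1, q 2, m] = ∑ q : Fin 4 → Fin 8, f q := by
    intro f
    rw [← Fintype.sum_prod_type', ← (Fin.snocEquiv (fun _ : Fin 4 => Fin 8)).sum_comp]
    refine Finset.sum_congr rfl fun x _ => congrArg f ?_
    funext a
    fin_cases a <;> rfl
  have hmain : ∑ m : Fin 8, ∑ p : Fin 4 → Fin 8, ∑ q : Fin 3 → Fin 8,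
      δ (fun a => e (![p 0, p 1, p 2, p 3, q 0, q 1, q 2, m] a)) *
        (component e T₁ p * component e T₂ ![q 0, q 1, q 2, m] -
          component e T₂ p * component e T₁ ![q 0, q 1, q 2, m]) = 0 := by
    rw [Finset.sum_comm]
    have h1 : ∀ p : Fin 4 → Fin 8, (∑ m : Fin 8, ∑ q : Fin 3 → Fin 8,
        δ (fun a => e (![p 0, p 1, p 2, p 3, q 0, q 1, q 2, m] a)) *
          (component e T₁ p * component e T₂ ![q 0, q 1, q 2, m] -
            component e T₂ p * component e T₁ ![q 0, q 1, q 2, m])) =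
        ∑ q : Fin 4 → Fin 8, D p q *
          (component e T₁ p * component e T₂ q - component e T₂ p * component e T₁ q) :=
      fun p => hsnoc fun q => D p q *
        (component e T₁ p * component e T₂ q - component e T₂ p * component e T₁ q)
    simp_rw [h1, mul_sub, Finset.sum_sub_distrib]
    rw [sub_eq_zero, Finset.sum_comm]
    refine Finset.sum_congr rfl fun q _ => Finset.sum_congr rfl fun p _ => ?_
    rw [hD]
    ring
  simp only [Matrix.trace, Matrix.diag, bracketMatrix, Matrix.of_apply]
  rw [← Finset.mul_sum, hmain, mul_zero]

/-- The bracket of two four-vectors, as an element of `L₀(V)`. -/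
def bracketFour (e : Module.Basis (Fin 8) ℂ V) (δ : V [⋀^Fin 8]→ₗ[ℂ] ℂ) (T₁ T₂ : ⋀[ℂ]^4 V) :
    L₀ V :=
  ⟨Matrix.toLin e e (bracketMatrix e δ T₁ T₂), by
    rw [mem_L₀, LinearMap.trace_eq_matrix_trace ℂ e, LinearMap.toMatrix_toLin,
      trace_bracketMatrix]⟩

/-- The vector space `𝔤 = L₀(V) ⊕ ⋀⁴V`; the parameters only serve to attach the bracket. -/
def 𝔤 (_e : Module.Basis (Fin 8) ℂ V) (_δ : V [⋀^Fin 8]→ₗ[ℂ] ℂ) : Type u := L₀ V × ⋀[ℂ]^4 V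

variable (e : Module.Basis (Fin 8) ℂ V) (δ : V [⋀^Fin 8]→ₗ[ℂ] ℂ)

instance : AddCommGroup (𝔤 e δ) := inferInstanceAs (AddCommGroup (L₀ V × ⋀[ℂ]^4 V))
instance : Module ℂ (𝔤 e δ) := inferInstanceAs (Module ℂ (L₀ V × ⋀[ℂ]^4 V))
instance : Module.Finite ℂ (𝔤 e δ) :=
  haveI : Module.Finite ℂ V := Module.Finite.of_basis e
  inferInstanceAs (Module.Finite ℂ (L₀ V × ⋀[ℂ]^4 V))

/-- The bracket of `𝔤`: the commutator on `L₀(V)`, the usual action of `L₀(V)` on `⋀⁴V` (so that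
`[A, T] = -[T, A]`), and `bracketFour` on `⋀⁴V`. -/
instance : Bracket (𝔤 e δ) (𝔤 e δ) where
  bracket x y := (⁅x.1, y.1⁆ + bracketFour e δ x.2 y.2, action x.1 y.2 - action y.1 x.2)

/-- The inclusion of the summand `L₀(V)`. -/
def inl : L₀ V →ₗ[ℂ] 𝔤 e δ := LinearMap.inl ℂ (L₀ V) (⋀[ℂ]^4 V)

/-- The inclusion of the summand `⋀⁴V`. -/
def inr : ⋀[ℂ]^4 V →ₗ[ℂ] 𝔤 e δ := LinearMap.inr ℂ (L₀ V) (⋀[ℂ]^4 V)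

theorem lie_inl_inl (A B : L₀ V) : ⁅inl e δ A, inl e δ B⁆ = inl e δ ⁅A, B⁆ := by
  have h : bracketFour e δ 0 0 = 0 := by
    apply Subtype.ext
    have h0 : bracketMatrix e δ 0 0 = 0 := by
      ext k m
      simp [bracketMatrix, component]
    simp [bracketFour, h0]
  change ((⁅A, B⁆ + bracketFour e δ 0 0, action A.1 0 - action B.1 0) : L₀ V × ⋀[ℂ]^4 V) =
    (⁅A, B⁆, 0)
  rw [h]
  simp

/-- The bracket of `𝔤` satisfies the axioms of a complex Lie algebra: it is bilinear, alternating
and satisfies the Jacobi identity. -/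
class IsLieBracket : Prop where
  add_lie : ∀ x y z : 𝔤 e δ, ⁅x + y, z⁆ = ⁅x, z⁆ + ⁅y, z⁆
  lie_add : ∀ x y z : 𝔤 e δ, ⁅x, y + z⁆ = ⁅x, y⁆ + ⁅x, z⁆
  lie_smul : ∀ (c : ℂ) (x y : 𝔤 e δ), ⁅x, c • y⁆ = c • ⁅x, y⁆
  lie_self : ∀ x : 𝔤 e δ, ⁅x, x⁆ = 0
  jacobi : ∀ x y z : 𝔤 e δ, ⁅x, ⁅y, z⁆⁆ = ⁅⁅x, y⁆, z⁆ + ⁅y, ⁅x, z⁆⁆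

instance [h : IsLieBracket e δ] : LieRing (𝔤 e δ) where
  add_lie := h.add_lie
  lie_add := h.lie_add
  lie_self := h.lie_self
  leibniz_lie := h.jacobi

instance [h : IsLieBracket e δ] : LieAlgebra ℂ (𝔤 e δ) where
  lie_smul := h.lie_smul

/-- The components of the grading modulo `2`: `𝔤₀ = L₀(V)` and `𝔤₁ = ⋀⁴V`. -/
def grading (k : ZMod 2) : Submodule ℂ (𝔤 e δ) :=
  if k = 0 then LinearMap.range (inl e δ) else LinearMap.range (inr e δ)

/-- The operators of trace `0` that are diagonal in the basis `e`, as a subalgebra of `L₀(V)`. -/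
def diag : LieSubalgebra ℂ (L₀ V) where
  carrier := {A | (LinearMap.toMatrix e e (A : Module.End ℂ V)).IsDiag}
  zero_mem' := by simp
  add_mem' := by
    intro A B hA hB
    simpa using Matrix.IsDiag.add hA hB
  smul_mem' := by
    intro c A hA
    simpa using Matrix.IsDiag.smul c hA
  lie_mem' := by
    intro A B hA hB
    simp only [Set.mem_ofPred_eq] at hA hB ⊢
    rw [LieSubalgebra.coe_bracket, LieRing.of_associative_ring_bracket, map_sub,
      LinearMap.toMatrix_mul, LinearMap.toMatrix_mul, ← hA.diagonal_diag, ← hB.diagonal_diag,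
      Matrix.diagonal_mul_diagonal, Matrix.diagonal_mul_diagonal]
    exact (Matrix.isDiag_diagonal _).sub (Matrix.isDiag_diagonal _)

/-- The functional `ε_k (diag(c₁, …, c₈)) = c_k`. -/
def ε₀ (k : Fin 8) : Module.Dual ℂ (diag e) where
  toFun A := LinearMap.toMatrix e e (A : Module.End ℂ V) k k
  map_add' A B := by simp
  map_smul' c A := by simp

/-- The diagonal subalgebra `𝔡`, inside `𝔤`. -/
def 𝔡 [IsLieBracket e δ] : LieSubalgebra ℂ (𝔤 e δ) :=
  { (diag e).toSubmodule.map (inl e δ) with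
    lie_mem' := by
      rintro _ _ ⟨A, hA, rfl⟩ ⟨B, hB, rfl⟩
      exact ⟨⁅A, B⁆, (diag e).lie_mem hA hB, (lie_inl_inl e δ A B).symm⟩ }

/-- The functional `ε_k` on `𝔡 ⊆ 𝔤`. -/
def ε [IsLieBracket e δ] (k : Fin 8) : Module.Dual ℂ (𝔡 e δ) where
  toFun A := LinearMap.toMatrix e e ((A : 𝔤 e δ).1 : Module.End ℂ V) k k
  map_add' A B := by
    change LinearMap.toMatrix e e (((A : 𝔤 e δ).1 : Module.End ℂ V) + (B : 𝔤 e δ).1) k k = _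
    simp
  map_smul' c A := by
    change LinearMap.toMatrix e e (c • ((A : 𝔤 e δ).1 : Module.End ℂ V)) k k = _
    simp

/-- The element `e_i ⊗ e^j` of `L₀(V)`, for `i ≠ j`. -/
def matrixUnit (i j : Fin 8) (hij : i ≠ j) : L₀ V :=
  ⟨(e.coord j).smulRight (e i), by
    have : Module.Finite ℂ V := Module.Finite.of_basis e
    have : Module.Free ℂ V := Module.Free.of_basis e
    rw [mem_L₀, LinearMap.trace_smulRight]
    simp [hij]⟩

/-- The four-vector `e_i ∧ e_j ∧ e_k ∧ e_l`. -/
def wedge (i : Fin 4 → Fin 8) : ⋀[ℂ]^4 V := exteriorPower.ιMulti ℂ 4 fun a => e (i a)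

/-- The root system of the semisimple Lie algebra `L` with respect to the Cartan subalgebra `H`
has Cartan matrix `C` (for some base and some numbering of it). -/
def HasCartanMatrix {L : Type*} [LieRing L] [LieAlgebra ℂ L] [FiniteDimensional ℂ L]
    [LieAlgebra.IsKilling ℂ L] (H : LieSubalgebra ℂ L) [H.IsCartanSubalgebra]
    {n : ℕ} (C : Matrix (Fin n) (Fin n) ℤ) : Prop :=
  ∃ (b : (LieAlgebra.IsKilling.rootSystem H).Base) (f : b.support ≃ Fin n),
    b.cartanMatrix.reindex f f = C

section LieGroup

variable {E : Type*} [NormedAddCommGroup E] [NormedSpace ℝ E]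
  {G : Type*} [TopologicalSpace G] [ChartedSpace E G] [Group G]

/-- The adjoint representation of a Lie group: `Ad g` is the differential at `1` of the
conjugation `x ↦ g x g⁻¹`, whose value lies in the tangent space at `g 1 g⁻¹ = 1`. -/
def Ad (g : G) (x : GroupLieAlgebra 𝓘(ℝ, E) G) : GroupLieAlgebra 𝓘(ℝ, E) G :=
  mfderiv 𝓘(ℝ, E) 𝓘(ℝ, E) (fun y : G => g * y * g⁻¹) 1 x

/-- `γ` is a one-parameter subgroup of `G` with initial velocity `x`, i.e. `γ t = exp (t x)`.
The velocity at `0` lies in the tangent space at `γ 0 = 1`. -/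
structure IsOneParameterSubgroup (γ : ℝ → G) (x : GroupLieAlgebra 𝓘(ℝ, E) G) : Prop where
  map_add : ∀ s t, γ (s + t) = γ s * γ t
  contMDiff : ContMDiff 𝓘(ℝ, ℝ) 𝓘(ℝ, E) ∞ γ
  velocity : mfderiv 𝓘(ℝ, ℝ) 𝓘(ℝ, E) γ 0 (1 : ℝ) = x

/-- The connected subgroup of `G` that corresponds to the subalgebra `𝔥` of its Lie algebra: the
subgroup generated by the exponentials of the elements of `𝔥`. -/
def connectedSubgroup (𝔥 : Set (GroupLieAlgebra 𝓘(ℝ, E) G)) : Subgroup G :=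
  Subgroup.closure {g | ∃ x ∈ 𝔥, ∃ γ : ℝ → G, IsOneParameterSubgroup γ x ∧ γ 1 = g}

end LieGroup

end FourVector

end

open FourVector

/-! Jacobi identity. On decomposable four-vectors the sums over components collapse, each term being
counted `4! * 3! = 144` times, so that `[v, w] = -1/2 (C(v,w) - C(w,v))`, where `C(v,w) x = ∑ b,
δ(v, w with x in slot b) w_b` (`coe_bracketFour_ιMulti`). An operator of trace zero annihilates `δ`
as a derivation, hence the bracket is equivariant under `L₀(V)` (`lie_bracketFour`); together with
`action_lie` this gives every Jacobi identity that involves an operator. For three four-vectors the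
Jacobiator is equivariant too. It is checked on `e₀₁₂₃`, `e₄₅₆₇` and one basis four-vector for each
number of indices below 4, where it reduces to the fact that `[v, w]` acts on the `v_a` by `c` and
on the `w_b` by `-c`. Matrix units carry the vanishing from there to all arguments
(`wedge_mem_of_moves`, `jacobiator_base`, `jacobiator_eq_zero`).

Simplicity and roots. For `i ≠ j`, the square of `ad (e_j ⊗ e^i)` sends `(A, T)` to `-2 A_ij e_j ⊗
e^i`, while a non-zero four-vector can be bracketed into `L₀(V)` non-trivially. So a non-zero ideal
meets `L₀(V)`, contains it because `L₀(V)` is simple, and then contains `⋀⁴V` (`isSimple_𝔤`). Roots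
are read off simultaneous eigenvectors. The Cartan matrices come from explicit Chevalley generators
and integer vectors modulo `(1, …, 1)`, since `∑ ε_k = 0` (`hasCartanMatrix_of_generators`,
`hasCartanMatrix_of_integral`).

Orbits. In the chart at 1 the bracket of a Lie group is the antisymmetrised mixed second derivative
of the multiplication (`lie_eq_chartMulSnd`), whence `d/dt Ad(γ t) y = Ad(γ t) [x, y]`, and `w' =
[x, w]` is solved only by `Ad(γ t) (w 0)` (`IsOneParameterSubgroup.Ad_eq`). The curve `⋀⁴(exp tA) T`
solves this equation, so `exp A` in `G` acts on `⋀⁴V` as the matrix exponential, which has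
determinant 1. Conversely, `SL(V)` is generated by transvections and diagonal operators of
determinant 1, all of them exponentials of trace-zero operators; the corresponding elements of `G`
exist because one-parameter subgroups do (`exists_isOneParameterSubgroup`). -/

noncomputable section

/-! ### Multilinear algebra: partial evaluation, derivations, expansion in a basis. -/

section Multilinear

variable {R M N ι κ : Type*} [CommRing R] [AddCommGroup M] [Module R M] [AddCommGroup N]
  [Module R N]

/-- Fixing the second half of the arguments of an alternating map. -/
def AlternatingMap.fixRight (f : M [⋀^ι ⊕ κ]→ₗ[R] N) (w : κ → M) : M [⋀^ι]→ₗ[R] N where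
  toFun v := f (Sum.elim v w)
  map_update_add' v i x y := by
    classical
    have h : ∀ z, Sum.elim (Function.update v i z) w =
        Function.update (Sum.elim v w) (Sum.inl i) z := fun z => by
      convert Sum.update_elim_inl.symm
    simp only [h, f.map_update_add]
  map_update_smul' v i c x := by
    classical
    have h : ∀ z, Sum.elim (Function.update v i z) w =
        Function.update (Sum.elim v w) (Sum.inl i) z := fun z => by
      convert Sum.update_elim_inl.symm
    simp only [h, f.map_update_smul]
  map_eq_zero_of_eq' v i j h hij :=
    f.map_eq_zero_of_eq _ (i := Sum.inl i) (j := Sum.inl j) (by simpa using h) (by simpa using hij)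

@[simp] theorem AlternatingMap.fixRight_apply (f : M [⋀^ι ⊕ κ]→ₗ[R] N) (w : κ → M) (v : ι → M) :
    f.fixRight w v = f (Sum.elim v w) := rfl

/-- Fixing the first half of the arguments of an alternating map. -/
def AlternatingMap.fixLeft (f : M [⋀^ι ⊕ κ]→ₗ[R] N) (v : ι → M) : M [⋀^κ]→ₗ[R] N where
  toFun w := f (Sum.elim v w)
  map_update_add' w i x y := by
    classical
    have h : ∀ z, Sum.elim v (Function.update w i z) =
        Function.update (Sum.elim v w) (Sum.inr i) z := fun z => by
      convert Sum.update_elim_inr.symm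
    simp only [h, f.map_update_add]
  map_update_smul' w i c x := by
    classical
    have h : ∀ z, Sum.elim v (Function.update w i z) =
        Function.update (Sum.elim v w) (Sum.inr i) z := fun z => by
      convert Sum.update_elim_inr.symm
    simp only [h, f.map_update_smul]
  map_eq_zero_of_eq' w i j h hij :=
    f.map_eq_zero_of_eq _ (i := Sum.inr i) (j := Sum.inr j) (by simpa using h) (by simpa using hij)

@[simp] theorem AlternatingMap.fixLeft_apply (f : M [⋀^ι ⊕ κ]→ₗ[R] N) (v : ι → M) (w : κ → M) :
    f.fixLeft v w = f (Sum.elim v w) := rfl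

/-- The alternating map `u ↦ ∑ c, f (u₁, …, A u_c, …, u_n)`. -/
def AlternatingMap.derivation [Fintype ι] [DecidableEq ι] (f : M [⋀^ι]→ₗ[R] N)
    (A : M →ₗ[R] M) : M [⋀^ι]→ₗ[R] N :=
  { ∑ c : ι, f.toMultilinearMap.compLinearMap
      (Function.update (fun _ => LinearMap.id) c A) with
    map_eq_zero_of_eq' := by
      intro v i j hv hij
      have key : ∀ a : ι,
          (fun b => Function.update (fun _ : ι => (LinearMap.id : M →ₗ[R] M)) a A b (v b)) =
            Function.update v a (A (v a)) := by
        intro a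
        funext b
        by_cases h : b = a
        · subst h; simp
        · simp [h]
      have hsum : (∑ a : ι, f (Function.update v a (A (v a)))) = 0 := by
        -- Any term other than those at `i` and `j` keeps two equal arguments; these two differ by
        -- the transposition of `i` and `j`, so they cancel.
        rw [Finset.sum_eq_add i j hij]
        · have hsw : Function.update v j (A (v j)) =
              Function.update v i (A (v i)) ∘ Equiv.swap i j := by
            funext b
            by_cases h1 : b = i
            · subst h1; simp [hij, hij.symm, hv]
            · by_cases h2 : b = j
              · subst h2; simp [hv]
              · simp [h1, h2, Equiv.swap_apply_of_ne_of_ne h1 h2]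
          rw [hsw, AlternatingMap.map_swap _ _ hij, add_neg_cancel]
        · intro a _ ha
          exact AlternatingMap.map_eq_zero_of_eq _ _
            (by simp [Function.update_of_ne ha.1.symm, Function.update_of_ne ha.2.symm, hv]) hij
        · intro h; exact absurd (Finset.mem_univ _) h
        · intro h; exact absurd (Finset.mem_univ _) h
      simpa [sum_apply, MultilinearMap.compLinearMap_apply, key] using hsum }

theorem AlternatingMap.derivation_apply [Fintype ι] [DecidableEq ι] (f : M [⋀^ι]→ₗ[R] N)
    (A : M →ₗ[R] M) (u : ι → M) :
    f.derivation A u = ∑ c, f (Function.update u c (A (u c))) := by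
  change (∑ c : ι, f.toMultilinearMap.compLinearMap
    (Function.update (fun _ => LinearMap.id) c A)) u = _
  rw [sum_apply]
  refine Finset.sum_congr rfl fun c _ => ?_
  rw [MultilinearMap.compLinearMap_apply]
  change f _ = f _
  congr 1
  funext b
  by_cases h : b = c
  · subst h; simp
  · simp [h]

/-- The derivative of the determinant at the identity. The left side is alternating in `u`, so `u`
may be taken to be a permutation of the basis. It makes trace-zero operators annihilate volume
forms. -/
theorem AlternatingMap.sum_update_eq_trace [Fintype ι] [DecidableEq ι] (e : Module.Basis ι R M)
    (f : M [⋀^ι]→ₗ[R] N) (A : M →ₗ[R] M) (u : ι → M) :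
    ∑ c, f (Function.update u c (A (u c))) = LinearMap.trace R M A • f u := by
  rw [← f.derivation_apply A]
  have h : f.derivation A = LinearMap.trace R M A • f := by
    refine Module.Basis.ext_alternating e fun σ hσ => ?_
    rw [AlternatingMap.derivation_apply, AlternatingMap.smul_apply,
      LinearMap.trace_eq_matrix_trace R e, Matrix.trace, Finset.sum_smul]
    let τ : ι ≃ ι := Equiv.ofBijective σ hσ.bijective_of_finite
    rw [← τ.sum_comp (fun i => (LinearMap.toMatrix e e A).diag i • f fun i => e (σ i))]
    refine Finset.sum_congr rfl fun c _ => ?_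
    have hA : A (e (σ c)) = ∑ j, LinearMap.toMatrix e e A (σ (τ.symm j)) (σ c) • e j := by
      conv_lhs => rw [← e.sum_repr (A (e (σ c)))]
      refine Finset.sum_congr rfl fun j _ => ?_
      have : σ (τ.symm j) = j := τ.apply_symm_apply j
      rw [this, LinearMap.toMatrix_apply]
    -- Every off-diagonal coefficient of `A (e (σ c))` multiplies a term in which a basis vector is
    -- repeated.
    rw [hA, AlternatingMap.map_update_sum, Finset.sum_eq_single (σ c)]
    · rw [AlternatingMap.map_update_smul]
      have h1 : τ.symm (σ c) = c := τ.symm_apply_apply c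
      have h2 : τ c = σ c := rfl
      rw [h1, h2, Matrix.diag_apply]
      congr 2
      funext b
      by_cases hb : b = c
      · subst hb; simp
      · simp [hb]
    · intro j _ hj
      rw [AlternatingMap.map_update_smul]
      have h1 : σ (τ.symm j) = j := τ.apply_symm_apply j
      have hne : τ.symm j ≠ c := fun h => hj (by rw [← h, h1])
      rw [f.map_eq_zero_of_eq _ (i := c) (j := τ.symm j) (by simp [hne, h1]) hne.symm, smul_zero]
    · simp
  rw [h, AlternatingMap.smul_apply]

theorem MultilinearMap.apply_eq_sum_basis [Fintype ι] [DecidableEq ι] [Fintype κ]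
    (e : Module.Basis κ R M) (f : MultilinearMap R (fun _ : ι => M) N) (v : ι → M) :
    f v = ∑ p : ι → κ, (∏ i, e.coord (p i) (v i)) • f (fun i => e (p i)) := by
  have h : v = fun i => ∑ j, e.coord j (v i) • e j := funext fun i => (e.sum_repr (v i)).symm
  conv_lhs => rw [h, MultilinearMap.map_sum]
  exact Finset.sum_congr rfl fun p _ => f.map_smul_univ _ _

/-- In the Leibniz expansion each permutation contributes `f v`: the sign of the permutation cancels
the sign from reordering the arguments of `f`. -/
theorem AlternatingMap.sum_det_smul_basis [Fintype ι] [DecidableEq ι] [Fintype κ]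
    (e : Module.Basis κ R M) (f : M [⋀^ι]→ₗ[R] N) (v : ι → M) :
    ∑ p : ι → κ, (Matrix.of fun i j => e.coord (p j) (v i)).det • f (fun i => e (p i)) =
      (Fintype.card ι).factorial • f v := by
  simp_rw [Matrix.det_apply, Finset.sum_smul]
  rw [Finset.sum_comm]
  have h : ∀ σ : Equiv.Perm ι, ∑ p : ι → κ, (Equiv.Perm.sign σ •
      ∏ i, (Matrix.of fun i j => e.coord (p j) (v i)) (σ i) i) • f (fun i => e (p i)) = f v := by
    intro σ
    simp_rw [smul_assoc, ← Finset.smul_sum, Matrix.of_apply]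
    have := MultilinearMap.apply_eq_sum_basis e f.toMultilinearMap (v ∘ σ)
    change f (v ∘ σ) = _ at this
    rw [f.map_perm] at this
    change _ • f v = ∑ p : ι → κ, (∏ i, e.coord (p i) (v (σ i))) • f (fun i => e (p i)) at this
    rw [← this, smul_smul, Int.units_mul_self, one_smul]
  rw [Finset.sum_congr rfl fun σ _ => h σ, Finset.sum_const, Finset.card_univ,
    Fintype.card_perm]

end Multilinear

/-! ### The volume form on two quadruples and the contraction in components. -/

namespace FourVector

universe u

variable {V : Type u} [AddCommGroup V] [Module ℂ V]

/-- The volume form as a function of two quadruples of vectors. -/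
def vol (δ : V [⋀^Fin 8]→ₗ[ℂ] ℂ) : V [⋀^Fin 4 ⊕ Fin 4]→ₗ[ℂ] ℂ :=
  δ.domDomCongr (finSumFinEquiv (m := 4) (n := 4)).symm

theorem vol_apply (δ : V [⋀^Fin 8]→ₗ[ℂ] ℂ) (v w : Fin 4 → V) :
    vol δ (Sum.elim v w) = δ ![v 0, v 1, v 2, v 3, w 0, w 1, w 2, w 3] := by
  change δ _ = δ _
  congr 1
  funext a
  fin_cases a <;> rfl

/-- Exchanging the two quadruples is the fourth power of an 8-cycle, an even permutation. -/
theorem vol_comm (δ : V [⋀^Fin 8]→ₗ[ℂ] ℂ) (v w : Fin 4 → V) :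
    vol δ (Sum.elim w v) = vol δ (Sum.elim v w) := by
  rw [vol_apply, vol_apply]
  have h := δ.map_perm ![v 0, v 1, v 2, v 3, w 0, w 1, w 2, w 3] (finRotate 8 ^ 4)
  have hs : Equiv.Perm.sign (finRotate 8 ^ 4) = 1 := by
    rw [map_pow, sign_finRotate]; decide
  rw [hs, one_smul] at h
  refine Eq.trans ?_ h
  congr 1
  funext a
  fin_cases a <;> rfl

theorem component_ιMulti (e : Module.Basis (Fin 8) ℂ V) (v : Fin 4 → V) (i : Fin 4 → Fin 8) :
    component e (exteriorPower.ιMulti ℂ 4 v) i =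
      (Matrix.of fun a b => e.coord (i b) (v a)).det :=
  exteriorPower.pairingDual_ιMulti_ιMulti _ _

/-- The sum over `p` gives `4!` by `AlternatingMap.sum_det_smul_basis`; after a Laplace expansion of
the second component along its last column, the sum over `q` gives `3!`. -/
theorem sum_vol_mul_component (e : Module.Basis (Fin 8) ℂ V) (δ : V [⋀^Fin 8]→ₗ[ℂ] ℂ)
    (v w : Fin 4 → V) (k m : Fin 8) :
    ∑ p : Fin 4 → Fin 8, ∑ q : Fin 3 → Fin 8,
      δ (fun a => e (![p 0, p 1, p 2, p 3, q 0, q 1, q 2, m] a)) *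
        (component e (exteriorPower.ιMulti ℂ 4 v) p *
          component e (exteriorPower.ιMulti ℂ 4 w) ![q 0, q 1, q 2, k]) =
      144 * ∑ b : Fin 4, vol δ (Sum.elim v (Function.update w b (e m))) * e.coord k (w b) := by
  have hδ : ∀ (p : Fin 4 → Fin 8) (q : Fin 3 → Fin 8),
      δ (fun a => e (![p 0, p 1, p 2, p 3, q 0, q 1, q 2, m] a)) =
        (vol δ).fixRight (Fin.snoc (fun a => e (q a)) (e m)) (fun a => e (p a)) := by
    intro p q
    rw [AlternatingMap.fixRight_apply, vol_apply]
    congr 1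
    funext a
    fin_cases a <;> rfl
  -- The sign in `-24` comes from moving `e m` from the last slot to the first, past three vectors.
  have hp : ∀ q : Fin 3 → Fin 8, ∑ p : Fin 4 → Fin 8,
      δ (fun a => e (![p 0, p 1, p 2, p 3, q 0, q 1, q 2, m] a)) *
        component e (exteriorPower.ιMulti ℂ 4 v) p =
      -24 * ((vol δ).fixLeft v).curryLeft (e m) (fun a => e (q a)) := by
    intro q
    have h := AlternatingMap.sum_det_smul_basis e
      ((vol δ).fixRight (Fin.snoc (fun a => e (q a)) (e m))) v
    simp_rw [hδ, component_ιMulti]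
    rw [Finset.sum_congr rfl fun p _ => mul_comm _ _]
    simp_rw [← smul_eq_mul]
    rw [h]
    have h2 := AlternatingMap.map_insertNth ((vol δ).fixLeft v) (Fin.last 3) (e m)
      (fun a => e (q a))
    rw [Fin.insertNth_last'] at h2
    rw [AlternatingMap.fixRight_apply, ← AlternatingMap.fixLeft_apply, h2]
    simp only [AlternatingMap.curryLeft_apply_apply, Fintype.card_fin, nsmul_eq_mul, smul_eq_mul]
    norm_num [Nat.factorial]
  have hc : ∀ q : Fin 3 → Fin 8, component e (exteriorPower.ιMulti ℂ 4 w) ![q 0, q 1, q 2, k] =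
      ∑ b : Fin 4, (-1) ^ ((b : ℕ) + 3) * e.coord k (w b) *
        (Matrix.of fun i j => e.coord (q j) (b.removeNth w i)).det := by
    intro q
    rw [component_ιMulti, Matrix.det_succ_column _ (Fin.last 3)]
    refine Finset.sum_congr rfl fun b _ => ?_
    congr 2
    ext i j
    fin_cases j <;> rfl
  rw [Finset.sum_comm]
  simp_rw [← mul_assoc, ← Finset.sum_mul, hp, hc, Finset.mul_sum]
  rw [Finset.sum_comm]
  refine Finset.sum_congr rfl fun b _ => ?_
  have h := AlternatingMap.sum_det_smul_basis e (((vol δ).fixLeft v).curryLeft (e m))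
    (b.removeNth w)
  -- Bringing `e m` back from the first slot to slot `b` costs `(-1)^b`, which matches the Laplace
  -- sign `(-1)^(b+3)` and the minus sign in `-24`.
  have h3 := AlternatingMap.map_insertNth ((vol δ).fixLeft v) b (e m) (b.removeNth w)
  rw [Fin.insertNth_removeNth] at h3
  rw [← AlternatingMap.fixLeft_apply, h3]
  simp only [AlternatingMap.curryLeft_apply_apply, smul_eq_mul, Fintype.card_fin,
    nsmul_eq_mul] at h ⊢
  have : ∀ q : Fin 3 → Fin 8,
      -24 * ((vol δ).fixLeft v) (Matrix.vecCons (e m) fun a => e (q a)) *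
        ((-1) ^ ((b : ℕ) + 3) * e.coord k (w b) *
          (Matrix.of fun i j => e.coord (q j) (b.removeNth w i)).det) =
      (24 * (-1) ^ (b : ℕ) * e.coord k (w b)) *
        ((Matrix.of fun i j => e.coord (q j) (b.removeNth w i)).det *
        ((vol δ).fixLeft v) (Matrix.vecCons (e m) fun a => e (q a))) := by
    intro q; ring
  rw [Finset.sum_congr rfl fun q _ => this q, ← Finset.mul_sum, h]
  norm_num [Nat.factorial]
  ring

end FourVector

end

/-! ### The bracket of four-vectors without coordinates and its equivariance. -/

noncomputable section

namespace FourVector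

attribute [local instance 100] LieRing.ofAssociativeRing

universe u

variable {V : Type u} [AddCommGroup V] [Module ℂ V]

/-- The operator `x ↦ ∑ b, δ (v, w₁, …, x, …, w₄) w_b`. -/
def contraction (δ : V [⋀^Fin 8]→ₗ[ℂ] ℂ) (v w : Fin 4 → V) : Module.End ℂ V :=
  ∑ b : Fin 4, (((vol δ).fixLeft v).toMultilinearMap.toLinearMap w b).smulRight (w b)

theorem contraction_apply (δ : V [⋀^Fin 8]→ₗ[ℂ] ℂ) (v w : Fin 4 → V) (x : V) :
    contraction δ v w x = ∑ b, vol δ (Sum.elim v (Function.update w b x)) • w b := by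
  rw [contraction, LinearMap.sum_apply]
  rfl

variable (e : Module.Basis (Fin 8) ℂ V) (δ : V [⋀^Fin 8]→ₗ[ℂ] ℂ)

/-- The factor 144 of `sum_vol_mul_component` turns the constant `-1/288` into `-1/2`. -/
theorem coe_bracketFour_ιMulti (v w : Fin 4 → V) :
    (bracketFour e δ (exteriorPower.ιMulti ℂ 4 v) (exteriorPower.ιMulti ℂ 4 w) : Module.End ℂ V) =
      -(1 / 2 : ℂ) • (contraction δ v w - contraction δ w v) := by
  refine e.ext fun m => ?_
  change Matrix.toLin e e _ (e m) = _
  rw [Matrix.toLin_self]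
  refine e.ext_elem fun k => ?_
  rw [map_sum, Finset.sum_apply', Finset.sum_eq_single k]
  · have h1 := sum_vol_mul_component e δ v w k m
    have h2 := sum_vol_mul_component e δ w v k m
    simp only [map_smul, e.repr_self, Finsupp.smul_single, smul_eq_mul, mul_one,
      Finsupp.single_eq_same, bracketMatrix, Matrix.of_apply, mul_sub, Finset.sum_sub_distrib,
      h1, h2, LinearMap.smul_apply, LinearMap.sub_apply, contraction_apply, map_sub, map_sum,
      Finsupp.smul_apply, Finsupp.sub_apply, Finset.sum_apply', e.coord_apply]
    ring
  · intro j _ hj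
    simp [hj]
  · simp

theorem bracketFour_add_left (S T U : ⋀[ℂ]^4 V) :
    bracketFour e δ (S + T) U = bracketFour e δ S U + bracketFour e δ T U := by
  apply Subtype.ext
  have : bracketMatrix e δ (S + T) U = bracketMatrix e δ S U + bracketMatrix e δ T U := by
    ext k m
    simp only [bracketMatrix, component, map_add, Matrix.of_apply, Matrix.add_apply, ← mul_add,
      ← Finset.sum_add_distrib]
    congr 1
    refine Finset.sum_congr rfl fun p _ => Finset.sum_congr rfl fun q _ => ?_
    ring
  simp [bracketFour, this]

theorem bracketFour_smul_left (c : ℂ) (T U : ⋀[ℂ]^4 V) :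
    bracketFour e δ (c • T) U = c • bracketFour e δ T U := by
  apply Subtype.ext
  have : bracketMatrix e δ (c • T) U = c • bracketMatrix e δ T U := by
    ext k m
    simp only [bracketMatrix, component, map_smul, Matrix.of_apply, Matrix.smul_apply,
      smul_eq_mul]
    rw [mul_left_comm]
    refine congrArg _ ?_
    rw [Finset.mul_sum]
    refine Finset.sum_congr rfl fun p _ => ?_
    rw [Finset.mul_sum]
    refine Finset.sum_congr rfl fun q _ => ?_
    ring
  simp [bracketFour, this]

theorem bracketFour_skew (T U : ⋀[ℂ]^4 V) : bracketFour e δ T U = -bracketFour e δ U T := by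
  apply Subtype.ext
  have : bracketMatrix e δ T U = -bracketMatrix e δ U T := by
    ext k m
    simp only [bracketMatrix, Matrix.of_apply, Matrix.neg_apply]
    rw [← mul_neg, ← Finset.sum_neg_distrib]
    congr 1
    refine Finset.sum_congr rfl fun p _ => ?_
    rw [← Finset.sum_neg_distrib]
    refine Finset.sum_congr rfl fun q _ => ?_
    ring
  simp [bracketFour, this]

theorem bracketFour_self (T : ⋀[ℂ]^4 V) : bracketFour e δ T T = 0 := by
  have h : (2 : ℂ) • bracketFour e δ T T = 0 := by
    rw [two_smul]
    nth_rewrite 1 [bracketFour_skew]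
    exact neg_add_cancel _
  exact (smul_eq_zero.mp h).resolve_left two_ne_zero

/-- The bracket of four-vectors as a bilinear map. -/
def bracketBilin : ⋀[ℂ]^4 V →ₗ[ℂ] ⋀[ℂ]^4 V →ₗ[ℂ] L₀ V :=
  LinearMap.mk₂ ℂ (bracketFour e δ) (bracketFour_add_left e δ) (bracketFour_smul_left e δ)
    (fun S T U => by
      rw [bracketFour_skew, bracketFour_add_left, neg_add, ← bracketFour_skew,
        ← bracketFour_skew])
    (fun c T U => by
      rw [bracketFour_skew, bracketFour_smul_left, ← smul_neg, ← bracketFour_skew])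

@[simp] theorem bracketBilin_apply (T U : ⋀[ℂ]^4 V) :
    bracketBilin e δ T U = bracketFour e δ T U := rfl

theorem action_ιMulti (A : Module.End ℂ V) (v : Fin 4 → V) :
    action A (exteriorPower.ιMulti ℂ 4 v) =
      ∑ a, exteriorPower.ιMulti ℂ 4 (Function.update v a (A (v a))) := by
  rw [action, exteriorPower.alternatingMapLinearEquiv_apply_ιMulti]
  exact AlternatingMap.derivation_apply _ _ _

theorem exteriorPower_induction {P : ⋀[ℂ]^4 V → Prop} (T : ⋀[ℂ]^4 V)
    (ιMulti : ∀ v, P (exteriorPower.ιMulti ℂ 4 v)) (add : ∀ S T, P S → P T → P (S + T))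
    (smul : ∀ (c : ℂ) T, P T → P (c • T)) : P T := by
  have hT : T ∈ Submodule.span ℂ (Set.range (exteriorPower.ιMulti ℂ 4 (M := V))) := by
    rw [exteriorPower.ιMulti_span]; trivial
  induction hT using Submodule.span_induction with
  | mem x hx => obtain ⟨v, rfl⟩ := hx; exact ιMulti v
  | zero => simpa using smul 0 _ (ιMulti 0)
  | add x y _ _ hx hy => exact add _ _ hx hy
  | smul c x _ hx => exact smul _ _ hx

/-- The action of operators on four-vectors, as a linear map. -/
def actionLin : Module.End ℂ V →ₗ[ℂ] ⋀[ℂ]^4 V →ₗ[ℂ] ⋀[ℂ]^4 V where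
  toFun := action
  map_add' A B := by
    refine exteriorPower.linearMap_ext (AlternatingMap.ext fun v => ?_)
    simp [action_ιMulti, Finset.sum_add_distrib]
  map_smul' c A := by
    refine exteriorPower.linearMap_ext (AlternatingMap.ext fun v => ?_)
    simp [action_ιMulti, Finset.smul_sum]

@[simp] theorem actionLin_apply (A : Module.End ℂ V) : actionLin A = action A := rfl

/-- Modifications at two different positions commute and cancel; at one and the same position the
commutator remains. -/
theorem sum_update_update_comm (A B : Module.End ℂ V) {W : Type*} [AddCommGroup W] [Module ℂ W]
    (f : V [⋀^Fin 4]→ₗ[ℂ] W) (v : Fin 4 → V) :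
    (f.derivation A).derivation B v - (f.derivation B).derivation A v =
      f.derivation (A * B - B * A) v := by
  simp only [AlternatingMap.derivation_apply]
  rw [Finset.sum_comm, ← Finset.sum_sub_distrib]
  refine Finset.sum_congr rfl fun a _ => ?_
  rw [← Finset.sum_sub_distrib, Finset.sum_eq_single a]
  · simp [AlternatingMap.map_update_sub]
  · intro b _ hb
    simp [hb, hb.symm, Function.update_comm hb]
  · simp

theorem action_lie (A B : Module.End ℂ V) (T : ⋀[ℂ]^4 V) :
    action (A * B - B * A) T = action A (action B T) - action B (action A T) := by
  induction T using exteriorPower_induction with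
  | ιMulti v =>
    have h : ∀ A v, action A (exteriorPower.ιMulti ℂ 4 v) =
      (exteriorPower.ιMulti ℂ 4 (M := V)).derivation A v := fun A v => by
        rw [action_ιMulti, AlternatingMap.derivation_apply]
    rw [h, ← sum_update_update_comm, h, h, AlternatingMap.derivation_apply,
      AlternatingMap.derivation_apply, AlternatingMap.derivation_apply,
      AlternatingMap.derivation_apply, map_sum, map_sum]
    simp_rw [h]
  | add S T hS hT => simp only [map_add, hS, hT]; abel
  | smul c T hT => simp only [map_smul, hT, smul_sub]

/-- Infinitesimal invariance of the contraction under trace-zero operators, a consequence of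
`AlternatingMap.sum_update_eq_trace` for the volume form. -/
theorem contraction_derivation {A : Module.End ℂ V} (hA : LinearMap.trace ℂ V A = 0)
    (e : Module.Basis (Fin 8) ℂ V) (v w : Fin 4 → V) :
    ∑ a, contraction δ (Function.update v a (A (v a))) w +
      ∑ c, contraction δ v (Function.update w c (A (w c))) =
      A * contraction δ v w - contraction δ v w * A := by
  ext x
  simp only [LinearMap.add_apply, LinearMap.sub_apply, LinearMap.sum_apply,
    Module.End.mul_apply, contraction_apply, map_sum, map_smul]
  conv_lhs =>
    congr
    · rw [Finset.sum_comm]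
    · rw [Finset.sum_comm]
  rw [← Finset.sum_add_distrib, ← Finset.sum_sub_distrib]
  refine Finset.sum_congr rfl fun b _ => ?_
  -- The total derivative of the volume form vanishes on `(v, w)` with `x` in slot `b`. Its term at
  -- slot `b` itself contains `A x` and yields the product with `A` on the right; the product with
  -- `A` on the left comes from the outer factor `w b`.
  have ht := (vol δ).sum_update_eq_trace (e.reindex (finSumFinEquiv (m := 4) (n := 4)).symm) A
    (Sum.elim v (Function.update w b x))
  rw [hA, zero_smul, Fintype.sum_sum_type] at ht
  simp only [Sum.elim_inl, Sum.elim_inr, Sum.update_elim_inl, Sum.update_elim_inr] at ht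
  rw [← Finset.add_sum_erase _ (fun c => vol δ (Sum.elim v (Function.update
    (Function.update w b x) c (A (Function.update w b x c))))) (Finset.mem_univ b)] at ht
  rw [← Finset.add_sum_erase (Finset.univ) (fun c => vol δ (Sum.elim v (Function.update
    (Function.update w c (A (w c))) b x)) • Function.update w c (A (w c)) b) (Finset.mem_univ b)]
  have h2 : ∀ c ∈ Finset.univ.erase b, vol δ (Sum.elim v (Function.update
      (Function.update w c (A (w c))) b x)) • Function.update w c (A (w c)) b =
      vol δ (Sum.elim v (Function.update (Function.update w b x) c
        (A (Function.update w b x c)))) • w b := by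
    intro c hc
    have hc' : c ≠ b := Finset.ne_of_mem_erase hc
    rw [Function.update_of_ne hc'.symm, Function.update_of_ne hc', Function.update_comm hc']
  rw [Finset.sum_congr rfl h2, ← Finset.sum_smul, ← Finset.sum_smul]
  simp only [Function.update_idem, Function.update_self] at ht ⊢
  have h3 : ∀ a b c : ℂ, a + (b + c) = 0 → a = -b - c := fun a b c h => by linear_combination h
  rw [h3 _ _ _ ht]
  module

theorem lie_bracketFour (A : L₀ V) (T U : ⋀[ℂ]^4 V) :
    ⁅A, bracketFour e δ T U⁆ =
      bracketFour e δ (action A T) U + bracketFour e δ T (action A U) := by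
  simp only [← bracketBilin_apply]
  induction T using exteriorPower_induction with
  | add S T hS hT => simp only [map_add, LinearMap.add_apply, lie_add, hS, hT]; abel
  | smul c T hT => simp only [map_smul, LinearMap.smul_apply, lie_smul, hT, smul_add]
  | ιMulti v =>
  induction U using exteriorPower_induction with
  | add S T hS hT => simp only [map_add, lie_add, hS, hT]; abel
  | smul c T hT => simp only [map_smul, lie_smul, hT, smul_add]
  | ιMulti w =>
  apply Subtype.ext
  rw [action_ιMulti, action_ιMulti, map_sum, map_sum, LinearMap.sum_apply]
  simp only [bracketBilin_apply, LieSubalgebra.coe_bracket, coe_bracketFour_ιMulti,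
    LieRing.of_associative_ring_bracket, AddMemClass.coe_add, AddSubmonoidClass.coe_finsetSum]
  rw [← Finset.smul_sum, ← Finset.smul_sum, Finset.sum_sub_distrib, Finset.sum_sub_distrib,
    ← smul_add, sub_add_sub_comm, contraction_derivation δ A.2 e, add_comm (∑ a, contraction δ w _),
    contraction_derivation δ A.2 e]
  simp only [mul_smul_comm, smul_mul_assoc, mul_sub, sub_mul, ← smul_sub]
  congr 1
  abel

end FourVector

end

/-! ### The action in components; moving between basis four-vectors by matrix units. -/

noncomputable section

namespace FourVector

attribute [local instance 100] LieRing.ofAssociativeRing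

universe u

variable {V : Type u} [AddCommGroup V] [Module ℂ V]

/-- Both sides are the trace of `adjugate M * N`, the derivative of the determinant at `M` in the
direction `N`. -/
theorem sum_det_updateCol_eq_sum_det_updateRow {n R : Type*} [Fintype n] [DecidableEq n]
    [CommRing R] (M N : Matrix n n R) :
    ∑ a, (M.updateCol a fun b => N b a).det = ∑ b, (M.updateRow b (N b)).det := by
  have h1 : ∀ a, (M.updateCol a fun b => N b a).det = ∑ b, M.adjugate a b * N b a := fun a => by
    rw [← Matrix.cramer_apply, Matrix.cramer_eq_adjugate_mulVec]
    rfl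
  have h2 : ∀ b, (M.updateRow b (N b)).det = ∑ a, M.adjugate a b * N b a := fun b => by
    rw [← Matrix.cramer_transpose_apply, Matrix.cramer_eq_adjugate_mulVec,
      ← Matrix.adjugate_transpose]
    rfl
  rw [Finset.sum_congr rfl fun a _ => h1 a, Finset.sum_congr rfl fun a _ => h2 a,
    Finset.sum_comm]

/-- On decomposable four-vectors a component is a determinant: the action modifies its rows one at a
time, the index formula its columns. The two sums agree by `sum_det_updateCol_eq_sum_det_updateRow`.
-/
theorem component_action (e : Module.Basis (Fin 8) ℂ V) (A : Module.End ℂ V) (T : ⋀[ℂ]^4 V)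
    (i : Fin 4 → Fin 8) :
    component e (action A T) i =
      ∑ a : Fin 4, ∑ s : Fin 8, LinearMap.toMatrix e e A (i a) s *
        component e T (Function.update i a s) := by
  induction T using exteriorPower_induction with
  | add S T hS hT =>
    simp only [component, map_add] at hS hT ⊢
    rw [hS, hT]
    simp only [mul_add, Finset.sum_add_distrib]
  | smul c T hT =>
    simp only [component, map_smul, smul_eq_mul] at hT ⊢
    rw [hT]
    simp only [Finset.mul_sum]
    exact Finset.sum_congr rfl fun a _ => Finset.sum_congr rfl fun s _ => mul_left_comm _ _ _
  | ιMulti v =>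
    let M : Matrix (Fin 4) (Fin 4) ℂ := Matrix.of fun a b => e.coord (i b) (v a)
    let N : Matrix (Fin 4) (Fin 4) ℂ := Matrix.of fun a b => e.coord (i b) (A (v a))
    have h1 : component e (action A (exteriorPower.ιMulti ℂ 4 v)) i =
        ∑ b, (M.updateRow b (N b)).det := by
      rw [action_ιMulti]
      simp only [component, map_sum]
      refine Finset.sum_congr rfl fun b _ => ?_
      rw [exteriorPower.pairingDual_ιMulti_ιMulti]
      congr 1
      ext a c
      by_cases h : a = b
      · subst h; simp [N]
      · simp [M, h]
    have hN : ∀ a b, N b a = ∑ s, LinearMap.toMatrix e e A (i a) s * e.coord s (v b) := by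
      intro a b
      change e.repr (A (v b)) (i a) = _
      rw [← LinearMap.toMatrix_mulVec_repr e e]
      rfl
    rw [h1, ← sum_det_updateCol_eq_sum_det_updateRow]
    refine Finset.sum_congr rfl fun a _ => ?_
    have h2 : (fun b => N b a) =
        ∑ s, LinearMap.toMatrix e e A (i a) s • fun b => e.coord s (v b) := by
      funext b
      rw [hN, Finset.sum_apply]
      rfl
    rw [h2, ← Matrix.cramer_apply, map_sum, Finset.sum_apply]
    refine Finset.sum_congr rfl fun s _ => ?_
    rw [map_smul, Pi.smul_apply, Matrix.cramer_apply, smul_eq_mul, component_ιMulti]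
    congr 2
    ext b c
    by_cases h : c = a
    · subst h; simp
    · simp [M, h]

section Moves

variable (e : Module.Basis (Fin 8) ℂ V)

theorem wedge_comp_swap (q : Fin 4 → Fin 8) {a b : Fin 4} (hab : a ≠ b) :
    wedge e (q ∘ Equiv.swap a b) = -wedge e q :=
  AlternatingMap.map_swap (exteriorPower.ιMulti ℂ 4) (fun a => e (q a)) hab

theorem action_matrixUnit_wedge {i j : Fin 8} (hij : i ≠ j) {q : Fin 4 → Fin 8}
    (hq : Function.Injective q) {a : Fin 4} (ha : q a = j) :
    action (matrixUnit e i j hij : Module.End ℂ V) (wedge e q) =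
      wedge e (Function.update q a i) := by
  rw [wedge, action_ιMulti, Finset.sum_eq_single a]
  · rw [wedge]
    congr 1
    funext b
    by_cases h : b = a
    · subst h; simp [matrixUnit, ha]
    · simp [h]
  · intro b _ hb
    have : q b ≠ j := fun h => hb (hq (h.trans ha.symm))
    apply AlternatingMap.map_coord_zero _ b
    simp [matrixUnit, this]
  · simp

theorem action_matrixUnit_wedge_of_notMem {i j : Fin 8} (hij : i ≠ j) {q : Fin 4 → Fin 8}
    (h : ∀ a, q a ≠ j) :
    action (matrixUnit e i j hij : Module.End ℂ V) (wedge e q) = 0 := by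
  rw [wedge, action_ιMulti]
  refine Finset.sum_eq_zero fun b _ => ?_
  apply AlternatingMap.map_coord_zero _ b
  simp [matrixUnit, h]

theorem wedge_eq_zero {q : Fin 4 → Fin 8} {a b : Fin 4} (h : q a = q b) (hab : a ≠ b) :
    wedge e q = 0 :=
  AlternatingMap.map_eq_zero_of_eq _ _ (congrArg e h) hab

theorem action_matrixUnit_wedge_eq_zero {i j : Fin 8} (hij : i ≠ j) {q : Fin 4 → Fin 8}
    (hq : Function.Injective q) (h : ∀ a, q a = j → ∃ b, q b = i) :
    action (matrixUnit e i j hij : Module.End ℂ V) (wedge e q) = 0 := by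
  by_cases hj : ∃ a, q a = j
  · obtain ⟨a, ha⟩ := hj
    obtain ⟨b, hb⟩ := h a ha
    have hab : b ≠ a := fun h => hij (by rw [← ha, ← hb, h])
    rw [action_matrixUnit_wedge e hij hq ha]
    exact wedge_eq_zero e (a := b) (b := a) (by simp [hab, hb]) hab
  · push Not at hj
    exact action_matrixUnit_wedge_of_notMem e hij hj

/-- The indices of `q` are changed into those of `p` one position at a time, with `R` recording
which replacements preserve `N`. The induction is on the number of positions where `q` and `p`
differ. -/
theorem wedge_mem_of_moves (N : Submodule ℂ (⋀[ℂ]^4 V)) (R : Fin 8 → Fin 8 → Prop)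
    (hrefl : ∀ i, R i i) (hR : ∀ i j k, R i j → R j k → R i k)
    (hN : ∀ i j (hij : i ≠ j), R j i → ∀ T ∈ N, action (matrixUnit e i j hij : Module.End ℂ V) T ∈ N)
    {p q : Fin 4 → Fin 8} (hqN : wedge e q ∈ N) (hq : Function.Injective q)
    (hp : Function.Injective p) (h : ∀ a, R (q a) (p a)) : wedge e p ∈ N := by
  induction hn : (Finset.univ.filter fun a => q a ≠ p a).card using Nat.strong_induction_on
    generalizing q with
  | _ n ih =>
  by_cases hpq : q = p
  · rwa [← hpq]
  obtain ⟨a, ha⟩ := Function.ne_iff.mp hpq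
  -- If the wanted index already occurs in `q`, a matrix unit would give zero; exchanging two
  -- positions only changes the sign. Otherwise the matrix unit from `q a` to `p a` performs the
  -- replacement.
  by_cases hb : ∃ b, q b = p a
  · obtain ⟨b, hb⟩ := hb
    have hab : a ≠ b := fun h => ha (h ▸ hb)
    have hbp : q b ≠ p b := fun h => hab (hp (hb.symm.trans h))
    refine ih _ ?_ (q := q ∘ Equiv.swap a b) ?_ (hq.comp (Equiv.injective _)) ?_ rfl
    · rw [← hn]
      refine Finset.card_lt_card (Finset.ssubset_iff_subset_ne.mpr ⟨?_, ?_⟩)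
      · intro c hc
        simp only [Finset.mem_filter, Finset.mem_univ, true_and, Function.comp_apply] at hc ⊢
        by_cases hca : c = a
        · exact hca ▸ ha
        by_cases hcb : c = b
        · exact hcb ▸ hbp
        rwa [Equiv.swap_apply_of_ne_of_ne hca hcb] at hc
      · intro h
        have : a ∈ Finset.univ.filter fun a => q a ≠ p a := by simp [ha]
        rw [← h] at this
        simp [hb] at this
    · rw [wedge_comp_swap e q hab]
      exact N.neg_mem hqN
    · intro c
      by_cases hca : c = a
      · subst hca
        simpa [hb] using hrefl (p c)
      by_cases hcb : c = b
      · subst hcb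
        simpa using hR _ _ _ (h a) (hb ▸ h c)
      simpa [Equiv.swap_apply_of_ne_of_ne hca hcb] using h c
  · push Not at hb
    have hne : p a ≠ q a := fun h => ha h.symm
    refine ih _ ?_ (q := Function.update q a (p a)) ?_ ?_ ?_ rfl
    · rw [← hn]
      refine Finset.card_lt_card (Finset.ssubset_iff_subset_ne.mpr ⟨?_, ?_⟩)
      · intro c hc
        simp only [Finset.mem_filter, Finset.mem_univ, true_and] at hc ⊢
        by_cases hca : c = a
        · exact hca ▸ ha
        rwa [Function.update_of_ne hca] at hc
      · intro h
        have : a ∈ Finset.univ.filter fun a => q a ≠ p a := by simp [ha]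
        rw [← h] at this
        simp at this
    · rw [← action_matrixUnit_wedge e hne hq rfl]
      exact hN _ _ _ (h a) _ hqN
    · intro c d hcd
      by_cases hc : c = a <;> by_cases hd : d = a
      · rw [hc, hd]
      · subst hc
        simp only [Function.update_self, Function.update_of_ne hd] at hcd
        exact absurd hcd.symm (hb d)
      · subst hd
        simp only [Function.update_self, Function.update_of_ne hc] at hcd
        exact absurd hcd (hb c)
      · simp only [Function.update_of_ne hd, Function.update_of_ne hc] at hcd
        exact hq hcd
    · intro c
      by_cases hca : c = a
      · subst hca
        simpa using hrefl (p c)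
      simpa [Function.update_of_ne hca] using h c

end Moves

end FourVector

end

/-! ### The Jacobi identity. -/

noncomputable section

namespace FourVector

attribute [local instance 100] LieRing.ofAssociativeRing

universe u

variable {V : Type u} [AddCommGroup V] [Module ℂ V]

section Contraction

variable (δ : V [⋀^Fin 8]→ₗ[ℂ] ℂ) (v w : Fin 4 → V)

theorem vol_eq_zero_of_eq {v w : Fin 4 → V} {a b : Fin 4} (h : v a = w b) :
    vol δ (Sum.elim v w) = 0 :=
  (vol δ).map_eq_zero_of_eq _ (i := Sum.inl a) (j := Sum.inr b) (by simpa using h) (by simp)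

theorem vol_eq_zero_of_eq_left {v w : Fin 4 → V} {a b : Fin 4} (h : v a = v b) (hab : a ≠ b) :
    vol δ (Sum.elim v w) = 0 :=
  (vol δ).map_eq_zero_of_eq _ (i := Sum.inl a) (j := Sum.inl b) (by simpa using h) (by simpa)

theorem vol_update_comm (a b : Fin 4) (x : V) :
    vol δ (Sum.elim (Function.update v a (w b)) (Function.update w b x)) =
      -vol δ (Sum.elim (Function.update v a x) w) := by
  rw [← AlternatingMap.map_swap (vol δ) _ (show (Sum.inl a : Fin 4 ⊕ Fin 4) ≠ Sum.inr b by simp)]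
  congr 1
  funext c
  rcases c with c | c
  · by_cases h : c = a
    · subst h; simp [-Sum.elim_update_left, -Sum.elim_update_right]
    · rw [Function.comp_apply, Equiv.swap_apply_of_ne_of_ne (by simpa using h) (by simp)]
      simp [h]
  · by_cases h : c = b
    · subst h; simp [-Sum.elim_update_left, -Sum.elim_update_right]
    · rw [Function.comp_apply, Equiv.swap_apply_of_ne_of_ne (by simp) (by simpa using h)]
      simp [h]

theorem contraction_apply_left (a : Fin 4) : contraction δ v w (v a) = 0 := by
  rw [contraction_apply]
  refine Finset.sum_eq_zero fun b _ => ?_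
  rw [vol_eq_zero_of_eq δ (a := a) (b := b) (by simp), zero_smul]

theorem contraction_apply_right (a : Fin 4) :
    contraction δ v w (w a) = vol δ (Sum.elim v w) • w a := by
  rw [contraction_apply, Finset.sum_eq_single a]
  · simp
  · intro b _ hb
    rw [← vol_comm, vol_eq_zero_of_eq_left δ (a := a) (b := b) (by simp [hb.symm]) hb.symm,
      zero_smul]
  · simp

/-- Replacing a single slot of `w` leaves at least one of the two coincidences with `v` in place. -/
theorem contraction_eq_zero {v w : Fin 4 → V} {a a' b b' : Fin 4} (hb : b ≠ b')
    (h : v a = w b) (h' : v a' = w b') : contraction δ v w = 0 := by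
  ext x
  rw [contraction_apply]
  refine Finset.sum_eq_zero fun c _ => ?_
  by_cases hc : c = b
  · rw [vol_eq_zero_of_eq δ (a := a') (b := b') (by simp [hc, hb.symm, h']), zero_smul]
  · rw [vol_eq_zero_of_eq δ (a := a) (b := b) (by simp [Ne.symm hc, h]), zero_smul]

theorem contraction_update_right (a b : Fin 4) (x : V) :
    contraction δ w (Function.update v a (w b)) x =
      vol δ (Sum.elim (Function.update v a x) w) • w b := by
  rw [contraction_apply, Finset.sum_eq_single a]
  · rw [Function.update_idem, Function.update_self, vol_comm]
  · intro c _ hc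
    rw [vol_eq_zero_of_eq δ (a := b) (b := a) (by simp [hc.symm]), zero_smul]
  · exact fun h => absurd (Finset.mem_univ _) h

theorem contraction_update_left (a b : Fin 4) (x : V) :
    contraction δ (Function.update v a (w b)) w x =
      -vol δ (Sum.elim (Function.update v a x) w) • w b := by
  rw [contraction_apply, Finset.sum_eq_single b]
  · rw [vol_update_comm]
  · intro c _ hc
    rw [vol_eq_zero_of_eq δ (a := a) (b := b) (by simp [hc.symm]), zero_smul]
  · exact fun h => absurd (Finset.mem_univ _) h

end Contraction

variable (e : Module.Basis (Fin 8) ℂ V) (δ : V [⋀^Fin 8]→ₗ[ℂ] ℂ)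

/-- With `bracketFour_apply_right`: `[v, w]` is scalar on each factor, with opposite eigenvalues on
the two quadruples. The verifications of the Jacobi identity rest on this. -/
theorem bracketFour_apply_left (v w : Fin 4 → V) (a : Fin 4) :
    (bracketFour e δ (exteriorPower.ιMulti ℂ 4 v) (exteriorPower.ιMulti ℂ 4 w) : Module.End ℂ V)
      (v a) = ((1 / 2 : ℂ) * vol δ (Sum.elim v w)) • v a := by
  rw [coe_bracketFour_ιMulti, LinearMap.smul_apply, LinearMap.sub_apply, contraction_apply_left,
    contraction_apply_right, vol_comm]
  module

theorem bracketFour_apply_right (v w : Fin 4 → V) (a : Fin 4) :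
    (bracketFour e δ (exteriorPower.ιMulti ℂ 4 v) (exteriorPower.ιMulti ℂ 4 w) : Module.End ℂ V)
      (w a) = (-(1 / 2 : ℂ) * vol δ (Sum.elim v w)) • w a := by
  rw [coe_bracketFour_ιMulti, LinearMap.smul_apply, LinearMap.sub_apply, contraction_apply_left,
    contraction_apply_right]
  module

theorem bracketFour_eq_zero {v w : Fin 4 → V} {a a' b b' : Fin 4} (ha : a ≠ a') (hb : b ≠ b')
    (h : v a = w b) (h' : v a' = w b') :
    bracketFour e δ (exteriorPower.ιMulti ℂ 4 v) (exteriorPower.ιMulti ℂ 4 w) = 0 := by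
  apply Subtype.ext
  rw [coe_bracketFour_ιMulti, contraction_eq_zero δ hb h h',
    contraction_eq_zero δ ha h.symm h'.symm]
  simp

/-- The Jacobiator of three four-vectors, as a linear function of the first one. -/
def jacobiator (T U : ⋀[ℂ]^4 V) : ⋀[ℂ]^4 V →ₗ[ℂ] ⋀[ℂ]^4 V :=
  ((actionLin ∘ₗ (L₀ V).toSubmodule.subtype) ∘ₗ (bracketBilin e δ).flip T).flip U +
    action (bracketFour e δ T U : Module.End ℂ V) +
    ((actionLin ∘ₗ (L₀ V).toSubmodule.subtype) ∘ₗ bracketBilin e δ U).flip T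

theorem jacobiator_apply (S T U : ⋀[ℂ]^4 V) :
    jacobiator e δ T U S = action (bracketFour e δ S T : Module.End ℂ V) U +
      action (bracketFour e δ T U : Module.End ℂ V) S +
      action (bracketFour e δ U S : Module.End ℂ V) T := rfl

theorem jacobiator_cyclic (S T U : ⋀[ℂ]^4 V) :
    jacobiator e δ T U S = jacobiator e δ U S T := by
  simp only [jacobiator_apply]; abel

theorem action_neg (A : Module.End ℂ V) (T : ⋀[ℂ]^4 V) : action (-A) T = -action A T := by
  rw [← actionLin_apply, map_neg]; rfl

theorem jacobiator_swap (S T U : ⋀[ℂ]^4 V) :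
    jacobiator e δ T U S = -jacobiator e δ U T S := by
  simp only [jacobiator_apply]
  rw [bracketFour_skew e δ S T, bracketFour_skew e δ T U, bracketFour_skew e δ U S]
  simp only [NegMemClass.coe_neg, action_neg]
  abel

/-- Equivariance under `L₀(V)`: if an operator kills two of the arguments, it preserves the set of
third arguments on which the Jacobiator vanishes. -/
theorem action_jacobiator (A : L₀ V) (S T U : ⋀[ℂ]^4 V) :
    action (A : Module.End ℂ V) (jacobiator e δ T U S) =
      jacobiator e δ T U (action (A : Module.End ℂ V) S) +
      jacobiator e δ (action (A : Module.End ℂ V) T) U S +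
      jacobiator e δ T (action (A : Module.End ℂ V) U) S := by
  have h : ∀ S T U : ⋀[ℂ]^4 V, action (A : Module.End ℂ V)
      (action (bracketFour e δ S T : Module.End ℂ V) U) =
      action (bracketFour e δ (action (A : Module.End ℂ V) S) T : Module.End ℂ V) U +
      action (bracketFour e δ S (action (A : Module.End ℂ V) T) : Module.End ℂ V) U +
      action (bracketFour e δ S T : Module.End ℂ V) (action (A : Module.End ℂ V) U) := by
    intro S T U
    have h1 := action_lie (A : Module.End ℂ V) (bracketFour e δ S T : Module.End ℂ V) U
    have h2 := congrArg (fun X : L₀ V => action (X : Module.End ℂ V) U) (lie_bracketFour e δ A S T)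
    simp only [LieSubalgebra.coe_bracket, LieRing.of_associative_ring_bracket,
      AddMemClass.coe_add, ← actionLin_apply, map_add, LinearMap.add_apply] at h1 h2 ⊢
    rw [← h2, h1]
    abel
  simp only [jacobiator_apply, map_add, h]
  abel

/-- The third four-vector shares two factors with `v` and two with `w`, so its brackets with both
vanish. The remaining term vanishes because the eigenvalues of `[v, w]` on its factors add up to
zero. -/
theorem jacobiator_update_update (v w : Fin 4 → V) :
    jacobiator e δ (exteriorPower.ιMulti ℂ 4 v) (exteriorPower.ιMulti ℂ 4 w)
      (exteriorPower.ιMulti ℂ 4 ![v 0, v 1, w 0, w 1]) = 0 := by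
  have h1 : bracketFour e δ (exteriorPower.ιMulti ℂ 4 ![v 0, v 1, w 0, w 1])
      (exteriorPower.ιMulti ℂ 4 v) = 0 :=
    bracketFour_eq_zero e δ (a := 0) (a' := 1) (b := 0) (b' := 1) (by simp) (by simp) rfl rfl
  have h2 : bracketFour e δ (exteriorPower.ιMulti ℂ 4 w)
      (exteriorPower.ιMulti ℂ 4 ![v 0, v 1, w 0, w 1]) = 0 :=
    bracketFour_eq_zero e δ (a := 0) (a' := 1) (b := 2) (b' := 3) (by simp) (by simp) rfl rfl
  have h3 : action (bracketFour e δ (exteriorPower.ιMulti ℂ 4 v) (exteriorPower.ιMulti ℂ 4 w) :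
      Module.End ℂ V) (exteriorPower.ιMulti ℂ 4 ![v 0, v 1, w 0, w 1]) = 0 := by
    have hK : ∀ c, (bracketFour e δ (exteriorPower.ιMulti ℂ 4 v) (exteriorPower.ιMulti ℂ 4 w) :
        Module.End ℂ V) (![v 0, v 1, w 0, w 1] c) =
        (![1 / 2, 1 / 2, -(1 / 2), -(1 / 2)] c * vol δ (Sum.elim v w)) •
          ![v 0, v 1, w 0, w 1] c := by
      intro c
      fin_cases c
      · exact bracketFour_apply_left e δ v w 0
      · exact bracketFour_apply_left e δ v w 1
      · exact bracketFour_apply_right e δ v w 0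
      · exact bracketFour_apply_right e δ v w 1
    rw [action_ιMulti]
    simp_rw [hK, AlternatingMap.map_update_smul, Function.update_eq_self, ← Finset.sum_smul,
      ← Finset.sum_mul]
    simp [Fin.sum_univ_four]
  rw [jacobiator_cyclic, jacobiator_apply, h1, h2, h3, ZeroMemClass.coe_zero, ← actionLin_apply,
    map_zero]
  simp

theorem jacobiator_self (T U : ⋀[ℂ]^4 V) : jacobiator e δ T U T = 0 := by
  rw [jacobiator_apply, bracketFour_self, bracketFour_skew e δ U T, NegMemClass.coe_neg,
    action_neg, ZeroMemClass.coe_zero, ← actionLin_apply, map_zero]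
  simp

theorem mem_of_forall_wedge_mem {N : Submodule ℂ (⋀[ℂ]^4 V)}
    (h : ∀ p : Fin 4 → Fin 8, StrictMono p → wedge e p ∈ N) (T : ⋀[ℂ]^4 V) : T ∈ N := by
  have : (⊤ : Submodule ℂ (⋀[ℂ]^4 V)) ≤ N := by
    rw [← (e.exteriorPower 4).span_eq, Submodule.span_le]
    rintro _ ⟨s, rfl⟩
    rw [exteriorPower.basis_apply]
    exact h _ (OrderEmbedding.strictMono _)
  exact this trivial

/-- Let `K` be `v` with `w b` in slot `a`. It shares three factors with `v`, so `[K, v] = 0`. The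
operator `[w, K]` has its image in the line of `w b` and sends `v` to `-vol(v, w) K`, whereas `[v,
w]` multiplies `K` by `(3/2 - 1/2) vol(v, w)`. -/
theorem jacobiator_update (v w : Fin 4 → V) (a b : Fin 4) :
    jacobiator e δ (exteriorPower.ιMulti ℂ 4 v) (exteriorPower.ιMulti ℂ 4 w)
      (exteriorPower.ιMulti ℂ 4 (Function.update v a (w b))) = 0 := by
  set K := Function.update v a (w b) with hK
  have h0 : bracketFour e δ (exteriorPower.ιMulti ℂ 4 K) (exteriorPower.ιMulti ℂ 4 v) = 0 := by
    obtain ⟨c, d, hcd, hc, hd⟩ : ∃ c d : Fin 4, c ≠ d ∧ c ≠ a ∧ d ≠ a := by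
      clear_value K; clear hK; revert a; decide
    exact bracketFour_eq_zero e δ hcd hcd (by simp [hK, hc]) (by simp [hK, hd])
  have h1 : ∀ x, (bracketFour e δ (exteriorPower.ιMulti ℂ 4 w) (exteriorPower.ιMulti ℂ 4 K) :
      Module.End ℂ V) x = -vol δ (Sum.elim (Function.update v a x) w) • w b := by
    intro x
    rw [coe_bracketFour_ιMulti, LinearMap.smul_apply, LinearMap.sub_apply,
      contraction_update_right, contraction_update_left]
    module
  have h2 : action (bracketFour e δ (exteriorPower.ιMulti ℂ 4 w) (exteriorPower.ιMulti ℂ 4 K) :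
      Module.End ℂ V) (exteriorPower.ιMulti ℂ 4 v) =
      -vol δ (Sum.elim v w) • exteriorPower.ιMulti ℂ 4 K := by
    rw [action_ιMulti, Finset.sum_eq_single a]
    · rw [h1, Function.update_eq_self, AlternatingMap.map_update_smul]
    · intro c _ hc
      rw [h1, vol_eq_zero_of_eq_left δ (a := a) (b := c) (by simp [hc]) hc.symm]
      simp [AlternatingMap.map_update_zero]
    · simp
  have h3 : action (bracketFour e δ (exteriorPower.ιMulti ℂ 4 v) (exteriorPower.ιMulti ℂ 4 w) :
      Module.End ℂ V) (exteriorPower.ιMulti ℂ 4 K) =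
      vol δ (Sum.elim v w) • exteriorPower.ιMulti ℂ 4 K := by
    have hK' : ∀ c, (bracketFour e δ (exteriorPower.ιMulti ℂ 4 v) (exteriorPower.ιMulti ℂ 4 w) :
        Module.End ℂ V) (K c) =
        ((if c = a then -(1 / 2 : ℂ) else 1 / 2) * vol δ (Sum.elim v w)) • K c := by
      intro c
      by_cases hc : c = a
      · subst hc; simp only [hK, Function.update_self, if_true]
        exact bracketFour_apply_right e δ v w b
      · simp only [hK, Function.update_of_ne hc, if_neg hc]
        exact bracketFour_apply_left e δ v w c
    rw [action_ιMulti]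
    simp_rw [hK', AlternatingMap.map_update_smul, Function.update_eq_self, ← Finset.sum_smul,
      ← Finset.sum_mul]
    have : ∑ i : Fin 4, (if i = a then -(1 / 2 : ℂ) else 1 / 2) = 1 := by
      clear_value K
      clear hK h0 h1 h2 hK'
      simp only [Fin.sum_univ_four]
      fin_cases a <;> simp [Fin.ext_iff] <;> norm_num
    rw [this, one_mul]
  rw [jacobiator_cyclic, jacobiator_apply, h0, h2, h3, ZeroMemClass.coe_zero, ← actionLin_apply,
    map_zero, LinearMap.zero_apply]
  module

/-- The matrix units that preserve the blocks `0..3` and `4..7` kill both fixed four-vectors, hence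
preserve the kernel in `T`. By such moves only the number of indices below 4 matters, and each of
the five cases has a representative treated above. -/
theorem jacobiator_base (T : ⋀[ℂ]^4 V) :
    jacobiator e δ (wedge e ![0, 1, 2, 3]) (wedge e ![4, 5, 6, 7]) T = 0 := by
  have hv : Function.Injective (![0, 1, 2, 3] : Fin 4 → Fin 8) := by decide
  have hw : Function.Injective (![4, 5, 6, 7] : Fin 4 → Fin 8) := by decide
  refine mem_of_forall_wedge_mem e (N := LinearMap.ker
    (jacobiator e δ (wedge e ![0, 1, 2, 3]) (wedge e ![4, 5, 6, 7]))) (fun p hp => ?_) T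
  have key : ∀ q : Fin 4 → Fin 8, Function.Injective q →
      jacobiator e δ (wedge e ![0, 1, 2, 3]) (wedge e ![4, 5, 6, 7]) (wedge e q) = 0 →
      (∀ a, q a < 4 ↔ p a < 4) → wedge e p ∈ LinearMap.ker
        (jacobiator e δ (wedge e ![0, 1, 2, 3]) (wedge e ![4, 5, 6, 7])) := by
    intro q hq h hqp
    refine wedge_mem_of_moves e _ (fun i j => i < 4 ↔ j < 4) (fun i => Iff.rfl)
      (fun i j k => Iff.trans) ?_ h hq hp.injective hqp
    intro i j hij hR T hT
    rw [LinearMap.mem_ker] at hT ⊢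
    have h1 := action_jacobiator e δ (matrixUnit e i j hij) T (wedge e ![0, 1, 2, 3])
      (wedge e ![4, 5, 6, 7])
    have hvR : ∀ a, (![0, 1, 2, 3] : Fin 4 → Fin 8) a = j →
        ∃ b, (![0, 1, 2, 3] : Fin 4 → Fin 8) b = i := by clear h1; revert i j; decide
    have hwR : ∀ a, (![4, 5, 6, 7] : Fin 4 → Fin 8) a = j →
        ∃ b, (![4, 5, 6, 7] : Fin 4 → Fin 8) b = i := by clear h1 hvR; revert i j; decide
    rw [action_matrixUnit_wedge_eq_zero e hij hv hvR,
      action_matrixUnit_wedge_eq_zero e hij hw hwR, hT, map_zero,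
      jacobiator_cyclic e δ _ 0, map_zero, ← jacobiator_cyclic e δ 0, map_zero, add_zero,
      add_zero] at h1
    exact h1.symm
  have h01 : p 0 < p 1 := hp (by decide)
  have h12 : p 1 < p 2 := hp (by decide)
  have h23 : p 2 < p 3 := hp (by decide)
  have hpat : ∀ q : Fin 4 → Fin 8, (q 0 < 4 ↔ p 0 < 4) → (q 1 < 4 ↔ p 1 < 4) →
      (q 2 < 4 ↔ p 2 < 4) → (q 3 < 4 ↔ p 3 < 4) → ∀ a, q a < 4 ↔ p a < 4 := by
    intro q h0 h1 h2 h3 a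
    fin_cases a <;> assumption
  -- As `p` is increasing, its entries below 4 come first, so these five cases are exhaustive.
  by_cases p3 : p 3 < 4
  · refine key ![0, 1, 2, 3] hv (jacobiator_self e δ _ _) (hpat _ ?_ ?_ ?_ ?_)
    · exact iff_of_true (by decide) (h01.trans (h12.trans (h23.trans p3)))
    · exact iff_of_true (by decide) (h12.trans (h23.trans p3))
    · exact iff_of_true (by decide) (h23.trans p3)
    · exact iff_of_true (by decide) p3
  by_cases p2 : p 2 < 4
  · refine key ![0, 1, 2, 4] (by decide) ?_ (hpat _ ?_ ?_ ?_ ?_)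
    · convert jacobiator_update e δ (fun a => e (![0, 1, 2, 3] a)) (fun a => e (![4, 5, 6, 7] a))
        3 0 using 2
      · rfl
      · refine congrArg (exteriorPower.ιMulti ℂ 4 (M := V)) ?_
        funext a
        fin_cases a <;> rfl
    · exact iff_of_true (by decide) (h01.trans (h12.trans p2))
    · exact iff_of_true (by decide) (h12.trans p2)
    · exact iff_of_true (by decide) p2
    · exact iff_of_false (by decide) p3
  by_cases p1 : p 1 < 4
  · refine key ![0, 1, 4, 5] (by decide) ?_ (hpat _ ?_ ?_ ?_ ?_)
    · convert jacobiator_update_update e δ (fun a => e (![0, 1, 2, 3] a))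
        (fun a => e (![4, 5, 6, 7] a)) using 2
      · rfl
      · refine congrArg (exteriorPower.ιMulti ℂ 4 (M := V)) ?_
        funext a
        fin_cases a <;> rfl
    · exact iff_of_true (by decide) (h01.trans p1)
    · exact iff_of_true (by decide) p1
    · exact iff_of_false (by decide) p2
    · exact iff_of_false (by decide) p3
  by_cases p0 : p 0 < 4
  · refine key ![0, 5, 6, 7] (by decide) ?_ (hpat _ ?_ ?_ ?_ ?_)
    · rw [jacobiator_swap, neg_eq_zero]
      convert jacobiator_update e δ (fun a => e (![4, 5, 6, 7] a)) (fun a => e (![0, 1, 2, 3] a))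
        0 0 using 2
      · rfl
      · refine congrArg (exteriorPower.ιMulti ℂ 4 (M := V)) ?_
        funext a
        fin_cases a <;> rfl
    · exact iff_of_true (by decide) p0
    · exact iff_of_false (by decide) p1
    · exact iff_of_false (by decide) p2
    · exact iff_of_false (by decide) p3
  · refine key ![4, 5, 6, 7] hw ?_ (hpat _ ?_ ?_ ?_ ?_)
    · rw [jacobiator_swap, neg_eq_zero, jacobiator_self]
    · exact iff_of_false (by decide) p0
    · exact iff_of_false (by decide) p1
    · exact iff_of_false (by decide) p2
    · exact iff_of_false (by decide) p3

/-- The Jacobi identity for three four-vectors. -/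
theorem jacobiator_eq_zero (S T U : ⋀[ℂ]^4 V) : jacobiator e δ T U S = 0 := by
  have hv : Function.Injective (![0, 1, 2, 3] : Fin 4 → Fin 8) := by decide
  have hw : Function.Injective (![4, 5, 6, 7] : Fin 4 → Fin 8) := by decide
  have h2 : ∀ S T, jacobiator e δ S (wedge e ![0, 1, 2, 3]) T = 0 := by
    intro S T
    -- With only `e₀₁₂₃` fixed, every matrix unit that kills it may be used: all except those
    -- carrying an index below 4 to one above. Starting from `e₄₅₆₇`, they reach every basis
    -- four-vector.
    let N : Submodule ℂ (⋀[ℂ]^4 V) :=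
      ⨅ S, LinearMap.ker (jacobiator e δ S (wedge e ![0, 1, 2, 3]))
    have hN : ∀ T, T ∈ N ↔ ∀ S, jacobiator e δ S (wedge e ![0, 1, 2, 3]) T = 0 := fun T => by
      simp [N, Submodule.mem_iInf]
    refine (hN T).mp (mem_of_forall_wedge_mem e (fun p hp => ?_) T) S
    refine wedge_mem_of_moves e N (fun i j => i < 4 → j < 4) (fun i => id)
      (fun i j k hij hjk => hjk ∘ hij) ?_ (q := ![4, 5, 6, 7]) ?_ hw hp.injective ?_
    · intro i j hij hR T hT
      rw [hN] at hT ⊢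
      intro S
      have h1 := action_jacobiator e δ (matrixUnit e i j hij) T S (wedge e ![0, 1, 2, 3])
      have hvR : ∀ a, (![0, 1, 2, 3] : Fin 4 → Fin 8) a = j →
          ∃ b, (![0, 1, 2, 3] : Fin 4 → Fin 8) b = i := by
        clear h1; revert i j; decide
      rw [action_matrixUnit_wedge_eq_zero e hij hv hvR, hT, hT, map_zero,
        ← jacobiator_cyclic e δ 0, map_zero, add_zero, add_zero] at h1
      exact h1.symm
    · rw [hN]
      intro S
      rw [jacobiator_cyclic, jacobiator_base]
    · intro a
      fin_cases a <;> simp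
  -- With nothing fixed, all matrix units preserve `N`, and it contains `e₀₁₂₃` by the previous
  -- stage.
  let N : Submodule ℂ (⋀[ℂ]^4 V) := ⨅ T, ⨅ U, LinearMap.ker (jacobiator e δ T U)
  have hN : ∀ S, S ∈ N ↔ ∀ T U, jacobiator e δ T U S = 0 := fun T => by
    simp [N, Submodule.mem_iInf]
  refine (hN S).mp (mem_of_forall_wedge_mem e (fun p hp => ?_) S) T U
  refine wedge_mem_of_moves e N (fun i j => True) (fun i => trivial)
    (fun i j k hij hjk => trivial) ?_ (q := ![0, 1, 2, 3]) ?_ hv hp.injective (fun _ => trivial)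
  · intro i j hij hR S hS
    rw [hN] at hS ⊢
    intro T U
    have h1 := action_jacobiator e δ (matrixUnit e i j hij) S T U
    rw [hS, hS, hS, map_zero, add_zero, add_zero] at h1
    exact h1.symm
  · rw [hN]
    intro T U
    rw [jacobiator_cyclic, h2]

/-- The bracket of `𝔤` satisfies the axioms of a Lie algebra. -/
theorem isLieBracket : IsLieBracket e δ where
  add_lie x y z := by
    refine Prod.ext ?_ ?_
    · change ⁅x.1 + y.1, z.1⁆ + bracketFour e δ (x.2 + y.2) z.2 =
        ⁅x.1, z.1⁆ + bracketFour e δ x.2 z.2 + (⁅y.1, z.1⁆ + bracketFour e δ y.2 z.2)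
      rw [add_lie, bracketFour_add_left]
      abel
    · change action ((x.1 + y.1 : L₀ V) : Module.End ℂ V) z.2 - action z.1 (x.2 + y.2) =
        action x.1 z.2 - action z.1 x.2 + (action y.1 z.2 - action z.1 y.2)
      rw [AddMemClass.coe_add, ← actionLin_apply, map_add, map_add]
      simp only [LinearMap.add_apply, actionLin_apply]
      abel
  lie_add x y z := by
    refine Prod.ext ?_ ?_
    · change ⁅x.1, y.1 + z.1⁆ + bracketFour e δ x.2 (y.2 + z.2) =
        ⁅x.1, y.1⁆ + bracketFour e δ x.2 y.2 + (⁅x.1, z.1⁆ + bracketFour e δ x.2 z.2)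
      rw [lie_add, ← bracketBilin_apply, map_add]
      simp only [bracketBilin_apply]
      abel
    · change action x.1 (y.2 + z.2) - action ((y.1 + z.1 : L₀ V) : Module.End ℂ V) x.2 =
        action x.1 y.2 - action y.1 x.2 + (action x.1 z.2 - action z.1 x.2)
      rw [AddMemClass.coe_add, ← actionLin_apply (_ + _), map_add, map_add]
      simp only [LinearMap.add_apply, actionLin_apply]
      abel
  lie_smul c x y := by
    refine Prod.ext ?_ ?_
    · change ⁅x.1, c • y.1⁆ + bracketFour e δ x.2 (c • y.2) =
        c • (⁅x.1, y.1⁆ + bracketFour e δ x.2 y.2)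
      rw [lie_smul, ← bracketBilin_apply, map_smul, smul_add]
      rfl
    · change action x.1 (c • y.2) - actionLin (c • (y.1 : Module.End ℂ V)) x.2 =
        c • (action x.1 y.2 - action y.1 x.2)
      rw [map_smul, map_smul, smul_sub]
      rfl
  lie_self x := by
    refine Prod.ext ?_ ?_
    · change ⁅x.1, x.1⁆ + bracketFour e δ x.2 x.2 = 0
      rw [lie_self, bracketFour_self, add_zero]
    · change action x.1 x.2 - action x.1 x.2 = 0
      rw [sub_self]
  jacobi x y z := by
    obtain ⟨A, S⟩ := x
    obtain ⟨B, T⟩ := y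
    obtain ⟨C, U⟩ := z
    have hact : ∀ (A B : L₀ V) (T : ⋀[ℂ]^4 V), action ((A + B : L₀ V) : Module.End ℂ V) T =
        action A T + action B T := fun A B T => by
      rw [AddMemClass.coe_add, ← actionLin_apply, map_add]
      rfl
    have hlie : ∀ (A B : L₀ V) (T : ⋀[ℂ]^4 V), action ((⁅A, B⁆ : L₀ V) : Module.End ℂ V) T =
        action A (action B T) - action B (action A T) := fun A B T => action_lie _ _ T
    refine Prod.ext ?_ ?_
    · change ⁅A, ⁅B, C⁆ + bracketFour e δ T U⁆ +
          bracketFour e δ S (action B U - action C T) =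
        (⁅⁅A, B⁆ + bracketFour e δ S T, C⁆ + bracketFour e δ (action A T - action B S) U) +
        (⁅B, ⁅A, C⁆ + bracketFour e δ S U⁆ + bracketFour e δ T (action A U - action C S))
      simp only [← bracketBilin_apply, map_sub, LinearMap.sub_apply, lie_add, add_lie]
      rw [← lie_skew (bracketBilin e δ S T) C]
      simp only [bracketBilin_apply, lie_bracketFour]
      rw [leibniz_lie A B C, bracketFour_skew e δ T (action _ S)]
      abel
    · change action A (action B U - action C T) -
          action ((⁅B, C⁆ + bracketFour e δ T U : L₀ V) : Module.End ℂ V) S =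
        (action ((⁅A, B⁆ + bracketFour e δ S T : L₀ V) : Module.End ℂ V) U -
          action C (action A T - action B S)) +
        (action B (action A U - action C S) -
          action ((⁅A, C⁆ + bracketFour e δ S U : L₀ V) : Module.End ℂ V) T)
      have hJ := jacobiator_eq_zero e δ S T U
      rw [jacobiator_apply, bracketFour_skew e δ U S, NegMemClass.coe_neg, action_neg] at hJ
      simp only [hact, hlie, map_sub]
      rw [add_assoc, add_eq_zero_iff_eq_neg] at hJ
      rw [hJ]
      abel

end FourVector

end

/-! ### Matrices of trace zero and the simplicity of `L₀(V)`. -/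

noncomputable section

namespace FourVector

attribute [local instance 100] LieRing.ofAssociativeRing

universe u

variable {V : Type u} [AddCommGroup V] [Module ℂ V]

section Matrices

variable (e : Module.Basis (Fin 8) ℂ V)

theorem toMatrix_injective {A B : L₀ V}
    (h : LinearMap.toMatrix e e (A : Module.End ℂ V) = LinearMap.toMatrix e e B) : A = B :=
  Subtype.ext ((LinearMap.toMatrix e e).injective h)

theorem toMatrix_lie (A B : L₀ V) :
    LinearMap.toMatrix e e ((⁅A, B⁆ : L₀ V) : Module.End ℂ V) =
      LinearMap.toMatrix e e (A : Module.End ℂ V) * LinearMap.toMatrix e e (B : Module.End ℂ V) -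
      LinearMap.toMatrix e e (B : Module.End ℂ V) * LinearMap.toMatrix e e (A : Module.End ℂ V) := by
  rw [LieSubalgebra.coe_bracket, LieRing.of_associative_ring_bracket, map_sub,
    LinearMap.toMatrix_mul, LinearMap.toMatrix_mul]

theorem toMatrix_matrixUnit {i j : Fin 8} (hij : i ≠ j) :
    LinearMap.toMatrix e e (matrixUnit e i j hij : Module.End ℂ V) = Matrix.single i j 1 := by
  ext k l
  rw [LinearMap.toMatrix_apply]
  by_cases hl : l = j <;> by_cases hk : k = i
  · subst hl hk; simp [matrixUnit]
  · simp [matrixUnit, hl, Ne.symm hk]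
  · simp [matrixUnit, hl, Matrix.single_apply_of_col_ne _ _ (Ne.symm hl)]
  · simp [matrixUnit, hl, Matrix.single_apply_of_col_ne _ _ (Ne.symm hl)]

/-- The operator of trace zero that is diagonal in the basis `e` with entries `c`. -/
def diagOp (c : Fin 8 → ℂ) (hc : ∑ k, c k = 0) : L₀ V :=
  ⟨Matrix.toLin e e (Matrix.diagonal c), by
    rw [mem_L₀, LinearMap.trace_eq_matrix_trace ℂ e, LinearMap.toMatrix_toLin,
      Matrix.trace_diagonal, hc]⟩

@[simp] theorem toMatrix_diagOp (c : Fin 8 → ℂ) (hc : ∑ k, c k = 0) :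
    LinearMap.toMatrix e e (diagOp e c hc : Module.End ℂ V) = Matrix.diagonal c :=
  LinearMap.toMatrix_toLin _ _ _

theorem diagOp_apply (c : Fin 8 → ℂ) (hc : ∑ k, c k = 0) (k : Fin 8) :
    (diagOp e c hc : Module.End ℂ V) (e k) = c k • e k := by
  change Matrix.toLin e e (Matrix.diagonal c) (e k) = _
  rw [Matrix.toLin_self, Finset.sum_eq_single k]
  · simp
  · intro j _ hj; simp [hj]
  · simp

theorem sum_single_sub_single (i j : Fin 8) :
    ∑ k, (Pi.single i 1 - Pi.single j 1 : Fin 8 → ℂ) k = 0 := by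
  simp

theorem lie_matrixUnit_symm {i j : Fin 8} (hij : i ≠ j) :
    ⁅matrixUnit e i j hij, matrixUnit e j i hij.symm⁆ =
      diagOp e (Pi.single i 1 - Pi.single j 1) (sum_single_sub_single i j) := by
  apply toMatrix_injective e
  rw [toMatrix_lie, toMatrix_matrixUnit, toMatrix_matrixUnit, toMatrix_diagOp,
    Matrix.single_mul_single_same, Matrix.single_mul_single_same, mul_one]
  ext k l
  by_cases h : k = l
  · subst h
    simp [Matrix.single_apply, Pi.single_apply, eq_comm]
  · have h1 : ∀ i, ¬(i = k ∧ i = l) := fun i hi => h (hi.1.symm.trans hi.2)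
    simp [h, h1]

/-- With `E = e_j ⊗ e^i` one has `E² = 0` and `E A E = A_ij E`, so only the cross term `-2 E A E`
survives. It extracts a matrix unit from any operator with a non-zero entry off the diagonal. -/
theorem lie_lie_matrixUnit {i j : Fin 8} (hij : i ≠ j) (A : L₀ V) :
    ⁅matrixUnit e j i hij.symm, ⁅matrixUnit e j i hij.symm, A⁆⁆ =
      (-2 * LinearMap.toMatrix e e (A : Module.End ℂ V) i j) • matrixUnit e j i hij.symm := by
  apply toMatrix_injective e
  change _ = LinearMap.toMatrix e e (_ • (matrixUnit e j i hij.symm : Module.End ℂ V))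
  rw [toMatrix_lie, toMatrix_lie, map_smul, toMatrix_matrixUnit]
  set M := LinearMap.toMatrix e e (A : Module.End ℂ V)
  have h1 : Matrix.single j i (1 : ℂ) * Matrix.single j i 1 = 0 :=
    Matrix.single_mul_single_of_ne _ _ _ _ hij _
  have h2 : Matrix.single j i (1 : ℂ) * M * Matrix.single j i 1 = M i j • Matrix.single j i 1 := by
    rw [Matrix.single_mul_mul_single]
    simp
  have h3 : Matrix.single j i (1 : ℂ) * (Matrix.single j i 1 * M - M * Matrix.single j i 1) -
      (Matrix.single j i 1 * M - M * Matrix.single j i 1) * Matrix.single j i 1 =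
      (Matrix.single j i 1 * Matrix.single j i 1) * M +
        M * (Matrix.single j i 1 * Matrix.single j i 1) -
        (2 : ℂ) • (Matrix.single j i (1 : ℂ) * M * Matrix.single j i 1) := by
    rw [two_smul]
    noncomm_ring
  rw [h3, h1, h2]
  simp

theorem toMatrix_lie_matrixUnit {i j : Fin 8} (hij : i ≠ j) (A : L₀ V) :
    LinearMap.toMatrix e e ((⁅matrixUnit e i j hij, A⁆ : L₀ V) : Module.End ℂ V) i j =
      LinearMap.toMatrix e e (A : Module.End ℂ V) j j -
        LinearMap.toMatrix e e (A : Module.End ℂ V) i i := by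
  rw [toMatrix_lie, toMatrix_matrixUnit]
  simp

theorem exists_ne_of_isDiag {A : L₀ V} (hA0 : A ≠ 0)
    (hA : (LinearMap.toMatrix e e (A : Module.End ℂ V)).IsDiag) :
    ∃ i j, i ≠ j ∧ LinearMap.toMatrix e e (A : Module.End ℂ V) j j -
        LinearMap.toMatrix e e (A : Module.End ℂ V) i i ≠ 0 := by
  by_contra! h
  apply hA0
  apply toMatrix_injective e
  have htr : (LinearMap.toMatrix e e (A : Module.End ℂ V)).trace = 0 := by
    rw [← LinearMap.trace_eq_matrix_trace ℂ e]; exact A.2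
  have hall : ∀ i, LinearMap.toMatrix e e (A : Module.End ℂ V) i i =
      LinearMap.toMatrix e e (A : Module.End ℂ V) 0 0 := by
    intro i
    by_cases hi : i = 0
    · rw [hi]
    · exact sub_eq_zero.mp (h 0 i (Ne.symm hi))
  rw [Matrix.trace] at htr
  simp only [Matrix.diag_apply, hall, Finset.sum_const, Finset.card_univ, Fintype.card_fin,
    nsmul_eq_mul] at htr
  have h0 : LinearMap.toMatrix e e (A : Module.End ℂ V) 0 0 = 0 := by
    simpa using htr
  ext k l
  by_cases hkl : k = l
  · subst hkl; rw [hall, h0]; simp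
  · rw [hA hkl]; simp

/-- A nonzero subspace of `L₀(V)` that is stable under the matrix units is everything. -/
theorem eq_top_of_lie_matrixUnit_mem {N : Submodule ℂ (L₀ V)}
    (hN : ∀ i j (hij : i ≠ j), ∀ A ∈ N, ⁅matrixUnit e i j hij, A⁆ ∈ N) (h0 : N ≠ ⊥) : N = ⊤ := by
  obtain ⟨A, hA, hA0⟩ := Submodule.exists_mem_ne_zero_of_ne_bot h0
  have hoff : ∀ A ∈ N, ∀ i j (hij : i ≠ j),
      LinearMap.toMatrix e e (A : Module.End ℂ V) i j ≠ 0 → matrixUnit e j i hij.symm ∈ N := by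
    intro A hA i j hij h
    have h1 := hN j i hij.symm _ (hN j i hij.symm A hA)
    rw [lie_lie_matrixUnit e hij] at h1
    exact (N.smul_mem_iff (by simpa using h)).mp h1
  -- A non-zero diagonal operator of trace zero has two different entries; its bracket with the
  -- corresponding matrix unit has an entry off the diagonal.
  have hone : ∃ i j, ∃ hij : i ≠ j, matrixUnit e i j hij ∈ N := by
    by_cases hd : (LinearMap.toMatrix e e (A : Module.End ℂ V)).IsDiag
    · obtain ⟨i, j, hij, h⟩ := exists_ne_of_isDiag e hA0 hd
      exact ⟨j, i, hij.symm, hoff _ (hN i j hij A hA) i j hij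
        (by rwa [toMatrix_lie_matrixUnit e hij])⟩
    · simp only [Matrix.IsDiag, Pairwise, not_forall] at hd
      obtain ⟨i, j, hij, h⟩ := hd
      exact ⟨j, i, hij.symm, hoff A hA i j hij h⟩
  have hrow : ∀ i j k (hij : i ≠ j) (hkj : k ≠ j), matrixUnit e i j hij ∈ N →
      matrixUnit e k j hkj ∈ N := by
    intro i j k hij hkj h
    by_cases hki : k = i
    · subst hki; exact h
    have h1 := hN k i hki _ h
    convert h1
    apply toMatrix_injective e
    rw [toMatrix_lie]
    simp only [toMatrix_matrixUnit]
    rw [Matrix.single_mul_single_same, Matrix.single_mul_single_of_ne _ _ _ _ hkj.symm]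
    simp
  have hcol : ∀ i j l (hij : i ≠ j) (hil : i ≠ l), matrixUnit e i j hij ∈ N →
      matrixUnit e i l hil ∈ N := by
    intro i j l hij hil h
    by_cases hlj : l = j
    · subst hlj; exact h
    have h1 := N.neg_mem (hN j l (Ne.symm hlj) _ h)
    convert h1
    apply toMatrix_injective e
    change _ = LinearMap.toMatrix e e (-((⁅_, _⁆ : L₀ V) : Module.End ℂ V))
    rw [map_neg, toMatrix_lie]
    simp only [toMatrix_matrixUnit]
    rw [Matrix.single_mul_single_same, Matrix.single_mul_single_of_ne _ _ _ _ hil.symm]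
    simp
  have hall : ∀ k l (hkl : k ≠ l), matrixUnit e k l hkl ∈ N := by
    obtain ⟨i, j, hij, h⟩ := hone
    intro k l hkl
    -- The detour through row `m` keeps the row and column indices distinct at each stage from `(i,
    -- j)` to `(k, l)`.
    obtain ⟨m, hmj, hml⟩ : ∃ m : Fin 8, m ≠ j ∧ m ≠ l :=
      (by decide : ∀ j l : Fin 8, ∃ m : Fin 8, m ≠ j ∧ m ≠ l) j l
    exact hrow m l k hml hkl (hcol m j l hmj hml (hrow i j m hij hmj h))
  have hdiag : ∀ i j, i ≠ j →
      diagOp e (Pi.single i 1 - Pi.single j 1) (sum_single_sub_single i j) ∈ N := by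
    intro i j hij
    rw [← lie_matrixUnit_symm e hij]
    exact hN _ _ _ _ (hall _ _ _)
  rw [eq_top_iff]
  rintro A -
  -- The diagonal matrix units do not have trace zero and are corrected by subtracting the one at
  -- position 0; in the expansion of `A` the corrections add up to the trace of `A`, which is zero.
  let U : Fin 8 → Fin 8 → L₀ V := fun i j => if h : i ≠ j then matrixUnit e i j h else
    diagOp e (Pi.single i 1 - Pi.single 0 1) (sum_single_sub_single i 0)
  have hU : ∀ i j, U i j ∈ N := by
    intro i j
    by_cases h : i ≠ j
    · simp only [U, dif_pos h]; exact hall i j h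
    · simp only [U, dif_neg h]
      by_cases hi : i = 0
      · have : diagOp e (Pi.single i 1 - Pi.single 0 1) (sum_single_sub_single i 0) = 0 := by
          apply toMatrix_injective e
          simp [hi]
        rw [this]; exact N.zero_mem
      · exact hdiag i 0 hi
  have hUm : ∀ i j, LinearMap.toMatrix e e (U i j : Module.End ℂ V) =
      Matrix.single i j 1 - if i = j then Matrix.single 0 0 1 else 0 := by
    intro i j
    by_cases h : i ≠ j
    · simp only [U, dif_pos h, toMatrix_matrixUnit, if_neg h, sub_zero]
    · simp only [U, dif_neg h, toMatrix_diagOp]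
      rw [not_not] at h
      subst h
      simp only [if_true, ← Matrix.diagonal_single, Matrix.diagonal_sub]
      rfl
  have hA : A = ∑ i, ∑ j, LinearMap.toMatrix e e (A : Module.End ℂ V) i j • U i j := by
    apply toMatrix_injective e
    set M := LinearMap.toMatrix e e (A : Module.End ℂ V) with hM
    have htr : ∑ i, M i i = 0 := by
      have : M.trace = 0 := by
        rw [hM, ← LinearMap.trace_eq_matrix_trace ℂ e]; exact A.2
      exact this
    have hc : ((∑ i, ∑ j, M i j • U i j : L₀ V) : Module.End ℂ V) =
        ∑ i, ∑ j, M i j • (U i j : Module.End ℂ V) := by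
      simp only [AddSubmonoidClass.coe_finsetSum]
      rfl
    rw [hc]
    simp only [map_sum, map_smul, hUm, smul_sub, Finset.sum_sub_distrib, smul_ite, smul_zero,
      Finset.sum_ite_eq, Finset.mem_univ, if_true]
    rw [← Finset.sum_smul, htr, zero_smul, sub_zero]
    conv_lhs => rw [Matrix.matrix_eq_sum_single M]
    simp
  rw [hA]
  exact N.sum_mem fun i _ => N.sum_mem fun j _ => N.smul_mem _ (hU i j)

theorem isSimple_L₀ (e : Module.Basis (Fin 8) ℂ V) : LieAlgebra.IsSimple ℂ (L₀ V) where
  eq_bot_or_eq_top I := by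
    by_cases h : I = ⊥
    · exact Or.inl h
    · right
      rw [← LieSubmodule.toSubmodule_eq_top]
      refine eq_top_of_lie_matrixUnit_mem e (fun i j hij A hA => lie_mem_right ℂ _ I _ _ hA) ?_
      rwa [Ne, LieSubmodule.toSubmodule_eq_bot]
  non_abelian h := by
    have h1 := lie_matrixUnit_symm e (show (0 : Fin 8) ≠ 1 by decide)
    rw [h.trivial] at h1
    have h2 := congrArg (fun A : L₀ V => LinearMap.toMatrix e e (A : Module.End ℂ V) 0 0) h1
    simp at h2

end Matrices

end FourVector

end

/-! ### The grading and the simplicity of `𝔤`. -/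

noncomputable section

namespace FourVector

attribute [local instance 100] LieRing.ofAssociativeRing

universe u

variable {V : Type u} [AddCommGroup V] [Module ℂ V]

section

variable (e : Module.Basis (Fin 8) ℂ V) (δ : V [⋀^Fin 8]→ₗ[ℂ] ℂ)

theorem bracketFour_zero_left (T : ⋀[ℂ]^4 V) : bracketFour e δ 0 T = 0 := by
  rw [← bracketBilin_apply, map_zero]; rfl

theorem action_zero (T : ⋀[ℂ]^4 V) : action (0 : Module.End ℂ V) T = 0 := by
  rw [← actionLin_apply, map_zero]; rfl

theorem lie_inl (A : L₀ V) (x : 𝔤 e δ) :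
    ⁅inl e δ A, x⁆ = (⁅A, x.1⁆, action (A : Module.End ℂ V) x.2) := by
  refine Prod.ext ?_ ?_
  · change ⁅A, x.1⁆ + bracketFour e δ 0 x.2 = _
    rw [bracketFour_zero_left, add_zero]
  · change action (A : Module.End ℂ V) x.2 - action (x.1 : Module.End ℂ V) (0 : ⋀[ℂ]^4 V) =
      action (A : Module.End ℂ V) x.2
    rw [map_zero, sub_zero]

theorem lie_inl_inr (A : L₀ V) (T : ⋀[ℂ]^4 V) :
    ⁅inl e δ A, inr e δ T⁆ = inr e δ (action (A : Module.End ℂ V) T) := by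
  rw [lie_inl]
  refine Prod.ext ?_ rfl
  exact lie_zero A

theorem lie_inr_inr (S T : ⋀[ℂ]^4 V) :
    ⁅inr e δ S, inr e δ T⁆ = inl e δ (bracketFour e δ S T) := by
  refine Prod.ext ?_ ?_
  · change ⁅(0 : L₀ V), (0 : L₀ V)⁆ + bracketFour e δ S T = bracketFour e δ S T
    rw [lie_zero, zero_add]
  · change action (0 : Module.End ℂ V) T - action (0 : Module.End ℂ V) S = 0
    rw [action_zero, action_zero, sub_zero]

variable [IsLieBracket e δ]

theorem lie_inr_inl (A : L₀ V) (T : ⋀[ℂ]^4 V) :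
    ⁅inr e δ T, inl e δ A⁆ = -inr e δ (action (A : Module.End ℂ V) T) := by
  rw [← lie_skew, lie_inl_inr]

/-- The grading of `𝔤` modulo `2`. -/
theorem nonempty_gradedLieAlgebra : Nonempty (GradedLieAlgebra (grading e δ)) := by
  have h0 : grading e δ 0 = LinearMap.range (inl e δ) := if_pos rfl
  have h1 : grading e δ 1 = LinearMap.range (inr e δ) := if_neg one_ne_zero
  have key : ∀ k : ZMod 2, k = 0 ∨ k = 1 := by decide
  have hI : DirectSum.IsInternal (grading e δ) := by
    rw [DirectSum.isInternal_submodule_iff_isCompl (grading e δ) (i := 0) (j := 1) zero_ne_one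
      (by ext k; simpa using key k), h0, h1]
    exact LinearMap.isCompl_range_inl_inr
  refine ⟨{ hI.chooseDecomposition with bracket_mem := ?_ }⟩
  intro i j x y hx hy
  rcases key i with rfl | rfl <;> rcases key j with rfl | rfl
  · rw [add_zero]
    rw [h0] at hx hy ⊢
    obtain ⟨A, rfl⟩ := hx
    obtain ⟨B, rfl⟩ := hy
    exact ⟨_, (lie_inl_inl e δ A B).symm⟩
  · rw [zero_add]
    rw [h0] at hx
    rw [h1] at hy ⊢
    obtain ⟨A, rfl⟩ := hx
    obtain ⟨B, rfl⟩ := hy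
    exact ⟨_, (lie_inl_inr e δ A B).symm⟩
  · rw [add_zero]
    rw [h0] at hy
    rw [h1] at hx ⊢
    obtain ⟨A, rfl⟩ := hx
    obtain ⟨B, rfl⟩ := hy
    exact ⟨-action (B : Module.End ℂ V) A, by rw [lie_inr_inl, map_neg]⟩
  · rw [show (1 : ZMod 2) + 1 = 0 by decide]
    rw [h1] at hx hy
    rw [h0]
    obtain ⟨A, rfl⟩ := hx
    obtain ⟨B, rfl⟩ := hy
    exact ⟨_, (lie_inr_inr e δ A B).symm⟩

end

section Components

variable (e : Module.Basis (Fin 8) ℂ V)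

theorem exists_component_ne_zero {T : ⋀[ℂ]^4 V} (hT : T ≠ 0) :
    ∃ i : Fin 4 → Fin 8, StrictMono i ∧ component e T i ≠ 0 := by
  by_contra! h
  apply hT
  refine (e.exteriorPower 4).ext_elem fun s => ?_
  rw [exteriorPower.basis_repr_apply, map_zero, Finsupp.zero_apply]
  exact h _ (OrderEmbedding.strictMono _)

theorem exists_notMem_range (p : Fin 4 → Fin 8) : ∃ k, ∀ a, p a ≠ k := by
  by_contra! h
  have := Fintype.card_le_of_surjective p h
  simp at this

theorem exists_complement {p : Fin 4 → Fin 8} (hp : Function.Injective p) :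
    ∃ q : Fin 4 → Fin 8, Function.Injective q ∧ ∀ a b, p a ≠ q b := by
  have hc : ((Finset.univ.image p)ᶜ).card = 4 := by
    rw [Finset.card_compl, Finset.card_image_of_injective _ hp]; rfl
  refine ⟨((Finset.univ.image p)ᶜ).orderEmbOfFin hc, (OrderEmbedding.strictMono _).injective,
    fun a b h => ?_⟩
  have := Finset.orderEmbOfFin_mem ((Finset.univ.image p)ᶜ) hc b
  rw [← h] at this
  simp at this

theorem bijective_sumElim {p q : Fin 4 → Fin 8} (hp : Function.Injective p)
    (hq : Function.Injective q) (hpq : ∀ a b, p a ≠ q b) :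
    Function.Bijective (Sum.elim p q) := by
  rw [Fintype.bijective_iff_injective_and_card]
  exact ⟨hp.sumElim hq hpq, rfl⟩

theorem vol_basis_ne_zero {δ : V [⋀^Fin 8]→ₗ[ℂ] ℂ} (hδ : δ ≠ 0) {p q : Fin 4 → Fin 8}
    (hp : Function.Injective p) (hq : Function.Injective q) (hpq : ∀ a b, p a ≠ q b) :
    vol δ (Sum.elim (fun a => e (p a)) fun a => e (q a)) ≠ 0 := by
  let σ := Equiv.ofBijective _ (bijective_sumElim hp hq hpq)
  have hv : vol δ ≠ 0 := by
    intro h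
    apply hδ
    have : δ = (vol δ).domDomCongr (finSumFinEquiv (m := 4) (n := 4)) := by
      ext v
      change δ _ = δ _
      congr 1
      funext a
      simp
    rw [this, h]
    rfl
  have h := (AlternatingMap.map_basis_ne_zero_iff (e.reindex σ.symm) (vol δ)).mpr hv
  convert h using 2
  funext a
  rcases a with a | a <;> simp [σ]

theorem component_wedge_self {p : Fin 4 → Fin 8} (hp : Function.Injective p) :
    component e (wedge e p) p = 1 := by
  rw [wedge, component_ιMulti, ← Matrix.det_one (n := Fin 4)]
  congr 1
  ext a b
  rw [Matrix.of_apply, e.coord_apply, e.repr_self, Finsupp.single_apply, Matrix.one_apply]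
  simp only [hp.eq_iff]

theorem component_wedge_eq_zero {p i : Fin 4 → Fin 8} {a : Fin 4} (h : ∀ b, i b ≠ p a) :
    component e (wedge e p) i = 0 := by
  rw [wedge, component_ιMulti]
  apply Matrix.det_eq_zero_of_row_eq_zero a
  intro b
  rw [Matrix.of_apply, e.coord_apply, e.repr_self, Finsupp.single_apply, if_neg (h b).symm]

theorem exists_notMem_of_ne {p i : Fin 4 → Fin 8} (hp : StrictMono p) (hi : StrictMono i)
    (h : p ≠ i) : ∃ a, ∀ b, i b ≠ p a := by
  by_contra! hcon
  apply h
  have hsub : Finset.univ.image p ⊆ Finset.univ.image i := by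
    intro x hx
    obtain ⟨a, -, rfl⟩ := Finset.mem_image.mp hx
    obtain ⟨b, hb⟩ := hcon a
    exact Finset.mem_image.mpr ⟨b, Finset.mem_univ _, hb⟩
  have heq : Finset.univ.image p = Finset.univ.image i := by
    apply Finset.eq_of_subset_of_card_le hsub
    rw [Finset.card_image_of_injective _ hp.injective, Finset.card_image_of_injective _ hi.injective]
  have hr : Set.range p = Set.range i := by
    have := congrArg (fun s : Finset (Fin 8) => (s : Set (Fin 8))) heq
    simpa using this
  exact StrictMono.range_inj hp hi |>.mp hr

theorem wedge_ne_zero {p : Fin 4 → Fin 8} (hp : Function.Injective p) : wedge e p ≠ 0 := by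
  intro h
  have h1 := component_wedge_self e hp
  rw [h] at h1
  simp [component] at h1

/-- Bracketing with the complementary basis four-vector detects the component `T^i` in a diagonal
entry. Hence a non-zero four-vector has a non-zero bracket with some basis four-vector. -/
theorem coord_bracketFour_wedge (δ : V [⋀^Fin 8]→ₗ[ℂ] ℂ) {i q : Fin 4 → Fin 8}
    (hi : StrictMono i) (hiq : Function.Bijective (Sum.elim i q)) (T : ⋀[ℂ]^4 V) :
    e.coord (i 0) ((bracketFour e δ T (wedge e q) : Module.End ℂ V) (e (i 0))) =
      (1 / 2 * vol δ (Sum.elim (fun a => e (q a)) fun a => e (i a))) * component e T i := by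
  let f : ⋀[ℂ]^4 V →ₗ[ℂ] ℂ :=
    (e.coord (i 0)) ∘ₗ (LinearMap.applyₗ (e (i 0))) ∘ₗ (L₀ V).toSubmodule.subtype ∘ₗ
      (bracketBilin e δ).flip (wedge e q)
  let g : ⋀[ℂ]^4 V →ₗ[ℂ] ℂ := (1 / 2 * vol δ (Sum.elim (fun a => e (q a)) fun a => e (i a))) •
    exteriorPower.pairingDual ℂ V 4 (exteriorPower.ιMulti ℂ 4 fun a => e.coord (i a))
  have hne : ∀ a b, i a ≠ q b := fun a b h => by
    have := hiq.1 (a₁ := Sum.inl a) (a₂ := Sum.inr b) (by simpa using h)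
    simp at this
  suffices h : T ∈ LinearMap.ker (f - g) by
    rw [LinearMap.mem_ker, LinearMap.sub_apply, sub_eq_zero] at h
    exact h
  refine mem_of_forall_wedge_mem e (fun p hp => ?_) T
  rw [LinearMap.mem_ker, LinearMap.sub_apply, sub_eq_zero]
  change e.coord (i 0) ((bracketFour e δ (wedge e p) (wedge e q) : Module.End ℂ V) (e (i 0))) =
      (1 / 2 * vol δ (Sum.elim (fun a => e (q a)) fun a => e (i a))) * component e (wedge e p) i
  have hb : (bracketFour e δ (wedge e p) (wedge e q) : Module.End ℂ V) = _ :=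
    coe_bracketFour_ιMulti e δ (fun a => e (p a)) (fun a => e (q a))
  rw [hb, LinearMap.smul_apply, LinearMap.sub_apply, map_smul, map_sub]
  -- The image of this contraction is spanned by the `e (q b)`, none of which is `e (i 0)`.
  have h1 : e.coord (i 0) (contraction δ (fun a => e (p a)) (fun a => e (q a)) (e (i 0))) = 0 := by
    rw [contraction_apply, map_sum]
    refine Finset.sum_eq_zero fun b _ => ?_
    rw [map_smul, e.coord_apply, e.repr_self, Finsupp.single_eq_of_ne (hne 0 b), smul_zero]
  have h2 : e.coord (i 0) (contraction δ (fun a => e (q a)) (fun a => e (p a)) (e (i 0))) =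
      vol δ (Sum.elim (fun a => e (q a)) fun a => e (i a)) * component e (wedge e p) i := by
    by_cases hpi : p = i
    · subst hpi
      rw [contraction_apply_right δ _ (fun a => e (p a)) 0, component_wedge_self e hp.injective]
      simp
    · obtain ⟨a, ha⟩ := exists_notMem_of_ne hp hi hpi
      rw [component_wedge_eq_zero e ha, mul_zero, contraction_apply, map_sum]
      obtain ⟨c, hc⟩ := hiq.2 (p a)
      rcases c with c | c
      · exact absurd hc (ha c)
      · refine Finset.sum_eq_zero fun b _ => ?_
        by_cases hb : b = a
        · rw [map_smul, e.coord_apply, e.repr_self, hb, Finsupp.single_eq_of_ne (ha 0), smul_zero]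
        · rw [vol_eq_zero_of_eq δ (a := c) (b := a), zero_smul, map_zero]
          rw [Function.update_of_ne (Ne.symm hb)]
          exact congrArg e hc
  rw [h1, h2]
  simp only [smul_eq_mul]
  ring

/-- Once `e_j` has been replaced by `e_i`, no factor `e_j` is left to be replaced. -/
theorem action_matrixUnit_sq {i j : Fin 8} (hij : i ≠ j) (T : ⋀[ℂ]^4 V) :
    action (matrixUnit e i j hij : Module.End ℂ V)
      (action (matrixUnit e i j hij : Module.End ℂ V) T) = 0 := by
  refine mem_of_forall_wedge_mem e (N := LinearMap.ker
    (action (matrixUnit e i j hij : Module.End ℂ V) ∘ₗ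
      action (matrixUnit e i j hij : Module.End ℂ V))) (fun p hp => ?_) T
  rw [LinearMap.mem_ker, LinearMap.comp_apply]
  by_cases h : ∃ a, p a = j
  · obtain ⟨a, ha⟩ := h
    rw [action_matrixUnit_wedge e hij hp.injective ha]
    apply action_matrixUnit_wedge_of_notMem
    intro b
    by_cases hb : b = a
    · subst hb; simpa using hij
    · rw [Function.update_of_ne hb, ← ha]
      exact fun h => hb (hp.injective h)
  · push Not at h
    rw [action_matrixUnit_wedge_of_notMem e hij h, map_zero]

end Components

variable (e : Module.Basis (Fin 8) ℂ V) {δ : V [⋀^Fin 8]→ₗ[ℂ] ℂ}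

/-- The ideal `I` need not be graded. If some element has a non-zero part in `L₀(V)`, the square of
the adjoint action of a matrix unit removes the four-vector part and leaves a matrix unit in `I`. An
element of `⋀⁴V` is first moved into `L₀(V)` by `coord_bracketFour_wedge`. Then `I` contains the
simple algebra `L₀(V)`. -/
theorem isSimple_𝔤 (hδ : δ ≠ 0) [IsLieBracket e δ] : LieAlgebra.IsSimple ℂ (𝔤 e δ) where
  eq_bot_or_eq_top I := by
    by_cases h : I = ⊥
    · exact Or.inl h
    right
    let N : Submodule ℂ (L₀ V) := I.toSubmodule.comap (inl e δ)
    have hN : ∀ i j (hij : i ≠ j), ∀ A ∈ N, ⁅matrixUnit e i j hij, A⁆ ∈ N := by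
      intro i j hij A hA
      change inl e δ _ ∈ I
      rw [← lie_inl_inl]
      exact lie_mem_right ℂ _ I _ _ hA
    have hoff : ∀ x ∈ I, ∀ i j (hij : i ≠ j),
        LinearMap.toMatrix e e (x.1 : Module.End ℂ V) i j ≠ 0 → N ≠ ⊥ := by
      intro x hx i j hij hx0 hbot
      have h1 : ⁅inl e δ (matrixUnit e j i hij.symm), ⁅inl e δ (matrixUnit e j i hij.symm), x⁆⁆ ∈
          I := lie_mem_right ℂ _ I _ _ (lie_mem_right ℂ _ I _ _ hx)
      have h2 : ⁅inl e δ (matrixUnit e j i hij.symm), ⁅inl e δ (matrixUnit e j i hij.symm), x⁆⁆ =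
          inl e δ ((-2 * LinearMap.toMatrix e e (x.1 : Module.End ℂ V) i j) •
            matrixUnit e j i hij.symm) := by
        rw [lie_inl, lie_inl]
        exact Prod.ext (lie_lie_matrixUnit e hij x.1) (action_matrixUnit_sq e hij.symm x.2)
      rw [h2] at h1
      have h3 : (-2 * LinearMap.toMatrix e e (x.1 : Module.End ℂ V) i j) •
            matrixUnit e j i hij.symm ∈ N := h1
      rw [hbot, Submodule.mem_bot] at h3
      have h4 : matrixUnit e j i hij.symm = 0 :=
        (smul_eq_zero.mp h3).resolve_left (by simpa using hx0)
      have h5 := toMatrix_matrixUnit e hij.symm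
      rw [h4] at h5
      have h6 := congrFun (congrFun h5 j) i
      simp at h6
    have hleft : ∀ x ∈ I, x.1 ≠ 0 → N ≠ ⊥ := by
      intro x hx hx0
      by_cases hd : (LinearMap.toMatrix e e (x.1 : Module.End ℂ V)).IsDiag
      · obtain ⟨i, j, hij, h⟩ := exists_ne_of_isDiag e hx0 hd
        refine hoff ⁅inl e δ (matrixUnit e i j hij), x⁆ (lie_mem_right ℂ _ I _ _ hx) i j hij ?_
        rw [lie_inl, toMatrix_lie_matrixUnit e hij]
        exact h
      · simp only [Matrix.IsDiag, Pairwise, not_forall] at hd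
        obtain ⟨i, j, hij, h⟩ := hd
        exact hoff x hx i j hij h
    have hN0 : N ≠ ⊥ := by
      obtain ⟨x, hx, hx0⟩ := Submodule.exists_mem_ne_zero_of_ne_bot
        (p := I.toSubmodule) (by rwa [Ne, LieSubmodule.toSubmodule_eq_bot])
      by_cases hx1 : x.1 = 0
      · have hx2 : x.2 ≠ 0 := fun h => hx0 (Prod.ext hx1 h)
        obtain ⟨i, hi, hc⟩ := exists_component_ne_zero e hx2
        obtain ⟨q, hq, hiq⟩ := exists_complement hi.injective
        refine hleft ⁅x, inr e δ (wedge e q)⁆ (lie_mem_left ℂ _ I _ _ hx) fun h0 => ?_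
        have hxr : x = inr e δ x.2 := Prod.ext hx1 rfl
        rw [hxr, lie_inr_inr] at h0
        have h1 := coord_bracketFour_wedge e δ hi (bijective_sumElim hi.injective hq hiq) x.2
        have h2 : bracketFour e δ x.2 (wedge e q) = 0 := h0
        rw [h2] at h1
        have h3 := vol_basis_ne_zero e hδ hi.injective hq hiq
        rw [vol_comm] at h1
        simp [hc, h3] at h1
      · exact hleft x hx hx1
    have hNtop := eq_top_of_lie_matrixUnit_mem e hN hN0
    have hl : ∀ A : L₀ V, inl e δ A ∈ I := fun A => by
      have : A ∈ N := by rw [hNtop]; trivial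
      exact this
    have hr : ∀ T : ⋀[ℂ]^4 V, inr e δ T ∈ I := by
      refine mem_of_forall_wedge_mem e (N := I.toSubmodule.comap (inr e δ)) fun p hp => ?_
      -- `wedge e p` is the image, under a matrix unit, of the basis four-vector with its first
      -- index replaced by an unused `k`.
      obtain ⟨k, hk⟩ := exists_notMem_range p
      have hq : Function.Injective (Function.update p 0 k) := by
        intro a b hab
        by_cases ha : a = 0 <;> by_cases hb : b = 0
        · rw [ha, hb]
        · subst ha
          rw [Function.update_self, Function.update_of_ne hb] at hab
          exact absurd hab.symm (hk b)
        · subst hb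
          rw [Function.update_self, Function.update_of_ne ha] at hab
          exact absurd hab (hk a)
        · rw [Function.update_of_ne ha, Function.update_of_ne hb] at hab
          exact hp.injective hab
      have h1 := action_matrixUnit_wedge e (hk 0) hq (a := 0) (by simp)
      rw [Function.update_idem, Function.update_eq_self] at h1
      change inr e δ _ ∈ I
      rw [← h1, ← lie_inl_inr]
      exact lie_mem_left ℂ _ I _ _ (hl _)
    rw [← LieSubmodule.toSubmodule_eq_top, eq_top_iff]
    rintro x -
    have hx : x = inl e δ x.1 + inr e δ x.2 :=
      Prod.ext (add_zero x.1).symm (zero_add x.2).symm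
    rw [hx]
    exact I.add_mem (hl _) (hr _)
  non_abelian h := by
    have h1 := lie_inl_inl e δ (matrixUnit e 0 1 (by decide)) (matrixUnit e 1 0 (by decide))
    rw [lie_matrixUnit_symm, h.trivial] at h1
    have h2 : (0 : L₀ V) = diagOp e _ (sum_single_sub_single 0 1) := congrArg Prod.fst h1
    have h3 := congrArg (fun A : L₀ V => LinearMap.toMatrix e e (A : Module.End ℂ V) 0 0) h2
    simp at h3

end FourVector

end

/-! ### Roots from eigenvectors, Chevalley generators, and the diagonal Cartan subalgebras. -/

noncomputable section

namespace FourVector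

attribute [local instance 100] LieRing.ofAssociativeRing

universe u

variable {V : Type u} [AddCommGroup V] [Module ℂ V]

section Killing

open LieAlgebra LieAlgebra.IsKilling

variable {L : Type*} [LieRing L] [LieAlgebra ℂ L] [FiniteDimensional ℂ L]
  {H : LieSubalgebra ℂ L} [H.IsCartanSubalgebra]

theorem exists_weight_of_lie_eq {α : Module.Dual ℂ H} {x : L} (hx : x ≠ 0)
    (h : ∀ a : H, ⁅(a : L), x⁆ = α a • x) :
    ∃ χ : LieModule.Weight ℂ H L, χ.toLinear = α ∧ x ∈ rootSpace H χ := by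
  have hmem : x ∈ rootSpace H α := by
    apply LieModule.weightSpace_le_genWeightSpace
    rw [LieModule.mem_weightSpace]
    exact h
  refine ⟨⟨α, fun hbot => hx ?_⟩, ?_, hmem⟩
  · rw [rootSpace, hbot] at hmem
    simpa using hmem
  · ext a; rfl

variable [LieAlgebra.IsKilling ℂ L]

theorem root_of_lie_eq {α : Module.Dual ℂ H} (hα : α ≠ 0) {x : L} (hx : x ≠ 0)
    (h : ∀ a : H, ⁅(a : L), x⁆ = α a • x) :
    ∃ χ : H.root, (rootSystem H).root χ = α ∧ x ∈ rootSpace H χ.1 := by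
  obtain ⟨χ, hχ, hxχ⟩ := exists_weight_of_lie_eq hx h
  refine ⟨⟨χ, ?_⟩, hχ, hxχ⟩
  simp only [LieSubalgebra.root, Finset.mem_filter, Finset.mem_univ, true_and]
  intro h0
  apply hα
  rw [← hχ]
  ext a
  exact congrFun h0 a

/-- Root spaces of a Killing Lie algebra are one-dimensional, so a single eigenvector spans. -/
theorem rootSpace_eq_span {α : Module.Dual ℂ H} (hα : α ≠ 0) {x : L} (hx : x ≠ 0)
    (h : ∀ a : H, ⁅(a : L), x⁆ = α a • x) :
    (rootSpace H α).toSubmodule = Submodule.span ℂ {x} := by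
  obtain ⟨χ, hχ, hxχ⟩ := root_of_lie_eq hα hx h
  have hχ' : (χ.1 : H → ℂ) = α := by rw [← hχ]; rfl
  have h1 := finrank_rootSpace_eq_one χ.1 (Finset.mem_filter.mp χ.2).2
  rw [hχ'] at h1 hxχ
  refine le_antisymm (fun y hy => ?_) ?_
  · obtain ⟨c, hc⟩ := (finrank_eq_one_iff_of_nonzero' (⟨x, hxχ⟩ : rootSpace H α)
      (by simpa using hx)).mp h1 ⟨y, hy⟩
    exact Submodule.mem_span_singleton.mpr ⟨c, congrArg Subtype.val hc⟩
  · rw [Submodule.span_singleton_le_iff_mem]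
    exact hxχ

theorem exists_eigenvector_of_root (χ : H.root) :
    (rootSystem H).root χ ≠ 0 ∧
      ∃ x : L, x ≠ 0 ∧ ∀ a : H, ⁅(a : L), x⁆ = (rootSystem H).root χ a • x := by
  refine ⟨(rootSystem H).ne_zero χ, ?_⟩
  obtain ⟨x, hx, hx0⟩ := χ.1.exists_ne_zero
  exact ⟨x, hx0, fun a => lie_eq_smul_of_mem_rootSpace hx a⟩

/-- The Cartan matrix of a semisimple Lie algebra, from a set of Chevalley generators. -/
theorem hasCartanMatrix_of_generators {n : ℕ} {C : Matrix (Fin n) (Fin n) ℤ}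
    {α : Fin n → Module.Dual ℂ H} {x y : Fin n → L} {h : Fin n → H}
    (hx : ∀ i (a : H), ⁅(a : L), x i⁆ = α i a • x i)
    (hy : ∀ i (a : H), ⁅(a : L), y i⁆ = -α i a • y i)
    (hxy : ∀ i, ⁅x i, y i⁆ = h i) (hαh : ∀ i j, α i (h j) = C i j) (hC : ∀ i, C i i = 2)
    (hli : LinearIndependent ℂ α)
    (hpos : ∀ β ∈ Set.range (rootSystem H).root,
      β ∈ AddSubmonoid.closure (Set.range α) ∨ -β ∈ AddSubmonoid.closure (Set.range α)) :
    HasCartanMatrix H C := by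
  have h2 : ∀ i, α i (h i) = 2 := fun i => by rw [hαh, hC]; norm_num
  have hα0 : ∀ i, α i ≠ 0 := fun i => hli.ne_zero i
  have hh0 : ∀ i, (h i : L) ≠ 0 := fun i h0 => by
    have h3 := h2 i
    rw [show h i = 0 from Subtype.ext h0, map_zero] at h3
    norm_num at h3
  have hx0 : ∀ i, x i ≠ 0 := fun i h0 => hh0 i (by rw [← hxy, h0, zero_lie])
  choose χ hχ hxχ using fun i => root_of_lie_eq (hα0 i) (hx0 i) (hx i)
  have hχinj : Function.Injective χ := fun i j hij => hli.injective (by rw [← hχ, ← hχ, hij])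
  -- The neutral element of an `sl₂`-triple whose other members lie in opposite root spaces is the
  -- coroot.
  have hcoroot : ∀ i, h i = coroot (χ i).1 := by
    intro i
    have hχα : ∀ a, (χ i).1 a = α i a := fun a => by rw [← hχ i]; rfl
    have ht : IsSl2Triple (h i : L) (x i) (y i) :=
      { h_ne_zero := hh0 i
        lie_e_f := hxy i
        lie_h_e_nsmul := by rw [hx, h2, ofNat_smul_eq_nsmul]
        lie_h_f_nsmul := by rw [hy, h2, neg_smul, ofNat_smul_eq_nsmul] }
    have hyχ : y i ∈ rootSpace H (-(χ i).1 : H → ℂ) := by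
      apply LieModule.weightSpace_le_genWeightSpace
      rw [LieModule.mem_weightSpace]
      intro a
      change ⁅(a : L), y i⁆ = -(χ i).1 a • y i
      rw [hy, hχα]
    exact Subtype.ext (ht.h_eq_coroot (Finset.mem_filter.mp (χ i).2).2 (hxχ i) hyχ)
  have himg : (rootSystem H).root '' Set.range χ = Set.range α := by
    rw [← Set.range_comp]
    exact congrArg Set.range (funext hχ)
  let b : (rootSystem H).Base := RootPairing.Base.mk' (rootSystem H) (Set.range χ)
    (by
      rw [LinearIndepOn, ← linearIndependent_equiv (Equiv.ofInjective χ hχinj)]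
      have h3 : (rootSystem H).root ∘ χ = α := funext hχ
      rw [← h3] at hli
      exact hli)
    (by
      intro i
      rw [himg]
      exact hpos _ ⟨i, rfl⟩)
  have hb : ∀ c, c ∈ b.support ↔ c ∈ Set.range χ := fun c => by simp [b, RootPairing.Base.mk']
  let f : Fin n ≃ b.support := (Equiv.ofInjective χ hχinj).trans
    (Equiv.subtypeEquivRight fun c => (hb c).symm)
  have hf : ∀ i, (f i : H.root) = χ i := fun i => rfl
  refine ⟨b, f.symm, ?_⟩
  ext i j
  rw [Matrix.reindex_apply, Matrix.submatrix_apply, Equiv.symm_symm]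
  have h3 : ((b.cartanMatrix (f i) (f j) : ℤ) : ℂ) = C i j := by
    have h4 := b.algebraMap_cartanMatrixIn_apply ℤ (f i) (f j)
    rw [rootSystem_pairing_apply, hf, hf, ← hcoroot] at h4
    rw [← hαh, ← hχ i]
    exact h4
  exact_mod_cast h3

end Killing

section Diagonal

variable (e : Module.Basis (Fin 8) ℂ V)

theorem apply_basis_of_isDiag {A : Module.End ℂ V} (hA : (LinearMap.toMatrix e e A).IsDiag)
    (k : Fin 8) : A (e k) = LinearMap.toMatrix e e A k k • e k := by
  conv_lhs => rw [← Matrix.toLin_toMatrix e e A, Matrix.toLin_self]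
  rw [Finset.sum_eq_single k]
  · intro j _ hj
    rw [hA hj, zero_smul]
  · simp

theorem toMatrix_lie_of_isDiag {A : L₀ V}
    (hA : (LinearMap.toMatrix e e (A : Module.End ℂ V)).IsDiag) (B : L₀ V) (i j : Fin 8) :
    LinearMap.toMatrix e e ((⁅A, B⁆ : L₀ V) : Module.End ℂ V) i j =
      (LinearMap.toMatrix e e (A : Module.End ℂ V) i i -
        LinearMap.toMatrix e e (A : Module.End ℂ V) j j) *
        LinearMap.toMatrix e e (B : Module.End ℂ V) i j := by
  rw [toMatrix_lie, ← hA.diagonal_diag, Matrix.sub_apply, Matrix.diagonal_mul,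
    Matrix.mul_diagonal]
  simp only [Matrix.diag_apply, Matrix.diagonal_apply_eq]
  ring

theorem lie_eq_zero_of_isDiag {A B : L₀ V}
    (hA : (LinearMap.toMatrix e e (A : Module.End ℂ V)).IsDiag)
    (hB : (LinearMap.toMatrix e e (B : Module.End ℂ V)).IsDiag) : ⁅A, B⁆ = 0 := by
  apply toMatrix_injective e
  ext i j
  rw [toMatrix_lie_of_isDiag e hA]
  by_cases hij : i = j
  · simp [hij]
  · rw [hB hij]; simp

theorem lie_matrixUnit_of_isDiag {A : L₀ V}
    (hA : (LinearMap.toMatrix e e (A : Module.End ℂ V)).IsDiag) {i j : Fin 8} (hij : i ≠ j) :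
    ⁅A, matrixUnit e i j hij⁆ = (LinearMap.toMatrix e e (A : Module.End ℂ V) i i -
        LinearMap.toMatrix e e (A : Module.End ℂ V) j j) • matrixUnit e i j hij := by
  apply toMatrix_injective e
  ext k l
  rw [toMatrix_lie_of_isDiag e hA]
  change _ = LinearMap.toMatrix e e (_ • (matrixUnit e i j hij : Module.End ℂ V)) k l
  rw [map_smul, toMatrix_matrixUnit, Matrix.smul_apply, smul_eq_mul]
  by_cases h : k = i ∧ l = j
  · rw [h.1, h.2]
  · rw [Matrix.single_apply_of_ne _ _ _ _ _ fun h' => h ⟨h'.1.symm, h'.2.symm⟩, mul_zero, mul_zero]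

theorem component_action_of_isDiag {A : Module.End ℂ V} (hA : (LinearMap.toMatrix e e A).IsDiag)
    (T : ⋀[ℂ]^4 V) (i : Fin 4 → Fin 8) :
    component e (action A T) i =
      (∑ a, LinearMap.toMatrix e e A (i a) (i a)) * component e T i := by
  rw [component_action, Finset.sum_mul]
  refine Finset.sum_congr rfl fun a _ => ?_
  rw [Finset.sum_eq_single (i a)]
  · rw [Function.update_eq_self]
  · intro s _ hs
    rw [hA hs.symm, zero_mul]
  · simp

theorem action_wedge_of_isDiag {A : Module.End ℂ V} (hA : (LinearMap.toMatrix e e A).IsDiag)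
    (i : Fin 4 → Fin 8) :
    action A (wedge e i) = (∑ a, LinearMap.toMatrix e e A (i a) (i a)) • wedge e i := by
  rw [wedge, action_ιMulti, Finset.sum_smul]
  refine Finset.sum_congr rfl fun a _ => ?_
  rw [apply_basis_of_isDiag e hA, AlternatingMap.map_update_smul, Function.update_eq_self]

theorem isDiag_diagOp (c : Fin 8 → ℂ) (hc : ∑ k, c k = 0) :
    (LinearMap.toMatrix e e (diagOp e c hc : Module.End ℂ V)).IsDiag := by
  rw [toMatrix_diagOp]
  exact Matrix.isDiag_diagonal c

/-- If the brackets of `B` with the diagonal operators are diagonal, then so is `B`. -/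
theorem isDiag_of_lie_isDiag {B : L₀ V}
    (h : ∀ A : L₀ V, (LinearMap.toMatrix e e (A : Module.End ℂ V)).IsDiag →
      (LinearMap.toMatrix e e ((⁅A, B⁆ : L₀ V) : Module.End ℂ V)).IsDiag) :
    (LinearMap.toMatrix e e (B : Module.End ℂ V)).IsDiag := by
  intro i j hij
  -- The bracket with this operator, `1` at `i` and `-1` at `j`, doubles the entry `B_ij`.
  have h1 := h (diagOp e _ (sum_single_sub_single i j)) (isDiag_diagOp e _ _) hij
  beta_reduce at h1
  rw [toMatrix_lie_of_isDiag e (isDiag_diagOp e _ _), toMatrix_diagOp] at h1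
  simp only [Matrix.diagonal_apply_eq, Pi.sub_apply, Pi.single_eq_same,
    Pi.single_eq_of_ne hij, Pi.single_eq_of_ne hij.symm, mul_eq_zero] at h1
  refine h1.resolve_left ?_
  norm_num

/-- A diagonal operator of trace zero on which `∑ a, ε (p a)` takes the value `4`. -/
theorem exists_diagOp_eq_four {p : Fin 4 → Fin 8} (hp : Function.Injective p) :
    ∃ c : Fin 8 → ℂ, ∑ k, c k = 0 ∧ (∀ a, c (p a) = 1) ∧ ∀ k, (∀ a, p a ≠ k) → c k = -1 := by
  obtain ⟨q, hq, hpq⟩ := exists_complement hp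
  let σ := Equiv.ofBijective _ (bijective_sumElim hp hq hpq)
  refine ⟨fun k => if k ∈ Set.range p then 1 else -1, ?_, fun a => if_pos ⟨a, rfl⟩, fun k hk =>
    if_neg fun ⟨a, ha⟩ => hk a ha⟩
  rw [← σ.sum_comp, Fintype.sum_sum_type]
  have h1 : ∀ a, σ (Sum.inl a) ∈ Set.range p := fun a => ⟨a, rfl⟩
  have h2 : ∀ a, σ (Sum.inr a) ∉ Set.range p := fun a ⟨b, hb⟩ => hpq b a hb
  simp [h1, h2]

instance isCartanSubalgebra_diag : (diag e).IsCartanSubalgebra where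
  nilpotent := by
    have : IsLieAbelian (diag e) := ⟨fun A B => Subtype.ext (lie_eq_zero_of_isDiag e A.2 B.2)⟩
    infer_instance
  self_normalizing := by
    refine le_antisymm (fun B hB => ?_) (LieSubalgebra.le_normalizer _)
    rw [LieSubalgebra.mem_normalizer_iff] at hB
    refine isDiag_of_lie_isDiag e fun A hA => ?_
    rw [← lie_skew]
    have h := (diag e).neg_mem (hB A hA)
    exact h

variable (δ : V [⋀^Fin 8]→ₗ[ℂ] ℂ) [IsLieBracket e δ]

theorem mem_𝔡 {x : 𝔤 e δ} : x ∈ 𝔡 e δ ↔ ∃ A ∈ diag e, inl e δ A = x := Iff.rfl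

instance isCartanSubalgebra_𝔡 : (𝔡 e δ).IsCartanSubalgebra where
  nilpotent := by
    have : IsLieAbelian (𝔡 e δ) := ⟨fun x y => by
      obtain ⟨A, hA, hx⟩ := (mem_𝔡 e δ).mp x.2
      obtain ⟨B, hB, hy⟩ := (mem_𝔡 e δ).mp y.2
      apply Subtype.ext
      rw [LieSubalgebra.coe_bracket, ← hx, ← hy, lie_inl_inl, lie_eq_zero_of_isDiag e hA hB,
        map_zero]
      rfl⟩
    infer_instance
  self_normalizing := by
    refine le_antisymm (fun x hx => ?_) (LieSubalgebra.le_normalizer _)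
    rw [LieSubalgebra.mem_normalizer_iff] at hx
    have h1 : ∀ A ∈ diag e, ∃ B ∈ diag e, ⁅A, x.1⁆ = B ∧ action (A : Module.End ℂ V) x.2 = 0 := by
      intro A hA
      have h2 := (𝔡 e δ).neg_mem (hx _ ⟨A, hA, rfl⟩)
      rw [lie_skew, lie_inl] at h2
      obtain ⟨B, hB, hAB⟩ := h2
      exact ⟨B, hB, (congrArg Prod.fst hAB).symm, (congrArg Prod.snd hAB).symm⟩
    have hB : x.1 ∈ diag e := isDiag_of_lie_isDiag e fun A hA => by
      obtain ⟨B, hB, hAB, -⟩ := h1 A hA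
      rw [hAB]
      exact hB
    have hT : x.2 = 0 := by
      by_contra hT
      obtain ⟨i, hi, hc⟩ := exists_component_ne_zero e hT
      -- This operator multiplies the component `i` by 4, while the normaliser condition makes its
      -- action on `x.2` zero.
      obtain ⟨c, hc0, hc1, -⟩ := exists_diagOp_eq_four hi.injective
      obtain ⟨-, -, -, h3⟩ := h1 (diagOp e c hc0) (isDiag_diagOp e c hc0)
      have h4 := component_action_of_isDiag e (isDiag_diagOp e c hc0) x.2 i
      rw [h3] at h4
      simp only [toMatrix_diagOp, Matrix.diagonal_apply_eq, hc1] at h4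
      simp [component] at h4
      exact hc h4
    exact ⟨x.1, hB, Prod.ext rfl hT.symm⟩

end Diagonal

end FourVector

end

/-! ### The root systems of `L₀(V)` and `𝔤`. -/

noncomputable section

namespace FourVector

attribute [local instance 100] LieRing.ofAssociativeRing

universe u

variable {V : Type u} [AddCommGroup V] [Module ℂ V]

section Roots

variable (e : Module.Basis (Fin 8) ℂ V)

/-- The element `diag(c₁, …, c₈)` of the diagonal subalgebra of `L₀(V)`. -/
def diagElem₀ (c : Fin 8 → ℂ) (hc : ∑ k, c k = 0) : diag e := ⟨diagOp e c hc, isDiag_diagOp e c hc⟩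

@[simp] theorem ε₀_diagElem₀ (c : Fin 8 → ℂ) (hc : ∑ k, c k = 0) (k : Fin 8) :
    ε₀ e k (diagElem₀ e c hc) = c k := by
  change LinearMap.toMatrix e e (diagOp e c hc : Module.End ℂ V) k k = c k
  rw [toMatrix_diagOp, Matrix.diagonal_apply_eq]

theorem matrixUnit_ne_zero {i j : Fin 8} (hij : i ≠ j) : matrixUnit e i j hij ≠ 0 := by
  intro h
  have h5 := toMatrix_matrixUnit e hij
  rw [h] at h5
  have h6 := congrFun (congrFun h5 i) j
  simp at h6

theorem lie_matrixUnit_diag {i j : Fin 8} (hij : i ≠ j) (A : diag e) :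
    ⁅(A : L₀ V), matrixUnit e i j hij⁆ = (ε₀ e i - ε₀ e j) A • matrixUnit e i j hij :=
  lie_matrixUnit_of_isDiag e A.2 hij

theorem ε₀_sub_ne_zero {i j : Fin 8} (hij : i ≠ j) : ε₀ e i - ε₀ e j ≠ 0 := by
  intro h
  have h1 := congrArg (fun f => f (diagElem₀ e _ (sum_single_sub_single i j))) h
  simp only [LinearMap.sub_apply, ε₀_diagElem₀, Pi.sub_apply, Pi.single_eq_same,
    Pi.single_eq_of_ne hij, Pi.single_eq_of_ne hij.symm, LinearMap.zero_apply] at h1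
  norm_num at h1

theorem exists_entry_of_eigenvector {B : L₀ V} {α : Module.Dual ℂ (diag e)} (hα : α ≠ 0)
    (hB : B ≠ 0) (h : ∀ A : diag e, ⁅(A : L₀ V), B⁆ = α A • B) :
    ∃ i j : Fin 8, i ≠ j ∧ α = ε₀ e i - ε₀ e j := by
  by_cases hd : (LinearMap.toMatrix e e (B : Module.End ℂ V)).IsDiag
  · exfalso
    apply hα
    ext A
    have h1 := h A
    rw [lie_eq_zero_of_isDiag e A.2 hd] at h1
    exact (smul_eq_zero.mp h1.symm).resolve_right hB
  · simp only [Matrix.IsDiag, Pairwise, not_forall] at hd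
    obtain ⟨i, j, hij, hne⟩ := hd
    refine ⟨i, j, hij, ?_⟩
    ext A
    have h1 := toMatrix_lie_of_isDiag e A.2 B i j
    rw [h A] at h1
    change LinearMap.toMatrix e e (α A • (B : Module.End ℂ V)) i j = _ at h1
    rw [map_smul, Matrix.smul_apply, smul_eq_mul] at h1
    exact mul_right_cancel₀ hne h1

theorem range_root_diag [FiniteDimensional ℂ V] [LieAlgebra.IsSimple ℂ (L₀ V)] :
    Set.range (LieAlgebra.IsKilling.rootSystem (diag e)).root =
      {α | ∃ i j : Fin 8, i ≠ j ∧ α = ε₀ e i - ε₀ e j} := by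
  ext α
  constructor
  · rintro ⟨χ, rfl⟩
    obtain ⟨hα, B, hB, h⟩ := exists_eigenvector_of_root χ
    exact exists_entry_of_eigenvector e hα hB h
  · rintro ⟨i, j, hij, rfl⟩
    obtain ⟨χ, hχ, -⟩ := root_of_lie_eq (ε₀_sub_ne_zero e hij) (matrixUnit_ne_zero e hij)
      (lie_matrixUnit_diag e hij)
    exact ⟨χ, hχ⟩

variable (δ : V [⋀^Fin 8]→ₗ[ℂ] ℂ)

theorem inl_ne_zero {A : L₀ V} (hA : A ≠ 0) : inl e δ A ≠ 0 := fun h =>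
  hA (congrArg Prod.fst h)

theorem inr_ne_zero {T : ⋀[ℂ]^4 V} (hT : T ≠ 0) : inr e δ T ≠ 0 := fun h =>
  hT (congrArg Prod.snd h)

variable [IsLieBracket e δ]

/-- The element `diag(c₁, …, c₈)` of `𝔡`. -/
def diagElem (c : Fin 8 → ℂ) (hc : ∑ k, c k = 0) : 𝔡 e δ :=
  ⟨inl e δ (diagOp e c hc), diagOp e c hc, isDiag_diagOp e c hc, rfl⟩

@[simp] theorem ε_diagElem (c : Fin 8 → ℂ) (hc : ∑ k, c k = 0) (k : Fin 8) :
    ε e δ k (diagElem e δ c hc) = c k := by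
  change LinearMap.toMatrix e e (diagOp e c hc : Module.End ℂ V) k k = c k
  rw [toMatrix_diagOp, Matrix.diagonal_apply_eq]

theorem exists_eq_diagElem (A : 𝔡 e δ) :
    ∃ c, ∃ hc : ∑ k, c k = 0, A = diagElem e δ c hc := by
  obtain ⟨B, hB, hA⟩ := (mem_𝔡 e δ).mp A.2
  have h0 : ∑ k, (LinearMap.toMatrix e e (B : Module.End ℂ V)).diag k = 0 := by
    have := B.2
    rw [mem_L₀, LinearMap.trace_eq_matrix_trace ℂ e] at this
    exact this
  refine ⟨_, h0, Subtype.ext ?_⟩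
  rw [← hA]
  refine congrArg (inl e δ) (toMatrix_injective e ?_)
  rw [toMatrix_diagOp]
  exact (Matrix.IsDiag.diagonal_diag hB).symm

theorem lie_inl_matrixUnit {i j : Fin 8} (hij : i ≠ j) (A : 𝔡 e δ) :
    ⁅(A : 𝔤 e δ), inl e δ (matrixUnit e i j hij)⁆ =
      (ε e δ i - ε e δ j) A • inl e δ (matrixUnit e i j hij) := by
  obtain ⟨c, hc, rfl⟩ := exists_eq_diagElem e δ A
  change ⁅inl e δ (diagOp e c hc), _⁆ = _
  rw [lie_inl_inl, lie_matrixUnit_of_isDiag e (isDiag_diagOp e c hc), map_smul]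
  rfl

theorem lie_inr_wedge (i : Fin 4 → Fin 8) (A : 𝔡 e δ) :
    ⁅(A : 𝔤 e δ), inr e δ (wedge e i)⁆ =
      (∑ a : Fin 4, ε e δ (i a)) A • inr e δ (wedge e i) := by
  obtain ⟨c, hc, rfl⟩ := exists_eq_diagElem e δ A
  change ⁅inl e δ (diagOp e c hc), _⁆ = _
  rw [lie_inl_inr, action_wedge_of_isDiag e (isDiag_diagOp e c hc), map_smul, LinearMap.sum_apply]
  rfl

theorem ε_sub_ne_zero {i j : Fin 8} (hij : i ≠ j) : ε e δ i - ε e δ j ≠ 0 := by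
  intro h
  have h1 := congrArg (fun f => f (diagElem e δ _ (sum_single_sub_single i j))) h
  simp only [LinearMap.sub_apply, ε_diagElem, Pi.sub_apply, Pi.single_eq_same,
    Pi.single_eq_of_ne hij, Pi.single_eq_of_ne hij.symm, LinearMap.zero_apply] at h1
  norm_num at h1

theorem sum_ε_ne_zero {i : Fin 4 → Fin 8} (hi : Function.Injective i) :
    ∑ a, ε e δ (i a) ≠ 0 := by
  intro h
  obtain ⟨c, hc0, hc1, -⟩ := exists_diagOp_eq_four hi
  have h1 := congrArg (fun f => f (diagElem e δ c hc0)) h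
  simp [LinearMap.sum_apply, hc1] at h1

/-- Let `(B, T)` be an eigenvector. Any non-zero component of `T` determines the root; if `T = 0`,
any non-zero entry of `B` off the diagonal does, and a diagonal `B` would have weight zero. -/
theorem range_root_𝔡 [LieAlgebra.IsSimple ℂ (𝔤 e δ)] :
    Set.range (LieAlgebra.IsKilling.rootSystem (𝔡 e δ)).root =
      {α | ∃ i j : Fin 8, i ≠ j ∧ α = ε e δ i - ε e δ j} ∪
      {α | ∃ i : Fin 4 → Fin 8, Function.Injective i ∧ α = ∑ a : Fin 4, ε e δ (i a)} := by
  ext α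
  constructor
  · rintro ⟨χ, rfl⟩
    obtain ⟨hα, x, hx, h⟩ := exists_eigenvector_of_root χ
    generalize (LieAlgebra.IsKilling.rootSystem (𝔡 e δ)).root χ = α at hα h
    have h1 : ∀ c (hc : ∑ k, c k = 0), ⁅diagOp e c hc, x.1⁆ = α (diagElem e δ c hc) • x.1 ∧
        action (diagOp e c hc : Module.End ℂ V) x.2 = α (diagElem e δ c hc) • x.2 := by
      intro c hc
      have h2 := h (diagElem e δ c hc)
      change ⁅inl e δ (diagOp e c hc), _⁆ = _ at h2
      rw [lie_inl] at h2
      exact ⟨congrArg Prod.fst h2, congrArg Prod.snd h2⟩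
    by_cases hT : x.2 = 0
    · left
      have hB : x.1 ≠ 0 := fun hB => hx (Prod.ext hB hT)
      by_cases hd : (LinearMap.toMatrix e e (x.1 : Module.End ℂ V)).IsDiag
      · exfalso
        apply hα
        ext A
        obtain ⟨c, hc, rfl⟩ := exists_eq_diagElem e δ A
        have h2 := (h1 c hc).1
        rw [lie_eq_zero_of_isDiag e (isDiag_diagOp e c hc) hd] at h2
        exact (smul_eq_zero.mp h2.symm).resolve_right hB
      · simp only [Matrix.IsDiag, Pairwise, not_forall] at hd
        obtain ⟨i, j, hij, hne⟩ := hd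
        refine ⟨i, j, hij, ?_⟩
        ext A
        obtain ⟨c, hc, rfl⟩ := exists_eq_diagElem e δ A
        have h2 := toMatrix_lie_of_isDiag e (isDiag_diagOp e c hc) x.1 i j
        rw [(h1 c hc).1] at h2
        change LinearMap.toMatrix e e (_ • (x.1 : Module.End ℂ V)) i j = _ at h2
        rw [map_smul, Matrix.smul_apply, smul_eq_mul] at h2
        exact mul_right_cancel₀ hne h2
    · right
      obtain ⟨i, hi, hne⟩ := exists_component_ne_zero e hT
      refine ⟨i, hi.injective, ?_⟩
      ext A
      obtain ⟨c, hc, rfl⟩ := exists_eq_diagElem e δ A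
      have h2 := component_action_of_isDiag e (isDiag_diagOp e c hc) x.2 i
      rw [(h1 c hc).2] at h2
      have h3 : ∀ (z : ℂ) (T : ⋀[ℂ]^4 V), component e (z • T) i = z * component e T i :=
        fun z T => map_smul _ _ _
      rw [h3] at h2
      rw [LinearMap.sum_apply]
      exact mul_right_cancel₀ hne h2
  · rintro (⟨i, j, hij, rfl⟩ | ⟨i, hi, rfl⟩)
    · obtain ⟨χ, hχ, -⟩ := root_of_lie_eq (ε_sub_ne_zero e δ hij)
        (inl_ne_zero e δ (matrixUnit_ne_zero e hij)) (lie_inl_matrixUnit e δ hij)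
      exact ⟨χ, hχ⟩
    · obtain ⟨χ, hχ, -⟩ := root_of_lie_eq (sum_ε_ne_zero e δ hi)
        (inr_ne_zero e δ (wedge_ne_zero e hi)) (lie_inr_wedge e δ i)
      exact ⟨χ, hχ⟩

end Roots

end FourVector

end

/-! ### The multiplication of a Lie group in the chart at 1, and its second derivative as the
bracket. -/

noncomputable section

namespace FourVector

section LieGroup

open VectorField Filter Set
open scoped Topology

variable {E : Type*} [NormedAddCommGroup E] [NormedSpace ℝ E]
  {G : Type*} [TopologicalSpace G] [ChartedSpace E G] [Group G]

/-- The multiplication of a Lie group, in the chart at `1`. -/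
def chartMul (E : Type*) [NormedAddCommGroup E] [NormedSpace ℝ E] (G : Type*) [TopologicalSpace G]
    [ChartedSpace E G] [Group G] (p : E × E) : E :=
  extChartAt 𝓘(ℝ, E) (1 : G)
    ((extChartAt 𝓘(ℝ, E) (1 : G)).symm p.1 * (extChartAt 𝓘(ℝ, E) (1 : G)).symm p.2)

/-- The coordinates of `1`. -/
def chartOne (E : Type*) [NormedAddCommGroup E] [NormedSpace ℝ E] (G : Type*) [TopologicalSpace G]
    [ChartedSpace E G] [Group G] : E := extChartAt 𝓘(ℝ, E) (1 : G) 1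

/-- Partial derivatives of the multiplication, as restrictions of its derivative. -/
theorem fderiv_chartMul_right {a : E} (h : DifferentiableAt ℝ (chartMul E G) (a, chartOne E G)) :
    fderiv ℝ (fun b => chartMul E G (a, b)) (chartOne E G) =
      (fderiv ℝ (chartMul E G) (a, chartOne E G)) ∘L ContinuousLinearMap.inr ℝ E E := by
  exact (h.hasFDerivAt.comp (chartOne E G) (hasFDerivAt_prodMk_right a (chartOne E G))).fderiv

theorem fderiv_chartMul_left {a : E} (h : DifferentiableAt ℝ (chartMul E G) (chartOne E G, a)) :
    fderiv ℝ (fun b => chartMul E G (b, a)) (chartOne E G) =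
      (fderiv ℝ (chartMul E G) (chartOne E G, a)) ∘L ContinuousLinearMap.inl ℝ E E := by
  exact (h.hasFDerivAt.comp (f := fun b => (b, a)) (chartOne E G)
    (hasFDerivAt_prodMk_left (chartOne E G) a)).fderiv

variable [LieGroup 𝓘(ℝ, E) ∞ G]

theorem mdifferentiable_mul_left (g : G) :
    MDifferentiable 𝓘(ℝ, E) 𝓘(ℝ, E) (fun h : G => g * h) :=
  (contMDiff_mul_left (I := 𝓘(ℝ, E)) (n := ∞)).mdifferentiable (by simp)

theorem mdifferentiable_mul_right (g : G) :
    MDifferentiable 𝓘(ℝ, E) 𝓘(ℝ, E) (fun h : G => h * g) :=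
  (contMDiff_mul_right (I := 𝓘(ℝ, E)) (n := ∞)).mdifferentiable (by simp)

theorem mdifferentiable_conj (g : G) :
    MDifferentiable 𝓘(ℝ, E) 𝓘(ℝ, E) (fun h : G => g * h * g⁻¹) :=
  (mdifferentiable_mul_right g⁻¹).comp (mdifferentiable_mul_left g)

theorem isManifold_one : IsManifold 𝓘(ℝ, E) 1 G :=
  have : IsManifold 𝓘(ℝ, E) ∞ G := LieGroup.toContMDiffMul.toIsManifold
  IsManifold.of_le (n := ∞) (by simp)

/-- The domain on which the coordinate expression of the multiplication is smooth. -/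
theorem exists_isOpen_contDiffAt_chartMul :
    ∃ U : Set (E × E), IsOpen U ∧ (chartOne E G, chartOne E G) ∈ U ∧
      ∀ p ∈ U, ContDiffAt ℝ ∞ (chartMul E G) p ∧
        p.1 ∈ (extChartAt 𝓘(ℝ, E) (1 : G)).target ∧ p.2 ∈ (extChartAt 𝓘(ℝ, E) (1 : G)).target ∧
        (extChartAt 𝓘(ℝ, E) (1 : G)).symm p.1 * (extChartAt 𝓘(ℝ, E) (1 : G)).symm p.2 ∈
          (extChartAt 𝓘(ℝ, E) (1 : G)).source := by
  have : IsManifold 𝓘(ℝ, E) ∞ G := LieGroup.toContMDiffMul.toIsManifold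
  have : IsTopologicalGroup G := topologicalGroup_of_lieGroup 𝓘(ℝ, E) ∞
  set φ := extChartAt 𝓘(ℝ, E) (1 : G) with hφ
  let f : E × E → G := fun p => φ.symm p.1 * φ.symm p.2
  have hto : IsOpen φ.target := isOpen_extChartAt_target (1 : G)
  have hso : IsOpen φ.source := isOpen_extChartAt_source (1 : G)
  have hf : ContinuousOn f (φ.target ×ˢ φ.target) := by
    have h := continuousOn_extChartAt_symm (I := 𝓘(ℝ, E)) (1 : G)
    exact (h.comp continuousOn_fst fun p hp => hp.1).mul (h.comp continuousOn_snd fun p hp => hp.2)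
  refine ⟨_, hf.isOpen_inter_preimage (hto.prod hto) hso, ?_, ?_⟩
  · have h1 : chartOne E G ∈ φ.target := mem_extChartAt_target (1 : G)
    refine ⟨⟨h1, h1⟩, ?_⟩
    have h2 : φ.symm (chartOne E G) = 1 := extChartAt_to_inv (1 : G)
    change φ.symm _ * φ.symm _ ∈ φ.source
    rw [h2, mul_one]
    exact mem_extChartAt_source (1 : G)
  · rintro p ⟨⟨h1, h2⟩, h3⟩
    refine ⟨?_, h1, h2, h3⟩
    have hs : ∀ a ∈ φ.target, ContMDiffAt 𝓘(ℝ, E) 𝓘(ℝ, E) ∞ φ.symm a := fun a ha =>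
      (contMDiffOn_extChartAt_symm (n := ∞) (1 : G)).contMDiffAt (hto.mem_nhds ha)
    have hm : ContMDiffAt 𝓘(ℝ, E × E) 𝓘(ℝ, E) ∞ f p :=
      ((hs _ h1).comp p contDiff_fst.contMDiff.contMDiffAt).mul
        ((hs _ h2).comp p contDiff_snd.contMDiff.contMDiffAt)
    have he : ContMDiffAt 𝓘(ℝ, E) 𝓘(ℝ, E) ∞ φ (f p) :=
      (contMDiffOn_extChartAt (n := ∞) (x := (1 : G))).contMDiffAt
        ((chartAt E (1 : G)).open_source.mem_nhds (by
          have h4 : f p ∈ φ.source := h3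
          rwa [hφ, extChartAt_source] at h4))
    exact (he.comp p hm).contDiffAt

/-- The coordinate expression of left translation. -/
theorem mfderiv_extChartAt_comp_mul_left {a : E}
    (h : (extChartAt 𝓘(ℝ, E) (1 : G)).symm a ∈ (extChartAt 𝓘(ℝ, E) (1 : G)).source) (x : E) :
    mfderiv 𝓘(ℝ, E) 𝓘(ℝ, E) (extChartAt 𝓘(ℝ, E) (1 : G) ∘
      ((extChartAt 𝓘(ℝ, E) (1 : G)).symm a * ·)) (1 : G) x =
    fderiv ℝ (fun b => chartMul E G (a, b)) (chartOne E G) x := by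
  have : IsManifold 𝓘(ℝ, E) 1 G := isManifold_one
  have h1 : MDifferentiableAt 𝓘(ℝ, E) 𝓘(ℝ, E) (extChartAt 𝓘(ℝ, E) (1 : G) ∘
      ((extChartAt 𝓘(ℝ, E) (1 : G)).symm a * ·)) (1 : G) := by
    refine MDifferentiableAt.comp (I' := 𝓘(ℝ, E)) _ (mdifferentiableAt_extChartAt ?_)
      (mdifferentiable_mul_left _ _)
    rw [extChartAt_source] at h
    simpa using h
  rw [h1.mfderiv, modelWithCornersSelf_coe, Set.range_id, fderivWithin_univ]
  rfl

theorem mfderiv_extChartAt_comp_mul_right {a : E}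
    (h : (extChartAt 𝓘(ℝ, E) (1 : G)).symm a ∈ (extChartAt 𝓘(ℝ, E) (1 : G)).source) (x : E) :
    mfderiv 𝓘(ℝ, E) 𝓘(ℝ, E) (extChartAt 𝓘(ℝ, E) (1 : G) ∘
      (· * (extChartAt 𝓘(ℝ, E) (1 : G)).symm a)) (1 : G) x =
    fderiv ℝ (fun b => chartMul E G (b, a)) (chartOne E G) x := by
  have : IsManifold 𝓘(ℝ, E) 1 G := isManifold_one
  have h1 : MDifferentiableAt 𝓘(ℝ, E) 𝓘(ℝ, E) (extChartAt 𝓘(ℝ, E) (1 : G) ∘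
      (· * (extChartAt 𝓘(ℝ, E) (1 : G)).symm a)) (1 : G) := by
    refine MDifferentiableAt.comp (I' := 𝓘(ℝ, E)) _ (mdifferentiableAt_extChartAt ?_)
      (mdifferentiable_mul_right _ _)
    rw [extChartAt_source] at h
    simpa using h
  rw [h1.mfderiv, modelWithCornersSelf_coe, Set.range_id, fderivWithin_univ]
  rfl

/-- The coordinate expression of a left invariant vector field. -/
theorem mfderiv_extChartAt_mulInvariantVectorField {a : E}
    (h : a ∈ (extChartAt 𝓘(ℝ, E) (1 : G)).target) (x : GroupLieAlgebra 𝓘(ℝ, E) G) :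
    mfderiv 𝓘(ℝ, E) 𝓘(ℝ, E) (extChartAt 𝓘(ℝ, E) (1 : G)) ((extChartAt 𝓘(ℝ, E) (1 : G)).symm a)
      (mulInvariantVectorField x ((extChartAt 𝓘(ℝ, E) (1 : G)).symm a)) =
    fderiv ℝ (fun b => chartMul E G (a, b)) (chartOne E G) x := by
  have : IsManifold 𝓘(ℝ, E) 1 G := isManifold_one
  have hs := (extChartAt 𝓘(ℝ, E) (1 : G)).map_target h
  refine Eq.trans ?_ (mfderiv_extChartAt_comp_mul_left hs x)
  have h1 := mfderiv_comp_of_eq (I := 𝓘(ℝ, E)) (I' := 𝓘(ℝ, E)) (I'' := 𝓘(ℝ, E)) (x := (1 : G))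
    (g := extChartAt 𝓘(ℝ, E) (1 : G)) (mdifferentiableAt_extChartAt (by
    rw [extChartAt_source] at hs; exact hs)) (mdifferentiable_mul_left _ _)
    (mul_one ((extChartAt 𝓘(ℝ, E) (1 : G)).symm a))
  -- The tangent spaces at `g * 1` and at `g` are different as dependent types; both unfold to `E`,
  -- and the equation is stated there so that `mul_one` can be rewritten.
  have h2 : @Eq (E →L[ℝ] E) (mfderiv 𝓘(ℝ, E) 𝓘(ℝ, E) (extChartAt 𝓘(ℝ, E) (1 : G))
      ((extChartAt 𝓘(ℝ, E) (1 : G)).symm a * 1)) (mfderiv 𝓘(ℝ, E) 𝓘(ℝ, E)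
      (extChartAt 𝓘(ℝ, E) (1 : G)) ((extChartAt 𝓘(ℝ, E) (1 : G)).symm a)) := by
    rw [mul_one]
  refine Eq.trans ?_ (congrArg (fun f => f x) h1).symm
  exact (congrArg (fun f : E →L[ℝ] E => f (mulInvariantVectorField x
    ((extChartAt 𝓘(ℝ, E) (1 : G)).symm a))) h2).symm

/-- The inverse of the derivative of the inverse chart is the derivative of the chart. The bracket
of vector fields on a manifold is computed from such pullbacks. -/
theorem mpullback_mulInvariantVectorField_extChartAt {a : E}
    (h : a ∈ (extChartAt 𝓘(ℝ, E) (1 : G)).target) (x : GroupLieAlgebra 𝓘(ℝ, E) G) :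
    mpullbackWithin 𝓘(ℝ, E) 𝓘(ℝ, E) (extChartAt 𝓘(ℝ, E) (1 : G)).symm
      (mulInvariantVectorField x) (range 𝓘(ℝ, E)) a =
    fderiv ℝ (fun b => chartMul E G (a, b)) (chartOne E G) x := by
  have : IsManifold 𝓘(ℝ, E) 1 G := isManifold_one
  have h1 := ContinuousLinearMap.inverse_eq
    (mfderivWithin_extChartAt_symm_comp_mfderiv_extChartAt h)
    (mfderiv_extChartAt_comp_mfderivWithin_extChartAt_symm h)
  refine (congrArg (fun f => f (mulInvariantVectorField x
    ((extChartAt 𝓘(ℝ, E) (1 : G)).symm a))) h1).trans ?_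
  exact mfderiv_extChartAt_mulInvariantVectorField h x

variable (E G) in
theorem contDiffAt_chartMul : ContDiffAt ℝ ∞ (chartMul E G) (chartOne E G, chartOne E G) := by
  obtain ⟨U, -, hU, h⟩ := exists_isOpen_contDiffAt_chartMul (E := E) (G := G)
  exact (h _ hU).1

/-- The second derivative at the identity of the multiplication in the chart. -/
def chartMulSnd (E : Type*) [NormedAddCommGroup E] [NormedSpace ℝ E] (G : Type*)
    [TopologicalSpace G] [ChartedSpace E G] [Group G] : E × E →L[ℝ] E × E →L[ℝ] E :=
  fderiv ℝ (fderiv ℝ (chartMul E G)) (chartOne E G, chartOne E G)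

variable (E G) in
theorem hasFDerivAt_fderiv_chartMul :
    HasFDerivAt (fderiv ℝ (chartMul E G)) (chartMulSnd E G) (chartOne E G, chartOne E G) :=
  (((contDiffAt_chartMul E G).fderiv_right (m := 1)
    (by rw [one_add_one_eq_two]; exact ENat.LEInfty.out)).differentiableAt
    (by simp)).hasFDerivAt

variable (E G) in
theorem eventually_chartMul_right : ∀ᶠ a in 𝓝 (chartOne E G),
    ContDiffAt ℝ ∞ (chartMul E G) (a, chartOne E G) ∧
      a ∈ (extChartAt 𝓘(ℝ, E) (1 : G)).target := by
  obtain ⟨U, hUo, hU, h⟩ := exists_isOpen_contDiffAt_chartMul (E := E) (G := G)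
  have h1 : Tendsto (fun a : E => (a, chartOne E G)) (𝓝 (chartOne E G))
      (𝓝 (chartOne E G, chartOne E G)) := by
    apply Continuous.tendsto' <;> [fun_prop; rfl]
  filter_upwards [h1 (hUo.mem_nhds hU)] with a ha
  exact ⟨(h _ ha).1, (h _ ha).2.1⟩

variable (E G) in
theorem eventually_chartMul_left : ∀ᶠ a in 𝓝 (chartOne E G),
    ContDiffAt ℝ ∞ (chartMul E G) (chartOne E G, a) := by
  obtain ⟨U, hUo, hU, h⟩ := exists_isOpen_contDiffAt_chartMul (E := E) (G := G)
  have h1 : Tendsto (fun a : E => (chartOne E G, a)) (𝓝 (chartOne E G))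
      (𝓝 (chartOne E G, chartOne E G)) := by
    apply Continuous.tendsto' <;> [fun_prop; rfl]
  filter_upwards [h1 (hUo.mem_nhds hU)] with a ha
  exact (h _ ha).1

variable (E G) in
theorem fderiv_chartMul_right_one :
    fderiv ℝ (fun b => chartMul E G (chartOne E G, b)) (chartOne E G) =
      ContinuousLinearMap.id ℝ E := by
  have h : (fun b => chartMul E G (chartOne E G, b)) =ᶠ[𝓝 (chartOne E G)] id := by
    filter_upwards [(eventually_chartMul_right E G)] with a ha
    change extChartAt 𝓘(ℝ, E) (1 : G) ((extChartAt 𝓘(ℝ, E) (1 : G)).symm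
      (extChartAt 𝓘(ℝ, E) (1 : G) 1) * _) = a
    rw [extChartAt_to_inv, one_mul]
    exact (extChartAt 𝓘(ℝ, E) (1 : G)).right_inv ha.2
  rw [h.fderiv_eq, fderiv_id]

variable (E G) in
theorem fderiv_chartMul_left_one :
    fderiv ℝ (fun b => chartMul E G (b, chartOne E G)) (chartOne E G) =
      ContinuousLinearMap.id ℝ E := by
  have h : (fun b => chartMul E G (b, chartOne E G)) =ᶠ[𝓝 (chartOne E G)] id := by
    filter_upwards [(eventually_chartMul_right E G)] with a ha
    change extChartAt 𝓘(ℝ, E) (1 : G) (_ * (extChartAt 𝓘(ℝ, E) (1 : G)).symm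
      (extChartAt 𝓘(ℝ, E) (1 : G) 1)) = a
    rw [extChartAt_to_inv, mul_one]
    exact (extChartAt 𝓘(ℝ, E) (1 : G)).right_inv ha.2
  rw [h.fderiv_eq, fderiv_id]

-- The left invariant field of `x` reads `a ↦ ∂₂m(a, 1) x` in the chart, with `m` the
-- multiplication; this is its linearisation at the identity.
variable (E G) in
theorem hasFDerivAt_fderiv_chartMul_right (x : E) :
    HasFDerivAt (fun a => fderiv ℝ (fun b => chartMul E G (a, b)) (chartOne E G) x)
      ((chartMulSnd E G).flip (0, x) ∘L ContinuousLinearMap.inl ℝ E E) (chartOne E G) := by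
  have h1 := (hasFDerivAt_fderiv_chartMul E G).comp (f := fun a => (a, chartOne E G))
    (chartOne E G) (hasFDerivAt_prodMk_left (𝕜 := ℝ) (chartOne E G) (chartOne E G))
  have h2 := h1.clm_apply (hasFDerivAt_const ((0, x) : E × E) (chartOne E G))
  refine (h2.congr_fderiv ?_).congr_of_eventuallyEq ?_
  · ext y
    simp
  · filter_upwards [eventually_chartMul_right E G] with a ha
    rw [fderiv_chartMul_right (ha.1.differentiableAt (by simp))]
    simp

theorem chartMulSnd_symm (p q : E × E) : chartMulSnd E G p q = chartMulSnd E G q p :=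
  ((contDiffAt_chartMul E G).isSymmSndFDerivAt
    (by rw [minSmoothness_of_isRCLikeNormedField]; exact ENat.LEInfty.out)) p q

/-- The bracket of the Lie algebra of a Lie group, in the chart at `1`. -/
theorem lie_eq_chartMulSnd (x y : GroupLieAlgebra 𝓘(ℝ, E) G) :
    ⁅x, y⁆ = chartMulSnd E G (x, 0) (0, y) - chartMulSnd E G (y, 0) (0, x) := by
  have : IsManifold 𝓘(ℝ, E) 1 G := isManifold_one
  have hev : ∀ z : GroupLieAlgebra 𝓘(ℝ, E) G,
      mpullbackWithin 𝓘(ℝ, E) 𝓘(ℝ, E) (extChartAt 𝓘(ℝ, E) (1 : G)).symm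
        (mulInvariantVectorField z) (range 𝓘(ℝ, E)) =ᶠ[𝓝 (chartOne E G)]
      fun a => fderiv ℝ (fun b => chartMul E G (a, b)) (chartOne E G) z := fun z => by
    filter_upwards [eventually_chartMul_right E G] with a ha
    exact mpullback_mulInvariantVectorField_extChartAt ha.2 z
  -- By definition the bracket is that of the invariant fields, computed in the chart at 1 and
  -- carried back by the derivative of the chart, which is the identity there.
  have h1 : ⁅x, y⁆ = (mfderiv 𝓘(ℝ, E) 𝓘(ℝ, E) (extChartAt 𝓘(ℝ, E) (1 : G)) 1).inverse
      (lieBracketWithin (E := E) ℝ (mpullbackWithin 𝓘(ℝ, E) 𝓘(ℝ, E) (extChartAt 𝓘(ℝ, E) (1 : G)).symm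
        (mulInvariantVectorField x) (range 𝓘(ℝ, E)))
        (mpullbackWithin 𝓘(ℝ, E) 𝓘(ℝ, E) (extChartAt 𝓘(ℝ, E) (1 : G)).symm
        (mulInvariantVectorField y) (range 𝓘(ℝ, E)))
        ((extChartAt 𝓘(ℝ, E) (1 : G)).symm ⁻¹' univ ∩ range 𝓘(ℝ, E)) (chartOne E G)) := rfl
  have h2 : lieBracket ℝ (mpullbackWithin 𝓘(ℝ, E) 𝓘(ℝ, E) (extChartAt 𝓘(ℝ, E) (1 : G)).symm
        (mulInvariantVectorField x) (range 𝓘(ℝ, E)))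
        (mpullbackWithin 𝓘(ℝ, E) 𝓘(ℝ, E) (extChartAt 𝓘(ℝ, E) (1 : G)).symm
        (mulInvariantVectorField y) (range 𝓘(ℝ, E))) (chartOne E G) =
      chartMulSnd E G (x, 0) (0, y) - chartMulSnd E G (y, 0) (0, x) := by
    refine (Filter.EventuallyEq.lieBracket_vectorField_eq (hev x) (hev y)).trans ?_
    rw [lieBracket, (hasFDerivAt_fderiv_chartMul_right E G x).fderiv,
      (hasFDerivAt_fderiv_chartMul_right E G y).fderiv, fderiv_chartMul_right_one]
    rfl
  rw [h1, mfderiv_extChartAt_self]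
  have h3 : (extChartAt 𝓘(ℝ, E) (1 : G)).symm ⁻¹' univ ∩ range 𝓘(ℝ, E) = univ := by simp
  refine (congrArg (fun f : E →L[ℝ] E => f _) (ContinuousLinearMap.inverse_id (R := ℝ) (M := E))).trans ?_
  refine Eq.trans ?_ h2
  rw [h3]
  exact congrFun lieBracketWithin_univ _

end LieGroup

end FourVector

end

/-! ### The adjoint representation and the existence of one-parameter subgroups. -/

noncomputable section

namespace FourVector

section LieGroup

open VectorField Filter Set
open scoped Topology

variable {E : Type*} [NormedAddCommGroup E] [NormedSpace ℝ E]
  {G : Type*} [TopologicalSpace G] [ChartedSpace E G] [Group G]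

theorem IsOneParameterSubgroup.map_zero {γ : ℝ → G} {x : GroupLieAlgebra 𝓘(ℝ, E) G}
    (h : IsOneParameterSubgroup γ x) : γ 0 = 1 := by
  have := h.map_add 0 0
  rwa [add_zero, left_eq_mul] at this

/-- The adjoint representation, as a linear map. -/
def adLin (g : G) : GroupLieAlgebra 𝓘(ℝ, E) G →L[ℝ] E :=
  mfderiv 𝓘(ℝ, E) 𝓘(ℝ, E) (fun y : G => g * y * g⁻¹) 1

theorem Ad_one (y : GroupLieAlgebra 𝓘(ℝ, E) G) : Ad (1 : G) y = y := by
  have h : (fun y : G => 1 * y * 1⁻¹) = id := by ext; simp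
  have h1 : mfderiv 𝓘(ℝ, E) 𝓘(ℝ, E) (fun y : G => 1 * y * 1⁻¹) (1 : G) =
      (ContinuousLinearMap.id ℝ E) := by
    rw [h]; exact mfderiv_id
  exact congrArg (fun f => f y) h1

/-- The coordinates of a one-parameter subgroup. -/
theorem IsOneParameterSubgroup.hasDerivAt_extChartAt {γ : ℝ → G} {x : GroupLieAlgebra 𝓘(ℝ, E) G}
    (h : IsOneParameterSubgroup γ x) :
    HasDerivAt (fun t => extChartAt 𝓘(ℝ, E) (1 : G) (γ t)) (x : E) 0 := by
  have hd : MDifferentiableAt 𝓘(ℝ, ℝ) 𝓘(ℝ, E) γ 0 := h.contMDiff.mdifferentiable (by simp) 0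
  have h2 : writtenInExtChartAt 𝓘(ℝ, ℝ) 𝓘(ℝ, E) 0 γ =
      fun t => extChartAt 𝓘(ℝ, E) (1 : G) (γ t) := by
    ext t
    simp only [writtenInExtChartAt, h.map_zero]
    rfl
  let L : ℝ →L[ℝ] E := mfderiv 𝓘(ℝ, ℝ) 𝓘(ℝ, E) γ 0
  have h1 : HasFDerivWithinAt (writtenInExtChartAt 𝓘(ℝ, ℝ) 𝓘(ℝ, E) 0 γ) L (range 𝓘(ℝ, ℝ)) 0 :=
    hd.hasMFDerivAt.2
  rw [h2, modelWithCornersSelf_coe, Set.range_id, hasFDerivWithinAt_univ] at h1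
  exact h1.hasDerivAt.congr_deriv h.velocity

variable [LieGroup 𝓘(ℝ, E) ∞ G]

theorem Ad_mul (g h : G) (y : GroupLieAlgebra 𝓘(ℝ, E) G) : Ad (g * h) y = Ad g (Ad h y) := by
  have h0 : (fun y : G => g * h * y * (g * h)⁻¹) =
      (fun y : G => g * y * g⁻¹) ∘ fun y : G => h * y * h⁻¹ := by
    ext; simp [mul_assoc]
  have h1 := mfderiv_comp_of_eq (I := 𝓘(ℝ, E)) (I' := 𝓘(ℝ, E)) (I'' := 𝓘(ℝ, E)) (x := (1 : G))
    (mdifferentiable_conj g _) (mdifferentiable_conj h _) (show h * 1 * h⁻¹ = 1 by simp)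
  rw [← h0] at h1
  have h2 : @Eq (E →L[ℝ] E) (mfderiv 𝓘(ℝ, E) 𝓘(ℝ, E) (fun y : G => g * y * g⁻¹) (h * 1 * h⁻¹))
      (mfderiv 𝓘(ℝ, E) 𝓘(ℝ, E) (fun y : G => g * y * g⁻¹) 1) := by
    rw [mul_one, mul_inv_cancel]
  refine Eq.trans (congrArg (fun f => f y) h1) ?_
  exact congrArg (fun f : E →L[ℝ] E => f (Ad h y)) h2

/-- The coordinate expression of `dR_g (Ad g y) = dL_g y`. -/
theorem fderiv_chartMul_Ad {a : E} (h : a ∈ (extChartAt 𝓘(ℝ, E) (1 : G)).target)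
    (y : GroupLieAlgebra 𝓘(ℝ, E) G) :
    fderiv ℝ (fun b => chartMul E G (b, a)) (chartOne E G)
        (Ad ((extChartAt 𝓘(ℝ, E) (1 : G)).symm a) y) =
      fderiv ℝ (fun b => chartMul E G (a, b)) (chartOne E G) y := by
  have : IsManifold 𝓘(ℝ, E) 1 G := isManifold_one
  have hs := (extChartAt 𝓘(ℝ, E) (1 : G)).map_target h
  refine Eq.trans (mfderiv_extChartAt_comp_mul_right hs _).symm
    (Eq.trans ?_ (mfderiv_extChartAt_comp_mul_left hs y))
  set g := (extChartAt 𝓘(ℝ, E) (1 : G)).symm a with hg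
  have h0 : (extChartAt 𝓘(ℝ, E) (1 : G) ∘ (g * ·)) =
      (extChartAt 𝓘(ℝ, E) (1 : G) ∘ (· * g)) ∘ fun y : G => g * y * g⁻¹ := by
    ext; simp
  have h1 := mfderiv_comp_of_eq (I := 𝓘(ℝ, E)) (I' := 𝓘(ℝ, E)) (I'' := 𝓘(ℝ, E)) (x := (1 : G))
    (g := extChartAt 𝓘(ℝ, E) (1 : G) ∘ (· * g)) (y := 1)
    (MDifferentiableAt.comp (I' := 𝓘(ℝ, E)) _ (mdifferentiableAt_extChartAt (by
      rw [extChartAt_source] at hs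
      simpa using hs)) (mdifferentiable_mul_right _ _))
    (mdifferentiable_conj g _) (show g * 1 * g⁻¹ = 1 by simp)
  rw [← h0] at h1
  have h2 : @Eq (E →L[ℝ] E) (mfderiv 𝓘(ℝ, E) 𝓘(ℝ, E)
      (extChartAt 𝓘(ℝ, E) (1 : G) ∘ (· * g)) (g * 1 * g⁻¹))
      (mfderiv 𝓘(ℝ, E) 𝓘(ℝ, E) (extChartAt 𝓘(ℝ, E) (1 : G) ∘ (· * g)) 1) := by
    rw [mul_one, mul_inv_cancel]
  refine Eq.trans ?_ (congrArg (fun f => f y) h1).symm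
  exact (congrArg (fun f : E →L[ℝ] E => f (Ad g y)) h2).symm

/-- The differential of the adjoint representation is the bracket. -/
theorem IsOneParameterSubgroup.hasDerivAt_Ad_zero [CompleteSpace E] {γ : ℝ → G}
    {x : GroupLieAlgebra 𝓘(ℝ, E) G} (h : IsOneParameterSubgroup γ x)
    (y : GroupLieAlgebra 𝓘(ℝ, E) G) :
    HasDerivAt (fun t => (Ad (γ t) y : E)) (⁅x, y⁆ : GroupLieAlgebra 𝓘(ℝ, E) G) 0 := by
  -- By `fderiv_chartMul_Ad`, `P(a) (Ad a y) = Q(a)`, so near the identity `Ad a y = P(a)⁻¹ Q(a)`.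
  -- As `P = 1` and `Q = y` at the identity, the derivative along `x` is `Q'(x) - P'(x) y`, which is
  -- the bracket by the symmetry of the second derivative.
  let P : E → E →L[ℝ] E := fun a => fderiv ℝ (fun b => chartMul E G (b, a)) (chartOne E G)
  let Q : E → E := fun a => fderiv ℝ (fun b => chartMul E G (a, b)) (chartOne E G) y
  let D : E →L[ℝ] E →L[ℝ] E := ((ContinuousLinearMap.compL ℝ E (E × E) E).flip
    (ContinuousLinearMap.inl ℝ E E)) ∘L (chartMulSnd E G) ∘L ContinuousLinearMap.inr ℝ E E
  have hP : HasFDerivAt P D (chartOne E G) := by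
    have h1 := (hasFDerivAt_fderiv_chartMul E G).comp (chartOne E G)
      (hasFDerivAt_prodMk_right (𝕜 := ℝ) (chartOne E G) (chartOne E G))
    have h2 := (((ContinuousLinearMap.compL ℝ E (E × E) E).flip
      (ContinuousLinearMap.inl ℝ E E)).hasFDerivAt).comp (chartOne E G) h1
    refine h2.congr_of_eventuallyEq ?_
    filter_upwards [eventually_chartMul_left E G] with a ha
    exact fderiv_chartMul_left (ha.differentiableAt (by simp))
  have hP1 : P (chartOne E G) = ContinuousLinearMap.id ℝ E := fderiv_chartMul_left_one E G
  have hQ : HasFDerivAt Q ((chartMulSnd E G).flip ((0 : E), (y : E)) ∘L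
      ContinuousLinearMap.inl ℝ E E) (chartOne E G) := hasFDerivAt_fderiv_chartMul_right E G y
  have hγ := h.hasDerivAt_extChartAt
  have hγ0 : extChartAt 𝓘(ℝ, E) (1 : G) (γ 0) = chartOne E G := by rw [h.map_zero]; rfl
  rw [← hγ0] at hP hQ
  have hPγ := hP.comp_hasDerivAt (0 : ℝ) hγ
  have hQγ := hQ.comp_hasDerivAt (0 : ℝ) hγ
  have hP0 : P (extChartAt 𝓘(ℝ, E) (1 : G) (γ 0)) = ((1 : (E →L[ℝ] E)ˣ) : E →L[ℝ] E) := by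
    rw [hγ0, hP1]; rfl
  have hinv := hasFDerivAt_ringInverse (𝕜 := ℝ) (1 : (E →L[ℝ] E)ˣ)
  rw [← hP0] at hinv
  have hInv := hinv.comp_hasDerivAt (0 : ℝ) hPγ
  have hAd := hInv.clm_apply hQγ
  have hunit : ∀ᶠ t in 𝓝 (0 : ℝ), IsUnit (P (extChartAt 𝓘(ℝ, E) (1 : G) (γ t))) := by
    have h1 := hPγ.continuousAt.tendsto
    refine h1 (Units.isOpen.mem_nhds ?_)
    change IsUnit (P _)
    rw [hP0]
    exact Units.isUnit _
  have hsrc : ∀ᶠ t in 𝓝 (0 : ℝ), γ t ∈ (extChartAt 𝓘(ℝ, E) (1 : G)).source := by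
    refine h.contMDiff.continuous.continuousAt.eventually_mem
      ((isOpen_extChartAt_source (1 : G)).mem_nhds ?_)
    rw [h.map_zero]
    exact mem_extChartAt_source (1 : G)
  refine (hAd.congr_deriv ?_).congr_of_eventuallyEq ?_
  · refine Eq.trans ?_ (lie_eq_chartMulSnd x y).symm
    have hQ1 : Q (chartOne E G) = y := by
      change fderiv ℝ (fun b => chartMul E G (chartOne E G, b)) (chartOne E G) y = y
      rw [fderiv_chartMul_right_one]; rfl
    have h5 : Ring.inverse (ContinuousLinearMap.id ℝ E) = ContinuousLinearMap.id ℝ E :=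
      Ring.inverse_one _
    simp only [Function.comp_apply, hγ0, hP1, h5]
    have h6 : D x (Q (chartOne E G)) = chartMulSnd E G ((0 : E), (x : E)) ((y : E), (0 : E)) := by
      rw [hQ1]; rfl
    have h7 := chartMulSnd_symm (E := E) (G := G) ((y : E), (0 : E)) ((0 : E), (x : E))
    refine Eq.trans ?_ (congrArg (fun z => chartMulSnd E G ((x : E), (0 : E)) ((0 : E), (y : E)) - z)
      (h6.trans h7.symm))
    simp only [Units.val_one, inv_one, neg_apply, ContinuousLinearMap.mulLeftRight_apply, one_mul,
      mul_one, ContinuousLinearMap.id_apply]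
    exact neg_add_eq_sub _ _
  · filter_upwards [hunit, hsrc] with t ht hs
    have h1 := fderiv_chartMul_Ad ((extChartAt 𝓘(ℝ, E) (1 : G)).map_source hs) y
    rw [(extChartAt 𝓘(ℝ, E) (1 : G)).left_inv hs] at h1
    have h2 : Ring.inverse (P (extChartAt 𝓘(ℝ, E) (1 : G) (γ t)))
        (P (extChartAt 𝓘(ℝ, E) (1 : G) (γ t)) (Ad (γ t) y)) = Ad (γ t) y := by
      change (Ring.inverse (P (extChartAt 𝓘(ℝ, E) (1 : G) (γ t))) *
        (P (extChartAt 𝓘(ℝ, E) (1 : G) (γ t)))) (Ad (γ t) y) = Ad (γ t) y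
      rw [Ring.inverse_mul_cancel _ ht]
      rfl
    rw [← h2]
    exact congrArg _ h1

/-- Follows from the case `t = 0` through `Ad (γ s) = Ad (γ t) ∘ Ad (γ (s - t))`. -/
theorem IsOneParameterSubgroup.hasDerivAt_Ad [CompleteSpace E] {γ : ℝ → G}
    {x : GroupLieAlgebra 𝓘(ℝ, E) G} (h : IsOneParameterSubgroup γ x)
    (y : GroupLieAlgebra 𝓘(ℝ, E) G) (t : ℝ) :
    HasDerivAt (fun t => (Ad (γ t) y : E)) (Ad (γ t) ⁅x, y⁆ : E) t := by
  have h0 : HasDerivAt (F := E) (fun s => Ad (γ s) y) (⁅x, y⁆ : GroupLieAlgebra 𝓘(ℝ, E) G) (t - t) := by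
    rw [sub_self]; exact h.hasDerivAt_Ad_zero y
  have h1 := h0.comp_sub_const t t
  let L : E →L[ℝ] E := adLin (γ t)
  have h2 := L.hasFDerivAt.comp_hasDerivAt t h1
  refine h2.congr_of_eventuallyEq (Eventually.of_forall fun s => ?_)
  change Ad (γ s) y = Ad (γ t) (Ad (γ (s - t)) y)
  rw [← Ad_mul, ← h.map_add, add_sub_cancel]

/-- Left translates of integral curves of left invariant fields are integral curves. -/
theorem hasMFDerivWithinAt_mul_left {γ : ℝ → G} {x : GroupLieAlgebra 𝓘(ℝ, E) G} {s : Set ℝ}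
    (h : IsMIntegralCurveOn γ (mulInvariantVectorField x) s) (g : G) :
    IsMIntegralCurveOn (fun t => g * γ t) (mulInvariantVectorField x) s := by
  intro t ht
  have h1 := (mdifferentiable_mul_left (E := E) g (γ t)).hasMFDerivAt.comp_hasMFDerivWithinAt t
    (h t ht)
  refine h1.congr_mfderiv ?_
  ext
  have h0 : (fun y : G => g * γ t * y) = (fun y : G => g * y) ∘ fun y : G => γ t * y := by
    ext; simp [mul_assoc]
  have h1 := mfderiv_comp_of_eq (I := 𝓘(ℝ, E)) (I' := 𝓘(ℝ, E)) (I'' := 𝓘(ℝ, E)) (x := (1 : G))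
    (mdifferentiable_mul_left g _) (mdifferentiable_mul_left (γ t) _) (mul_one (γ t))
  rw [← h0] at h1
  have h2 : @Eq (E →L[ℝ] E) (mfderiv 𝓘(ℝ, E) 𝓘(ℝ, E) (fun y : G => g * y) (γ t * 1))
      (mfderiv 𝓘(ℝ, E) 𝓘(ℝ, E) (fun y : G => g * y) (γ t)) := by
    rw [mul_one]
  have h3 : mulInvariantVectorField x (g * γ t) =
      mfderiv 𝓘(ℝ, E) 𝓘(ℝ, E) (fun y : G => g * y) (γ t) (mulInvariantVectorField x (γ t)) :=
    (congrArg (fun f => f x) h1).trans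
      (congrArg (fun f : E →L[ℝ] E => f (mulInvariantVectorField x (γ t))) h2)
  refine Eq.trans ?_ (congrArg (fun z : E => (1 : ℝ) • z) h3).symm
  let L : E →L[ℝ] E := mfderiv 𝓘(ℝ, E) 𝓘(ℝ, E) (fun y : G => g * y) (γ t)
  exact L.map_smul (1 : ℝ) (show E from mulInvariantVectorField x (γ t))

theorem mfderiv_extChartAt_mulInvariantVectorField' {g : G}
    (h : g ∈ (extChartAt 𝓘(ℝ, E) (1 : G)).source) (x : GroupLieAlgebra 𝓘(ℝ, E) G) :
    mfderiv 𝓘(ℝ, E) 𝓘(ℝ, E) (extChartAt 𝓘(ℝ, E) (1 : G)) g (mulInvariantVectorField x g) =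
    fderiv ℝ (fun b => chartMul E G (extChartAt 𝓘(ℝ, E) (1 : G) g, b)) (chartOne E G) x := by
  have h1 := (extChartAt 𝓘(ℝ, E) (1 : G)).map_source h
  have h2 := (extChartAt 𝓘(ℝ, E) (1 : G)).left_inv h
  generalize extChartAt 𝓘(ℝ, E) (1 : G) g = a at h1 h2 ⊢
  subst h2
  exact mfderiv_extChartAt_mulInvariantVectorField h1 x

theorem contMDiff_mulInvariantVectorField_one (x : GroupLieAlgebra 𝓘(ℝ, E) G) :
    ContMDiff 𝓘(ℝ, E) 𝓘(ℝ, E).tangent 1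
      (fun g : G => (⟨g, mulInvariantVectorField x g⟩ : TangentBundle 𝓘(ℝ, E) G)) := by
  have : LieGroup 𝓘(ℝ, E) (minSmoothness ℝ 3) G := by
    rw [minSmoothness_of_isRCLikeNormedField]
    infer_instance
  refine (contMDiff_mulInvariantVectorField x).of_le ?_
  rw [minSmoothness_of_isRCLikeNormedField]
  exact one_le_two

/-- Left translates of the local solution through 1 start at any given point and have the same
lifetime, so solutions extend to all times. -/
theorem exists_isMIntegralCurve [CompleteSpace E] [T2Space G] (x : GroupLieAlgebra 𝓘(ℝ, E) G) :
    ∃ γ : ℝ → G, γ 0 = 1 ∧ IsMIntegralCurve γ (mulInvariantVectorField x) := by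
  have : IsManifold 𝓘(ℝ, E) 1 G := isManifold_one
  obtain ⟨γ, hγ0, hγ⟩ := exists_isMIntegralCurveAt_of_contMDiffAt_boundaryless (I := 𝓘(ℝ, E)) 0
    ((contMDiff_mulInvariantVectorField_one x) 1)
  obtain ⟨ε, hε, h⟩ := isMIntegralCurveAt_iff'.mp hγ
  refine exists_isMIntegralCurve_of_isMIntegralCurveOn
    (contMDiff_mulInvariantVectorField_one x) hε (fun g => ⟨fun t => g * γ t, by simp [hγ0], ?_⟩) 1
  rw [Real.ball_eq_Ioo, zero_sub, zero_add] at h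
  exact hasMFDerivWithinAt_mul_left h g

/-- Existence of the exponential: every element of the Lie algebra is the velocity of a
one-parameter subgroup. -/
theorem exists_isOneParameterSubgroup [CompleteSpace E] [T2Space G]
    (x : GroupLieAlgebra 𝓘(ℝ, E) G) : ∃ γ : ℝ → G, IsOneParameterSubgroup γ x := by
  have : IsManifold 𝓘(ℝ, E) 1 G := isManifold_one
  obtain ⟨γ, hγ0, hγ⟩ := exists_isMIntegralCurve x
  -- As functions of `t` both sides are integral curves of the same field, with the same value at
  -- `0`.
  have hadd : ∀ s t, γ (s + t) = γ s * γ t := by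
    intro s t
    have h1 : IsMIntegralCurve (fun t => γ s * γ t) (mulInvariantVectorField x) := by
      rw [isMIntegralCurve_iff_isMIntegralCurveOn]
      exact hasMFDerivWithinAt_mul_left (hγ.isMIntegralCurveOn _) _
    have h2 := hγ.comp_add s
    have h3 := isMIntegralCurve_Ioo_eq_of_contMDiff_boundaryless (t₀ := 0)
      (contMDiff_mulInvariantVectorField_one x) h2 h1 (by simp [hγ0])
    have h4 := congrFun h3 t
    rw [add_comm]
    exact h4
  have hW : ∃ u : Set E, IsOpen u ∧ chartOne E G ∈ u ∧ u ⊆ (extChartAt 𝓘(ℝ, E) (1 : G)).target ∧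
      ContDiffOn ℝ ∞ (fun a => fderiv ℝ (fun b => chartMul E G (a, b)) (chartOne E G) x) u := by
    obtain ⟨U, hUo, hU, h⟩ := exists_isOpen_contDiffAt_chartMul (E := E) (G := G)
    have hc : Continuous fun a : E => (a, chartOne E G) := by fun_prop
    refine ⟨_, hUo.preimage hc, hU, fun a ha => (h _ ha).2.1, ?_⟩
    have h1 : ContDiffOn ℝ ∞ (fun a => fderiv ℝ (chartMul E G) (a, chartOne E G) ((0 : E), (x : E)))
        ((fun a : E => (a, chartOne E G)) ⁻¹' U) := by
      intro a ha
      have h2 : ContDiffAt ℝ ∞ (fderiv ℝ (chartMul E G)) (a, chartOne E G) :=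
        (h _ ha).1.fderiv_right (by simp)
      have h3 : ContDiffAt ℝ ∞ (fun a => fderiv ℝ (chartMul E G) (a, chartOne E G)) a :=
        h2.comp a (by fun_prop)
      exact (h3.clm_apply contDiffAt_const).contDiffWithinAt
    refine h1.congr fun a ha => ?_
    rw [fderiv_chartMul_right ((h _ ha).1.differentiableAt (by simp))]
    rfl
  obtain ⟨u, huo, hu1, hut, hW⟩ := hW
  -- An integral curve is a priori only differentiable. In the chart it solves an equation whose
  -- right side is smooth on `u`, hence it is smooth near `0`.
  have hsm : ContMDiffAt 𝓘(ℝ, ℝ) 𝓘(ℝ, E) ∞ γ 0 := by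
    have : IsManifold 𝓘(ℝ, E) ∞ G := LieGroup.toContMDiffMul.toIsManifold
    let α : ℝ → E := fun t => extChartAt 𝓘(ℝ, E) (1 : G) (γ t)
    have hα0 : α 0 = chartOne E G := by simp only [α, hγ0]; rfl
    have hsrc : ∀ᶠ t in 𝓝 (0 : ℝ), γ t ∈ (extChartAt 𝓘(ℝ, E) (1 : G)).source := by
      refine hγ.continuous.continuousAt.eventually_mem
        ((isOpen_extChartAt_source (1 : G)).mem_nhds ?_)
      rw [hγ0]
      exact mem_extChartAt_source (1 : G)
    have hder : ∀ t, γ t ∈ (extChartAt 𝓘(ℝ, E) (1 : G)).source → HasDerivAt α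
        (fderiv ℝ (fun b => chartMul E G (α t, b)) (chartOne E G) x) t := by
      intro t ht
      have h1 := HasMFDerivAt.comp t ((mdifferentiableAt_extChartAt (I := 𝓘(ℝ, E)) (x := (1 : G))
        (y := γ t) (by rwa [extChartAt_source] at ht)).hasMFDerivAt) (hγ t)
      let M : E →L[ℝ] E := mfderiv 𝓘(ℝ, E) 𝓘(ℝ, E) (extChartAt 𝓘(ℝ, E) (1 : G)) (γ t)
      let L : ℝ →L[ℝ] E := M ∘L (1 : ℝ →L[ℝ] ℝ).smulRight (mulInvariantVectorField x (γ t) : E)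
      have h2 : HasFDerivAt α L t := hasMFDerivAt_iff_hasFDerivAt.mp h1
      refine h2.hasDerivAt.congr_deriv ?_
      refine Eq.trans ?_ (mfderiv_extChartAt_mulInvariantVectorField' ht x)
      change M ((1 : ℝ) • (mulInvariantVectorField x (γ t) : E)) = _
      rw [one_smul]
      rfl
    have hu : ∀ᶠ t in 𝓝 (0 : ℝ), α t ∈ u := by
      have h1 : ContinuousAt α 0 := (hder 0 hsrc.self_of_nhds).continuousAt
      exact h1.eventually_mem (huo.mem_nhds (by rwa [hα0]))
    obtain ⟨r, hr, hr'⟩ := Metric.eventually_nhds_iff.mp (hsrc.and hu)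
    have hIcc : ∀ t ∈ Icc (-(r / 2)) (r / 2), γ t ∈ (extChartAt 𝓘(ℝ, E) (1 : G)).source ∧ α t ∈ u := by
      intro t ht
      apply hr'
      rw [Real.dist_eq, sub_zero]
      exact lt_of_le_of_lt (abs_le.mpr ht) (half_lt_self hr)
    have h5 := ODE.contDiffOn_enat_Icc_of_hasDerivWithinAt (n := ⊤)
      (f := fun _ a => fderiv ℝ (fun b => chartMul E G (a, b)) (chartOne E G) x) (u := u)
      (tmin := -(r / 2)) (tmax := r / 2) (α := α)
      (hW.comp contDiffOn_snd fun p hp => hp.2)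
      (fun t ht => (hder t (hIcc t ht).1).hasDerivWithinAt) fun t ht => (hIcc t ht).2
    have h6 : ContDiffAt ℝ ∞ α 0 := h5.contDiffAt (Icc_mem_nhds (by linarith) (by linarith))
    have h7 : ContMDiffAt 𝓘(ℝ, E) 𝓘(ℝ, E) ∞ (extChartAt 𝓘(ℝ, E) (1 : G)).symm (α 0) :=
      (contMDiffOn_extChartAt_symm (n := ∞) (1 : G)).contMDiffAt
        ((isOpen_extChartAt_target (1 : G)).mem_nhds (hut (by rwa [hα0])))
    refine (h7.comp 0 h6.contMDiffAt).congr_of_eventuallyEq ?_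
    filter_upwards [hsrc] with t ht
    exact ((extChartAt 𝓘(ℝ, E) (1 : G)).left_inv ht).symm
  -- Smoothness at `0` spreads to every `s` by `γ t = γ s * γ (t - s)`.
  have hsm' : ContMDiff 𝓘(ℝ, ℝ) 𝓘(ℝ, E) ∞ γ := by
    intro s
    have h1 : γ = fun t => γ s * γ (t - s) := by
      ext t; rw [← hadd, add_sub_cancel]
    rw [h1]
    have h0 : ContMDiffAt 𝓘(ℝ, ℝ) 𝓘(ℝ, E) ∞ γ (s - s) := by rwa [sub_self]
    have h2 : ContMDiffAt 𝓘(ℝ, ℝ) 𝓘(ℝ, E) ∞ (fun t => γ (t - s)) s :=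
      h0.comp (f := fun t => t - s) s
        (ContDiff.contMDiff (contDiff_id.sub contDiff_const)).contMDiffAt
    exact (contMDiff_mul_left (I := 𝓘(ℝ, E)) (n := ∞) (a := γ s)).contMDiffAt.comp s h2
  refine ⟨γ, hadd, hsm', ?_⟩
  have h1 : mfderiv 𝓘(ℝ, ℝ) 𝓘(ℝ, E) γ 0 (1 : ℝ) = (1 : ℝ) • mulInvariantVectorField x (γ 0) :=
    congrArg (fun f : ℝ →L[ℝ] E => f 1) (hγ 0).mfderiv
  have h2 : ∀ g : G, g = 1 → @Eq E (mulInvariantVectorField x g) x := by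
    rintro _ rfl
    have h : (fun y : G => 1 * y) = id := by ext; simp
    have h1 : mfderiv 𝓘(ℝ, E) 𝓘(ℝ, E) (fun y : G => 1 * y) (1 : G) =
        (ContinuousLinearMap.id ℝ E) := by
      rw [h]; exact mfderiv_id
    exact congrArg (fun f => f x) h1
  refine h1.trans ((congrArg (fun z : E => (1 : ℝ) • z) (h2 _ hγ0)).trans ?_)
  exact one_smul ℝ (show E from x)

end LieGroup

end FourVector

end

/-! ### Linear flows on `V` and the comparison of the orbits. -/

noncomputable section

namespace FourVector

attribute [local instance 100] LieRing.ofAssociativeRing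

universe u

variable {V : Type u} [AddCommGroup V] [Module ℂ V]

section Flow

variable {κ : Type*} [Fintype κ] (e : Module.Basis κ ℂ V)

/-- The product rule for a multilinear map on a space with a basis, in coordinates. -/
theorem hasDerivAt_multilinearMap {ι W F : Type*} [Fintype ι] [DecidableEq ι] [AddCommGroup W]
    [Module ℂ W] [NormedAddCommGroup F] [NormedSpace ℝ F]
    (f : MultilinearMap ℂ (fun _ : ι => V) W) (ψ : W →ₗ[ℝ] F) {c : ι → ℝ → V} {c' : ι → V} {t : ℝ}
    (hc : ∀ a k, HasDerivAt (fun t => e.coord k (c a t)) (e.coord k (c' a)) t) :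
    HasDerivAt (fun t => ψ (f fun a => c a t))
      (ψ (∑ a, f (Function.update (fun b => c b t) a (c' a)))) t := by
  let L : (ι → κ) → ℂ →L[ℝ] F := fun q => LinearMap.toContinuousLinearMap
    (ψ ∘ₗ ((LinearMap.toSpanSingleton ℂ W (f fun i => e (q i))).restrictScalars ℝ))
  have hL : ∀ q z, L q z = ψ (z • f fun i => e (q i)) := fun q z => rfl
  have h1 : ∀ v : ι → V, ψ (f v) = ∑ q : ι → κ, L q (∏ a, e.coord (q a) (v a)) := fun v => by
    rw [MultilinearMap.apply_eq_sum_basis e f v, map_sum]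
    simp only [hL]
  have h2 : HasDerivAt (fun t => ∑ q : ι → κ, L q (∏ a, e.coord (q a) (c a t)))
      (∑ q : ι → κ, L q (∑ a, (∏ b ∈ Finset.univ.erase a, e.coord (q b) (c b t)) •
        e.coord (q a) (c' a))) t := by
    refine HasDerivAt.fun_sum fun q _ => ?_
    exact (L q).hasFDerivAt.comp_hasDerivAt t
      (HasDerivAt.fun_finsetProd fun a _ => hc a (q a))
  refine (h2.congr_deriv ?_).congr_of_eventuallyEq (Filter.Eventually.of_forall fun s => h1 _)
  simp only [map_sum, h1]
  rw [Finset.sum_comm]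
  refine Finset.sum_congr rfl fun a _ => Finset.sum_congr rfl fun q _ => congrArg (L q) ?_
  rw [← Finset.mul_prod_erase _ _ (Finset.mem_univ a), Function.update_self, smul_eq_mul, mul_comm]
  congr 1
  refine Finset.prod_congr rfl fun b hb => ?_
  rw [Function.update_of_ne (Finset.ne_of_mem_erase hb)]

/-- `u t` is a fundamental solution of the linear equation `v' = A v`, that is `u t = exp (t A)`. -/
structure IsFlow (A : Module.End ℂ V) (u : ℝ → Module.End ℂ V) : Prop where
  map_zero : u 0 = 1
  hasDerivAt : ∀ v k t, HasDerivAt (fun t => e.coord k (u t v)) (e.coord k (A (u t v))) t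

variable {e} {A : Module.End ℂ V} {u : ℝ → Module.End ℂ V}

/-- No norm is put on `⋀⁴V`; derivatives are taken after an arbitrary real-linear map `ψ` into a
normed space. The induction needs all `ψ` at once, since a scalar is absorbed into it. -/
theorem IsFlow.hasDerivAt_map (h : IsFlow e A u) {F : Type*} [NormedAddCommGroup F]
    [NormedSpace ℝ F] (ψ : ⋀[ℂ]^4 V →ₗ[ℝ] F) (T : ⋀[ℂ]^4 V) (t : ℝ) :
    HasDerivAt (fun t => ψ (exteriorPower.map 4 (u t) T))
      (ψ (action A (exteriorPower.map 4 (u t) T))) t := by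
  induction T using exteriorPower_induction generalizing ψ with
  | ιMulti v =>
    simp only [exteriorPower.map_apply_ιMulti, action_ιMulti]
    exact hasDerivAt_multilinearMap e (exteriorPower.ιMulti ℂ 4).toMultilinearMap ψ
      fun a k => h.hasDerivAt (v a) k t
  | add S T hS hT =>
    simp only [map_add]
    exact (hS ψ).add (hT ψ)
  | smul c T hT =>
    have := hT (ψ ∘ₗ ((LinearMap.lsmul ℂ (⋀[ℂ]^4 V) c).restrictScalars ℝ))
    simp only [map_smul]
    exact this

/-- Liouville's formula: the derivative of the determinant is the trace of `A` times the
determinant, that is, zero. -/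
theorem IsFlow.det_eq_one [DecidableEq κ] (h : IsFlow e A u) (hA : LinearMap.trace ℂ V A = 0)
    (t : ℝ) : LinearMap.det (u t) = 1 := by
  have h1 : ∀ t, HasDerivAt (fun t => LinearMap.det (u t)) 0 t := by
    intro t
    have h2 := hasDerivAt_multilinearMap e e.det.toMultilinearMap
      (LinearMap.id (R := ℝ) (M := ℂ)) (c := fun a t => u t (e a)) (c' := fun a => A (u t (e a)))
      (t := t) fun a k => h.hasDerivAt (e a) k t
    have h3 : ∑ a, e.det.toMultilinearMap (Function.update (fun b => u t (e b)) a
        (A (u t (e a)))) = 0 := by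
      have := AlternatingMap.sum_update_eq_trace e e.det A (fun b => u t (e b))
      rw [hA, zero_smul] at this
      exact this
    rw [h3] at h2
    refine (h2.congr_deriv (LinearMap.map_zero _)).congr_of_eventuallyEq
      (Filter.Eventually.of_forall fun s => ?_)
    change LinearMap.det (u s) = e.det fun a => u s (e a)
    have := e.det_comp (u s) e
    rw [e.det_self, mul_one] at this
    exact this.symm
  have h2 := is_const_of_deriv_eq_zero (fun t => (h1 t).differentiableAt)
    (fun t => (h1 t).deriv) t 0
  rw [h2, h.map_zero, map_one]

variable (e) in
theorem isFlow_toLin [DecidableEq κ] {M : Matrix κ κ ℂ} {u : ℝ → Matrix κ κ ℂ} (h0 : u 0 = 1)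
    (h : ∀ i j t, HasDerivAt (fun t => u t i j) ((M * u t) i j) t) :
    IsFlow e (Matrix.toLin e e M) fun t => Matrix.toLin e e (u t) where
  map_zero := by simp only [h0, Matrix.toLin_one]; rfl
  hasDerivAt v k t := by
    have hc : ∀ (N : Matrix κ κ ℂ) (v : V), e.coord k (Matrix.toLin e e N v) =
        ∑ j, N k j * e.coord j v := by
      intro N v
      rw [Matrix.toLin_apply, map_sum]
      simp [Matrix.mulVec, dotProduct, Finsupp.single_apply]
    rw [← Matrix.toLin_mul_apply]
    simp only [hc]
    exact HasDerivAt.fun_sum fun j _ => (h k j t).mul_const _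

variable (e) in
theorem exists_isFlow [DecidableEq κ] (A : Module.End ℂ V) : ∃ u, IsFlow e A u := by
  let _ : NormedRing (Matrix κ κ ℂ) := Matrix.linftyOpNormedRing
  let _ : NormedAlgebra ℝ (Matrix κ κ ℂ) := Matrix.linftyOpNormedAlgebra
  have hA : A = Matrix.toLin e e (LinearMap.toMatrix e e A) := by simp
  rw [hA]
  refine ⟨_, isFlow_toLin e (u := fun t => NormedSpace.exp (t • LinearMap.toMatrix e e A))
    (by simp) fun i j t => ?_⟩
  have h := hasDerivAt_exp_smul_const' (𝕂 := ℝ) (LinearMap.toMatrix e e A) t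
  let L : Matrix κ κ ℂ →L[ℝ] ℂ := LinearMap.toContinuousLinearMap
    (Matrix.entryLinearMap ℝ ℂ i j)
  exact L.hasFDerivAt.comp_hasDerivAt t h

-- The matrix `single i j c` has square zero, so its exponential series stops after the linear term.
variable (e) in
theorem isFlow_transvection [DecidableEq κ] {i j : κ} (hij : i ≠ j) (c : ℂ) :
    IsFlow e (Matrix.toLin e e (Matrix.single i j c)) fun t =>
      Matrix.toLin e e (Matrix.transvection i j (t • c)) := by
  refine isFlow_toLin e (by simp) fun k l t => ?_
  have h1 : Matrix.single i j c * Matrix.transvection i j (t • c) = Matrix.single i j c := by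
    rw [Matrix.transvection, mul_add, mul_one, Matrix.single_mul_single_of_ne _ _ _ _ hij.symm,
      add_zero]
  rw [h1]
  have h2 : ∀ s : ℝ, Matrix.transvection i j (s • c) k l =
      (1 : Matrix κ κ ℂ) k l + s • Matrix.single i j c k l := by
    intro s
    rw [Matrix.transvection, Matrix.add_apply, ← Matrix.smul_single, Matrix.smul_apply]
  simp only [h2]
  simpa using ((hasDerivAt_id t).smul_const (Matrix.single i j c k l)).const_add
    ((1 : Matrix κ κ ℂ) k l)

variable (e) in
theorem isFlow_diagonal [DecidableEq κ] (c : κ → ℂ) :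
    IsFlow e (Matrix.toLin e e (Matrix.diagonal c)) fun t =>
      Matrix.toLin e e (Matrix.diagonal fun k => Complex.exp (t * c k)) := by
  refine isFlow_toLin e (by simp) fun k l t => ?_
  rw [Matrix.diagonal_mul_diagonal]
  by_cases hkl : k = l
  · subst hkl
    simp only [Matrix.diagonal_apply_eq]
    have h1 : HasDerivAt (fun t : ℝ => (t : ℂ) * c k) (1 * c k) t :=
      (Complex.ofRealCLM.hasDerivAt).mul_const (c k)
    simpa [mul_comm] using h1.cexp
  · simp only [Matrix.diagonal_apply_ne _ hkl]
    exact hasDerivAt_const _ _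

end Flow

section LieGroup

variable {E : Type*} [NormedAddCommGroup E] [NormedSpace ℝ E] [FiniteDimensional ℝ E]
  {G : Type*} [TopologicalSpace G] [ChartedSpace E G] [Group G] [LieGroup 𝓘(ℝ, E) ∞ G]

/-- The solutions of the linear equation `w' = [x, w]` in the Lie algebra of a Lie group are given
by the adjoint representation. -/
theorem IsOneParameterSubgroup.Ad_eq {γ : ℝ → G} {x : GroupLieAlgebra 𝓘(ℝ, E) G}
    (h : IsOneParameterSubgroup γ x) {w : ℝ → GroupLieAlgebra 𝓘(ℝ, E) G}
    (hw : ∀ t, HasDerivAt (F := E) w (⁅x, w t⁆ : GroupLieAlgebra 𝓘(ℝ, E) G) t) (t : ℝ) : Ad (γ t) (w 0) = w t := by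
  have : CompleteSpace E := FiniteDimensional.complete ℝ E
  let b := Module.finBasis ℝ E
  -- The formula for the bracket in the chart exhibits `y ↦ [x, y]` as a real-linear map on `E`.
  let adx : E →ₗ[ℝ] E := (chartMulSnd E G ((x : E), (0 : E)) ∘L ContinuousLinearMap.inr ℝ E E -
    (chartMulSnd E G).flip ((0 : E), (x : E)) ∘L ContinuousLinearMap.inl ℝ E E).toLinearMap
  have hadx : ∀ y : GroupLieAlgebra 𝓘(ℝ, E) G, 
      @Eq E (⁅x, y⁆ : GroupLieAlgebra 𝓘(ℝ, E) G) (adx y) := fun y =>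
    lie_eq_chartMulSnd x y
  let A : G → E →ₗ[ℝ] E := fun g => (adLin g : E →L[ℝ] E).toLinearMap
  have hA : ∀ y t, HasDerivAt (fun t => A (γ t) y) (A (γ t) (adx y)) t := fun y t =>
    HasDerivAt.congr_deriv (F := E) (h.hasDerivAt_Ad y t) (congrArg (A (γ t)) (hadx y))
  have hA' : ∀ y t, HasDerivAt (fun t => A (γ (-t)) y) (-A (γ (-t)) (adx y)) t := fun y t => by
    simpa using! (hA y (-t)).scomp t (hasDerivAt_neg t)
  have hwi : ∀ i t, HasDerivAt (fun t => b.coord i (w t)) (b.coord i (adx (w t))) t := fun i t =>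
    (LinearMap.toContinuousLinearMap (b.coord i)).hasFDerivAt.comp_hasDerivAt t
      (HasDerivAt.congr_deriv (F := E) (hw t) (hadx (w t)))
  have hsum : ∀ (f : E →ₗ[ℝ] E) (y : E), f y = ∑ i, b.coord i y • f (b i) := fun f y => by
    conv_lhs => rw [← b.sum_repr y, map_sum]
    simp
  -- Variation of constants: the derivative is `-Ad(γ(-t)) [x, w] + Ad(γ(-t)) [x, w]`. The product
  -- rule is applied after expanding `w` in the basis `b`.
  have hk : ∀ t, HasDerivAt (fun t => A (γ (-t)) (w t)) 0 t := by
    intro t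
    have h1 := HasDerivAt.fun_sum (u := Finset.univ) fun i _ => (hwi i t).smul (hA' (b i) t)
    refine (h1.congr_deriv ?_).congr_of_eventuallyEq
      (Filter.Eventually.of_forall fun s => hsum _ _)
    rw [Finset.sum_add_distrib, ← hsum (A (γ (-t)))]
    have h2 : A (γ (-t)) (adx (w t)) = ∑ i, b.coord i (w t) • A (γ (-t)) (adx (b i)) :=
      hsum (A (γ (-t)) ∘ₗ adx) (w t)
    simp only [smul_neg, Finset.sum_neg_distrib]
    rw [h2, neg_add_cancel]
  have h2 := is_const_of_deriv_eq_zero (fun t => (hk t).differentiableAt)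
    (fun t => (hk t).deriv) t 0
  have h3 : Ad (γ (-t)) (w t) = w 0 := by
    have h4 : Ad (γ (-t)) (w t) = Ad (γ (-0)) (w 0) := h2
    rw [neg_zero, h.map_zero, Ad_one] at h4
    exact h4
  rw [← h3, ← Ad_mul, ← h.map_add, add_neg_cancel, h.map_zero, Ad_one]

end LieGroup

section Orbits

variable (e : Module.Basis (Fin 8) ℂ V) (δ : V [⋀^Fin 8]→ₗ[ℂ] ℂ)
  {E : Type*} [NormedAddCommGroup E] [NormedSpace ℝ E] [FiniteDimensional ℝ E]
  {G : Type*} [TopologicalSpace G] [ChartedSpace E G] [Group G] [LieGroup 𝓘(ℝ, E) ∞ G]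
  (φ : GroupLieAlgebra 𝓘(ℝ, E) G ≃ₗ[ℝ] 𝔤 e δ)

/-- The subgroup of `G` corresponding to `L₀(V)` acts on `⋀⁴V` through exponentials of operators. -/
theorem Ad_eq_of_isFlow (hφ : ∀ x y, φ ⁅x, y⁆ = ⁅φ x, φ y⁆) {γ : ℝ → G}
    {x : GroupLieAlgebra 𝓘(ℝ, E) G} (hγ : IsOneParameterSubgroup γ x) {A : L₀ V}
    (hx : φ x = inl e δ A) {u : ℝ → Module.End ℂ V} (hu : IsFlow e (A : Module.End ℂ V) u)
    (T : ⋀[ℂ]^4 V) :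
    φ (Ad (γ 1) (φ.symm (inr e δ T))) = inr e δ (exteriorPower.map 4 (u 1) T) := by
  let ψ : ⋀[ℂ]^4 V →ₗ[ℝ] E := φ.symm.toLinearMap ∘ₗ (inr e δ).restrictScalars ℝ
  have hw : ∀ t, HasDerivAt (F := E) (fun t => φ.symm (inr e δ (exteriorPower.map 4 (u t) T)))
      (⁅x, φ.symm (inr e δ (exteriorPower.map 4 (u t) T))⁆ : GroupLieAlgebra 𝓘(ℝ, E) G) t := by
    intro t
    have h1 := hu.hasDerivAt_map ψ T t
    have h2 : ⁅x, φ.symm (inr e δ (exteriorPower.map 4 (u t) T))⁆ =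
        φ.symm (inr e δ (action (A : Module.End ℂ V) (exteriorPower.map 4 (u t) T))) := by
      rw [← lie_inl_inr, LinearEquiv.eq_symm_apply, hφ, hx, LinearEquiv.apply_symm_apply]
    rw [h2]
    exact h1
  have h := hγ.Ad_eq hw 1
  rw [hu.map_zero] at h
  have h0 : exteriorPower.map 4 (1 : Module.End ℂ V) T = T :=
    congrArg (fun f => f T) (exteriorPower.map_id (R := ℂ) (M := V) (n := 4))
  simp only [h0] at h
  rw [h, LinearEquiv.apply_symm_apply]

/-- A generator `exp A` acts as the time-one flow of `A`, which has determinant 1; products and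
inverses correspond to those in `SL(V)`. -/
theorem exists_specialLinearGroup_of_mem (hφ : ∀ x y, φ ⁅x, y⁆ = ⁅φ x, φ y⁆) {g : G}
    (hg : g ∈ connectedSubgroup (φ ⁻¹' Set.range (inl e δ))) :
    ∃ a : SpecialLinearGroup ℂ V, ∀ T : ⋀[ℂ]^4 V, φ (Ad g (φ.symm (inr e δ T))) =
      inr e δ (exteriorPower.map 4 (a : V ≃ₗ[ℂ] V).toLinearMap T) := by
  induction hg using Subgroup.closure_induction with
  | mem g hg =>
    obtain ⟨x, ⟨A, hA⟩, γ, hγ, rfl⟩ := hg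
    obtain ⟨u, hu⟩ := exists_isFlow e (A : Module.End ℂ V)
    have hdet := hu.det_eq_one A.2 1
    have : Module.Finite ℂ V := Module.Finite.of_basis e
    refine ⟨⟨LinearEquiv.ofIsUnitDet (f := u 1) (v := e) (v' := e) ?_, ?_⟩, fun T => ?_⟩
    · rw [LinearMap.det_toMatrix, hdet]
      exact isUnit_one
    · apply Units.ext
      rw [LinearEquiv.coe_det, LinearEquiv.coe_ofIsUnitDet, hdet]
      rfl
    · exact Ad_eq_of_isFlow e δ φ hφ hγ hA.symm hu T
  | one => exact ⟨1, fun T => by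
      rw [Ad_one, LinearEquiv.apply_symm_apply]
      exact (congrArg (inr e δ) (congrArg (fun f => f T)
        (exteriorPower.map_id (R := ℂ) (M := V) (n := 4)))).symm⟩
  | mul g h _ _ hg hh =>
    obtain ⟨a, ha⟩ := hg
    obtain ⟨b, hb⟩ := hh
    refine ⟨a * b, fun T => ?_⟩
    rw [Ad_mul, ← φ.symm_apply_apply (Ad h _), hb, ha]
    exact congrArg (inr e δ) (congrArg (fun f => f T)
        (exteriorPower.map_comp (n := 4) b.1.toLinearMap a.1.toLinearMap)).symm
  | inv g _ hg =>
    obtain ⟨a, ha⟩ := hg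
    refine ⟨a⁻¹, fun T => ?_⟩
    set S := exteriorPower.map 4 ((a⁻¹ : SpecialLinearGroup ℂ V) : V ≃ₗ[ℂ] V).toLinearMap T with hS
    have hT : exteriorPower.map 4 (a : V ≃ₗ[ℂ] V).toLinearMap S = T := by
      have h1 : (a : V ≃ₗ[ℂ] V).toLinearMap ∘ₗ
          ((a⁻¹ : SpecialLinearGroup ℂ V) : V ≃ₗ[ℂ] V).toLinearMap = LinearMap.id := by
        ext v
        exact LinearEquiv.apply_symm_apply a.1 v
      rw [hS, ← LinearMap.comp_apply, ← exteriorPower.map_comp, h1, exteriorPower.map_id]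
      rfl
    have h1 := ha S
    rw [hT, ← LinearEquiv.eq_symm_apply] at h1
    rw [← h1, ← Ad_mul, inv_mul_cancel, Ad_one, LinearEquiv.apply_symm_apply]

theorem exists_mem_of_isFlow [T2Space G] (hφ : ∀ x y, φ ⁅x, y⁆ = ⁅φ x, φ y⁆)
    {A : Module.End ℂ V} (hA : LinearMap.trace ℂ V A = 0) {u : ℝ → Module.End ℂ V}
    (hu : IsFlow e A u) :
    ∃ g ∈ connectedSubgroup (φ ⁻¹' Set.range (inl e δ)), ∀ T : ⋀[ℂ]^4 V,
      φ (Ad g (φ.symm (inr e δ T))) = inr e δ (exteriorPower.map 4 (u 1) T) := by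
  have : CompleteSpace E := FiniteDimensional.complete ℝ E
  obtain ⟨γ, hγ⟩ := exists_isOneParameterSubgroup (φ.symm (inl e δ ⟨A, hA⟩))
  have hx := φ.apply_symm_apply (inl e δ ⟨A, hA⟩)
  exact ⟨γ 1, Subgroup.subset_closure ⟨_, ⟨_, hx.symm⟩, γ, hγ, rfl⟩,
    Ad_eq_of_isFlow e δ φ hφ hγ hx hu⟩

/-- Gaussian elimination writes `M` as a product of transvections and a diagonal matrix of
determinant 1, and each factor is the exponential of a trace-zero matrix. -/
theorem exists_mem_of_det_eq_one [T2Space G] (hφ : ∀ x y, φ ⁅x, y⁆ = ⁅φ x, φ y⁆)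
    {M : Matrix (Fin 8) (Fin 8) ℂ} (hM : M.det = 1) :
    ∃ g ∈ connectedSubgroup (φ ⁻¹' Set.range (inl e δ)), ∀ T : ⋀[ℂ]^4 V,
      φ (Ad g (φ.symm (inr e δ T))) =
        inr e δ (exteriorPower.map 4 (Matrix.toLin e e M) T) := by
  refine Matrix.diagonal_transvection_induction (fun M =>
    ∃ g ∈ connectedSubgroup (φ ⁻¹' Set.range (inl e δ)), ∀ T : ⋀[ℂ]^4 V,
      φ (Ad g (φ.symm (inr e δ T))) =
        inr e δ (exteriorPower.map 4 (Matrix.toLin e e M) T)) M ?_ ?_ ?_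
  · intro D hD
    rw [hM, Matrix.det_diagonal] at hD
    have hD0 : ∀ k, D k ≠ 0 := fun k h => by
      rw [Finset.prod_eq_zero (Finset.mem_univ k) h] at hD
      exact zero_ne_one hD
    -- The principal logarithms need only add up to a multiple of `2πi`. The entry at `0` is chosen
    -- to make the sum exactly zero, and it still exponentiates to `D 0` because the product of the
    -- `D k` is 1.
    let c : Fin 8 → ℂ := fun k => if k = 0 then -∑ j ∈ Finset.univ.erase 0, Complex.log (D j) else
      Complex.log (D k)
    have hc : ∀ k, k ≠ 0 → c k = Complex.log (D k) := fun k hk => if_neg hk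
    have hc0 : c 0 = -∑ j ∈ Finset.univ.erase 0, Complex.log (D j) := if_pos rfl
    have hexp : ∀ k, Complex.exp ((1 : ℝ) * c k) = D k := by
      intro k
      rw [Complex.ofReal_one, one_mul]
      by_cases hk : k = 0
      · rw [hk, hc0, Complex.exp_neg, Complex.exp_sum, inv_eq_iff_eq_inv]
        rw [← Finset.mul_prod_erase _ _ (Finset.mem_univ 0)] at hD
        rw [Finset.prod_congr rfl fun j _ => Complex.exp_log (hD0 j)]
        exact eq_inv_of_mul_eq_one_right hD
      · rw [hc k hk, Complex.exp_log (hD0 k)]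
    have htr : LinearMap.trace ℂ V (Matrix.toLin e e (Matrix.diagonal c)) = 0 := by
      rw [LinearMap.trace_eq_matrix_trace ℂ e, LinearMap.toMatrix_toLin, Matrix.trace_diagonal,
        ← Finset.add_sum_erase _ _ (Finset.mem_univ 0), hc0,
        Finset.sum_congr rfl fun j hj => hc j (Finset.ne_of_mem_erase hj), neg_add_cancel]
    have h := exists_mem_of_isFlow e δ φ hφ htr (isFlow_diagonal e c)
    simp only [hexp] at h
    exact h
  · intro t
    have htr : LinearMap.trace ℂ V (Matrix.toLin e e (Matrix.single t.i t.j t.c)) = 0 := by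
      rw [LinearMap.trace_eq_matrix_trace ℂ e, LinearMap.toMatrix_toLin,
        Matrix.trace_single_eq_of_ne _ _ _ t.hij]
    have h := exists_mem_of_isFlow e δ φ hφ htr (isFlow_transvection e t.hij t.c)
    simp only [one_smul] at h
    exact h
  · rintro M N ⟨g, hg, hgT⟩ ⟨h, hh, hhT⟩
    refine ⟨g * h, mul_mem hg hh, fun T => ?_⟩
    rw [Ad_mul, ← φ.symm_apply_apply (Ad h _), hhT, hgT, Matrix.toLin_mul e e e,
      exteriorPower.map_comp]
    rfl

/-- The orbits on `⋀⁴V` of the subgroup of `G` corresponding to `L₀(V)` are those of `SL(V)`. -/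
theorem orbit_eq [T2Space G] (hφ : ∀ x y, φ ⁅x, y⁆ = ⁅φ x, φ y⁆) (T : ⋀[ℂ]^4 V) :
    {x | ∃ g ∈ connectedSubgroup (φ ⁻¹' Set.range (inl e δ)),
        φ (Ad g (φ.symm (inr e δ T))) = x} =
      {x | ∃ a : SpecialLinearGroup ℂ V,
        inr e δ (exteriorPower.map 4 (a : V ≃ₗ[ℂ] V).toLinearMap T) = x} := by
  ext x
  constructor
  · rintro ⟨g, hg, rfl⟩
    obtain ⟨a, ha⟩ := exists_specialLinearGroup_of_mem e δ φ hφ hg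
    exact ⟨a, (ha T).symm⟩
  · rintro ⟨a, rfl⟩
    obtain ⟨g, hg, h⟩ := exists_mem_of_det_eq_one e δ φ hφ
      (M := LinearMap.toMatrix e e (a : V ≃ₗ[ℂ] V).toLinearMap)
      (by rw [LinearMap.det_toMatrix]; exact a.det_eq_one)
    rw [Matrix.toLin_toMatrix] at h
    exact ⟨g, hg, h T⟩

end Orbits

end FourVector

end

/-! ### Cartan matrices of types `A₇` and `E₇` from integral data. -/

noncomputable section

namespace FourVector

attribute [local instance 100] LieRing.ofAssociativeRing

universe u

variable {V : Type u} [AddCommGroup V] [Module ℂ V]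

section Integral

open LieAlgebra LieAlgebra.IsKilling

variable {M : Type*} [AddCommGroup M] [Module ℂ M]

/-- The integral combination `∑ k, n k • ε k`. -/
def intComb (ε : Fin 8 → Module.Dual ℂ M) (n : Fin 8 → ℤ) : Module.Dual ℂ M := ∑ k, n k • ε k

theorem intComb_apply (ε : Fin 8 → Module.Dual ℂ M) (n : Fin 8 → ℤ) (a : M) :
    intComb ε n a = ∑ k, (n k : ℂ) * ε k a := by
  simp [intComb, LinearMap.sum_apply]

theorem intComb_single_sub_single (ε : Fin 8 → Module.Dual ℂ M) (i j : Fin 8) :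
    intComb ε (Pi.single i 1 - Pi.single j 1) = ε i - ε j := by
  simp [intComb, sub_smul, Finset.sum_sub_distrib, Pi.single_apply, ite_smul]

/-- The constant vector `(t, …, t)` contributes `t ∑ ε_k = 0`, so coordinates are needed only modulo
it. -/
theorem intComb_eq_sum {ε : Fin 8 → Module.Dual ℂ M} (hε : ∑ k, ε k = 0) {m : ℕ}
    {N : Fin m → Fin 8 → ℤ} {n : Fin 8 → ℤ} {c : Fin m → ℤ} {t : ℤ}
    (h : ∀ k, n k = ∑ i, c i * N i k + t) : intComb ε n = ∑ i, c i • intComb ε (N i) := by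
  simp only [intComb, h, add_smul, Finset.sum_add_distrib, ← Finset.smul_sum, hε, smul_zero,
    add_zero, Finset.sum_smul, mul_smul]
  rw [Finset.sum_comm]
  simp only [Finset.smul_sum]

variable {L : Type*} [LieRing L] [LieAlgebra ℂ L] [FiniteDimensional ℂ L]
  [LieAlgebra.IsKilling ℂ L] {H : LieSubalgebra ℂ L} [H.IsCartanSubalgebra]

/-- The Cartan matrix of a semisimple Lie algebra whose roots are integral combinations of eight
functionals with sum zero, from integral data. -/
theorem hasCartanMatrix_of_integral {m : ℕ} {C : Matrix (Fin m) (Fin m) ℤ}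
    {ε : Fin 8 → Module.Dual ℂ H} (hε : ∑ k, ε k = 0) {d : ∀ c : Fin 8 → ℂ, ∑ k, c k = 0 → H}
    (hd : ∀ c hc k, ε k (d c hc) = c k) {D : ℤ} (hD : D ≠ 0) {N h W : Fin m → Fin 8 → ℤ}
    (hh : ∀ i, ∑ k, ((h i k : ℂ) / 2) = 0) (hW : ∀ i, ∑ k, W i k = 0)
    (hNh : ∀ i j, ∑ k, N i k * h j k = 2 * C i j) (hC : ∀ i, C i i = 2)
    (hNW : ∀ i j, ∑ k, N i k * W j k = if i = j then D else 0)
    (gen : ∀ i, ∃ x y : L, (∀ a : H, ⁅(a : L), x⁆ = intComb ε (N i) a • x) ∧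
      (∀ a : H, ⁅(a : L), y⁆ = -intComb ε (N i) a • y) ∧ ⁅x, y⁆ = d _ (hh i))
    (hpos : ∀ β ∈ Set.range (rootSystem H).root, ∃ (n : Fin 8 → ℤ) (c : Fin m → ℤ) (t : ℤ),
      β = intComb ε n ∧ (∀ k, n k = ∑ i, c i * N i k + t) ∧ ((∀ i, 0 ≤ c i) ∨ ∀ i, c i ≤ 0)) :
    HasCartanMatrix H C := by
  choose x y hx hy hxy using gen
  refine hasCartanMatrix_of_generators (α := fun i => intComb ε (N i)) hx hy hxy ?_ hC ?_ ?_
  · intro i j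
    rw [intComb_apply]
    simp only [hd]
    -- The integer vector `h j` is twice a coroot, because coroots of type `E₇` have half-integral
    -- entries here.
    have h1 : ((∑ k, N i k * h j k : ℤ) : ℂ) = (2 * C i j : ℤ) := by rw [hNh]
    push_cast at h1
    rw [← mul_right_inj' (two_ne_zero (α := ℂ)), ← h1, Finset.mul_sum]
    exact Finset.sum_congr rfl fun k _ => by ring
  -- The diagonal elements given by the `W j` form a dual family to the `N i` up to the factor `D`,
  -- so evaluating a relation at them isolates each coefficient.
  · rw [Fintype.linearIndependent_iff]
    intro g hg j
    have hWj : ∑ k, (W j k : ℂ) = 0 := by exact_mod_cast hW j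
    have h1 := congrArg (fun f => f (d (fun k => (W j k : ℂ)) hWj)) hg
    simp only [LinearMap.sum_apply, LinearMap.smul_apply, LinearMap.zero_apply, intComb_apply, hd,
      smul_eq_mul] at h1
    have h2 : ∀ i, ∑ k, (N i k : ℂ) * W j k = if i = j then (D : ℂ) else 0 := fun i => by
      have h3 := congrArg (fun z : ℤ => (z : ℂ)) (hNW i j)
      push_cast at h3
      exact h3
    simp only [h2] at h1
    simpa [hD] using h1
  · intro β hβ
    obtain ⟨n, c, t, rfl, hn, hc⟩ := hpos β hβ
    rw [intComb_eq_sum hε hn]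
    have key : ∀ c : Fin m → ℤ, (∀ i, 0 ≤ c i) → ∑ i, c i • intComb ε (N i) ∈
        AddSubmonoid.closure (Set.range fun i => intComb ε (N i)) := by
      intro c hc
      refine AddSubmonoid.sum_mem _ fun i _ => ?_
      obtain ⟨z, hz⟩ := Int.eq_ofNat_of_zero_le (hc i)
      rw [hz, natCast_zsmul]
      exact nsmul_mem (AddSubmonoid.subset_closure (Set.mem_range_self i)) z
    rcases hc with hc | hc
    · exact Or.inl (key c hc)
    · right
      have := key (fun i => -c i) fun i => neg_nonneg.mpr (hc i)
      simpa [neg_smul, Finset.sum_neg_distrib] using this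

end Integral

section Functionals

variable (e : Module.Basis (Fin 8) ℂ V) (δ : V [⋀^Fin 8]→ₗ[ℂ] ℂ)

theorem sum_ε₀ : ∑ k, ε₀ e k = 0 := by
  ext A
  have h := (A : L₀ V).2
  rw [mem_L₀, LinearMap.trace_eq_matrix_trace ℂ e] at h
  rw [LinearMap.sum_apply]
  exact h

theorem sum_ε [IsLieBracket e δ] : ∑ k, ε e δ k = 0 := by
  ext A
  obtain ⟨c, hc, rfl⟩ := exists_eq_diagElem e δ A
  simp [LinearMap.sum_apply, hc]

/-- The simple roots `ε_i - ε_{i+1}` of type `A₇`, as integral combinations of the `ε_k`. -/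
def simpleA (i : Fin 7) : Fin 8 → ℤ := Pi.single i.castSucc 1 - Pi.single i.succ 1

/-- Multiples of the fundamental coweights of type `A₇`. -/
def coweightA (j : Fin 7) (k : Fin 8) : ℤ :=
  if (k : ℕ) ≤ j then 7 - (j : ℕ) else -((j : ℕ) + 1)

/-- The coordinates of an integral vector with sum zero with respect to `simpleA`. -/
def coeffA (n : Fin 8 → ℤ) (i : Fin 7) : ℤ := ∑ k : Fin 8, if (k : ℕ) ≤ i then n k else 0

theorem diagOp_congr {c c' : Fin 8 → ℂ} (h : c = c') (hc : ∑ k, c k = 0) (hc' : ∑ k, c' k = 0) :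
    diagOp e c hc = diagOp e c' hc' := by
  subst h; rfl

theorem two_mul_single_sub_div (i j : Fin 8) :
    (fun k => (((2 * (Pi.single i 1 - Pi.single j 1 : Fin 8 → ℤ)) k : ℤ) : ℂ) / 2) =
      Pi.single i 1 - Pi.single j 1 := by
  funext k
  simp only [Pi.mul_apply, Pi.ofNat_apply, Pi.sub_apply, Pi.single_apply]
  push_cast
  ring

theorem hasCartanMatrix_diag [FiniteDimensional ℂ V] [LieAlgebra.IsSimple ℂ (L₀ V)] :
    HasCartanMatrix (diag e) (CartanMatrix.A 7) := by
  have hh : ∀ i, ∑ k, (((2 * simpleA i) k : ℤ) : ℂ) / 2 = 0 := fun i => by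
    have := sum_single_sub_single i.castSucc i.succ
    rwa [← two_mul_single_sub_div] at this
  -- `coweightA j` is eight times a fundamental coweight, its entries jumping by `(7 - j) + (j + 1)
  -- = 8` after position `j`; hence `D = 8`.
  refine hasCartanMatrix_of_integral (sum_ε₀ e) (d := diagElem₀ e) (fun c hc k => by simp)
    (D := 8) (by norm_num) (N := simpleA) (h := fun i => 2 * simpleA i) (W := coweightA) hh
    (by decide) (by decide) (by decide) (by decide) ?_ ?_
  · intro i
    have hi : i.castSucc ≠ i.succ := (Fin.castSucc_lt_succ (i := i)).ne
    refine ⟨matrixUnit e _ _ hi, matrixUnit e _ _ hi.symm, fun a => ?_, fun a => ?_, ?_⟩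
    · rw [simpleA, intComb_single_sub_single]; exact lie_matrixUnit_diag e hi a
    · rw [simpleA, intComb_single_sub_single, lie_matrixUnit_diag e hi.symm a,
        LinearMap.sub_apply, LinearMap.sub_apply, neg_sub]
    · rw [lie_matrixUnit_symm]
      exact diagOp_congr e (two_mul_single_sub_div _ _).symm _ (hh i)
  · intro β hβ
    rw [range_root_diag] at hβ
    obtain ⟨i, j, hij, rfl⟩ := hβ
    refine ⟨_, coeffA (Pi.single i 1 - Pi.single j 1), 0, (intComb_single_sub_single _ i j).symm,
      ?_, ?_⟩
    · clear hij hh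
      revert i j
      decide +kernel
    · clear hij hh
      revert i j
      decide +kernel

/-- The simple roots of type `E₇`, in Bourbaki's numbering, as integral combinations of the
functionals `ε_k`. -/
def simpleE : Fin 7 → Fin 8 → ℤ :=
  ![Pi.single 5 1 - Pi.single 6 1, ![0, 0, 0, 0, 1, 1, 1, 1], Pi.single 4 1 - Pi.single 5 1,
    Pi.single 3 1 - Pi.single 4 1, Pi.single 2 1 - Pi.single 3 1, Pi.single 1 1 - Pi.single 2 1,
    Pi.single 0 1 - Pi.single 1 1]

/-- Twice the simple coroots of type `E₇`. -/
def corootE (i : Fin 7) : Fin 8 → ℤ :=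
  if i = 1 then ![-1, -1, -1, -1, 1, 1, 1, 1] else 2 * simpleE i

/-- The coordinates with respect to `simpleE` of an integral vector with sum `4 * τ`, modulo the
vector `(1, …, 1)`. -/
def coeffE (n : Fin 8 → ℤ) (τ : ℤ) : Fin 7 → ℤ :=
  ![n 0 + n 1 + n 2 + n 3 + n 4 + n 5 - 6 * (τ - n 7) - 2 * (2 * n 7 - τ),
    2 * n 7 - τ,
    n 0 + n 1 + n 2 + n 3 + n 4 - 5 * (τ - n 7) - (2 * n 7 - τ),
    n 0 + n 1 + n 2 + n 3 - 4 * (τ - n 7),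
    n 0 + n 1 + n 2 - 3 * (τ - n 7),
    n 0 + n 1 - 2 * (τ - n 7),
    n 0 - (τ - n 7)]

/-- Among the simple roots only `simpleE 1` involves slot 7 or has non-zero sum. Slot 7 and the
total sum thus determine its coefficient `2 n 7 - τ` and the shift `τ - n 7`; partial sums give the
other coefficients. -/
theorem eq_sum_coeffE_mul {n : Fin 8 → ℤ} {τ : ℤ} (h : ∑ k, n k = 4 * τ) (k : Fin 8) :
    n k = ∑ i, coeffE n τ i * simpleE i k + (τ - n 7) := by
  simp only [Fin.sum_univ_eight] at h
  simp only [Fin.sum_univ_seven]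
  fin_cases k <;> simp [coeffE, simpleE] <;> linarith

theorem coeffE_single_sub_single (i j : Fin 8) :
    (∀ a, 0 ≤ coeffE (Pi.single i 1 - Pi.single j 1) 0 a) ∨
      ∀ a, coeffE (Pi.single i 1 - Pi.single j 1) 0 a ≤ 0 := by
  revert i j
  decide +kernel

/-- The entry at 7 decides the sign: a sum of four distinct `ε_k` is positive exactly when it
contains `ε 7`. -/
theorem coeffE_indicator {n : Fin 8 → ℤ} (h0 : ∀ k, 0 ≤ n k) (h1 : ∀ k, n k ≤ 1)
    (h : ∑ k, n k = 4) : (∀ a, 0 ≤ coeffE n 1 a) ∨ ∀ a, coeffE n 1 a ≤ 0 := by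
  simp only [Fin.sum_univ_eight] at h
  simp only [Fin.forall_fin_succ, coeffE] at h0 h1 ⊢
  simp at h0 h1 ⊢
  rcases (show n 7 = 0 ∨ n 7 = 1 by omega) with h7 | h7
  · right; omega
  · left; omega

/-- The bracket of the two complementary four-vectors acts by opposite scalars on the two blocks;
rescaling by the volume makes them `±1/2`. This supplies the coroot of the one simple root lying in
`⋀⁴V`. -/
theorem exists_bracketFour_wedge_eq_diagOp (hδ : δ ≠ 0) {c : Fin 8 → ℂ} (hc : ∑ k, c k = 0)
    (h0 : ∀ k : Fin 4, c (Fin.castAdd 4 k) = -(1 / 2))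
    (h1 : ∀ k : Fin 4, c (Fin.natAdd 4 k) = 1 / 2) :
    ∃ t : ℂ, bracketFour e δ (t • wedge e (Fin.natAdd 4)) (wedge e (Fin.castAdd 4)) =
      diagOp e c hc := by
  set v := vol δ (Sum.elim (fun a : Fin 4 => e (Fin.natAdd 4 a)) fun a => e (Fin.castAdd 4 a))
    with hv
  have hv0 : v ≠ 0 := vol_basis_ne_zero e hδ (Fin.natAdd_injective 4 4)
    (Fin.castAdd_injective 4 4) (by decide)
  refine ⟨v⁻¹, ?_⟩
  rw [bracketFour_smul_left]
  apply Subtype.ext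
  refine e.ext fun k => ?_
  rw [diagOp_apply]
  change v⁻¹ • (bracketFour e δ _ _ : Module.End ℂ V) (e k) = _
  rw [wedge, wedge]
  induction k using Fin.addCases (m := 4) (n := 4) with
  | left k =>
    rw [bracketFour_apply_right e δ _ (fun a : Fin 4 => e (Fin.castAdd 4 a)) k, ← hv, smul_smul,
      h0]
    congr 1
    field_simp
  | right k =>
    rw [bracketFour_apply_left e δ (fun a : Fin 4 => e (Fin.natAdd 4 a)) _ k, ← hv, smul_smul,
      h1]
    congr 1
    field_simp

theorem intComb_sum_single {M : Type*} [AddCommGroup M] [Module ℂ M]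
    (ε : Fin 8 → Module.Dual ℂ M) (i : Fin 4 → Fin 8) :
    intComb ε (fun k => ∑ a, if i a = k then 1 else 0) = ∑ a, ε (i a) := by
  simp only [intComb, Finset.sum_smul]
  rw [Finset.sum_comm]
  simp [ite_smul]

theorem simpleE_eq (i : Fin 7) : i = 1 ∨ ∃ k l : Fin 8, k ≠ l ∧
    simpleE i = Pi.single k 1 - Pi.single l 1 ∧ corootE i = 2 * simpleE i := by
  revert i
  decide

theorem sum_corootE_div (i : Fin 7) : ∑ k, ((corootE i k : ℤ) : ℂ) / 2 = 0 := by
  have h : ∀ i, ∑ k, corootE i k = 0 := by decide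
  rw [← Finset.sum_div, ← Int.cast_sum, h, Int.cast_zero, zero_div]

theorem hasCartanMatrix_𝔡 [IsLieBracket e δ] (hδ : δ ≠ 0) [LieAlgebra.IsSimple ℂ (𝔤 e δ)] :
    HasCartanMatrix (𝔡 e δ) CartanMatrix.E₇ := by
  -- The dual family `W` is obtained by applying `coeffE`, which is linear in `(n, τ)`, to four
  -- times each unit vector: the factor 4 makes the sum of the entries equal to `4 * 1`, and so `D =
  -- 4`.
  refine hasCartanMatrix_of_integral (sum_ε e δ) (d := diagElem e δ) (fun c hc k => by simp)
    (D := 4) (by norm_num) (N := simpleE) (h := corootE)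
    (W := fun j k => coeffE (Pi.single k 4) 1 j) sum_corootE_div
    (by decide) (by decide) (by decide) (by decide) ?_ ?_
  · intro i
    rcases simpleE_eq i with rfl | ⟨k, l, hkl, hi, hci⟩
    · have hN : intComb (ε e δ) (simpleE 1) = ∑ a : Fin 4, ε e δ (Fin.natAdd 4 a) := by
        rw [← intComb_sum_single]
        congr 1
        decide
      -- As all `ε_k` add up to zero, the complementary four-vector spans the opposite root space.
      have hN' : ∑ a : Fin 4, ε e δ (Fin.castAdd 4 a) = -∑ a : Fin 4, ε e δ (Fin.natAdd 4 a) := by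
        rw [eq_neg_iff_add_eq_zero, ← sum_ε e δ]
        exact (Fin.sum_univ_add (a := 4) (b := 4) (ε e δ)).symm
      have hc0 : ∀ k : Fin 4, corootE 1 (Fin.castAdd 4 k) = -1 := by decide
      have hc1 : ∀ k : Fin 4, corootE 1 (Fin.natAdd 4 k) = 1 := by decide
      obtain ⟨t, ht⟩ := exists_bracketFour_wedge_eq_diagOp e δ hδ (sum_corootE_div 1)
        (fun k => by rw [hc0]; norm_num) (fun k => by rw [hc1]; norm_num)
      refine ⟨inr e δ (t • wedge e (Fin.natAdd 4)), inr e δ (wedge e (Fin.castAdd 4)),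
        fun a => ?_, fun a => ?_, ?_⟩
      · rw [hN, map_smul, lie_smul, lie_inr_wedge, smul_comm]
      · rw [hN, lie_inr_wedge, hN', LinearMap.neg_apply]
      · rw [lie_inr_inr, ht]
        rfl
    · refine ⟨inl e δ (matrixUnit e k l hkl), inl e δ (matrixUnit e l k hkl.symm), fun a => ?_,
        fun a => ?_, ?_⟩
      · rw [hi, intComb_single_sub_single]; exact lie_inl_matrixUnit e δ hkl a
      · rw [hi, intComb_single_sub_single, lie_inl_matrixUnit e δ hkl.symm a,
          LinearMap.sub_apply, LinearMap.sub_apply, neg_sub]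
      · rw [lie_inl_inl, lie_matrixUnit_symm]
        refine congrArg (inl e δ) (diagOp_congr e ?_ _ (sum_corootE_div i))
        rw [hci, hi]
        exact (two_mul_single_sub_div k l).symm
  · intro β hβ
    rw [range_root_𝔡] at hβ
    rcases hβ with ⟨i, j, -, rfl⟩ | ⟨i, hi, rfl⟩
    · exact ⟨_, _, _, (intComb_single_sub_single _ i j).symm,
        eq_sum_coeffE_mul (τ := 0) (by simp), coeffE_single_sub_single i j⟩
    · have hs : ∑ k : Fin 8, ∑ a : Fin 4, (if i a = k then (1 : ℤ) else 0) = 4 := by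
        rw [Finset.sum_comm]
        simp
      refine ⟨_, _, _, (intComb_sum_single _ i).symm, eq_sum_coeffE_mul (τ := 1) hs,
        coeffE_indicator (fun k => ?_) (fun k => ?_) hs⟩
      · exact Finset.sum_nonneg fun a _ => by split_ifs <;> norm_num
      · rw [Finset.sum_boole]
        exact_mod_cast Finset.card_le_one.mpr fun a ha b hb => hi (by simp_all)

end Functionals

end FourVector

end

/-! ### Assembly of the theorem. -/

theorem mainTheorem1 {V : Type*} [AddCommGroup V] [Module ℂ V] [FiniteDimensional ℂ V]
    (e : Module.Basis (Fin 8) ℂ V) (δ : V [⋀^Fin 8]→ₗ[ℂ] ℂ) (hδ : δ ≠ 0) :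
    -- the action of `L₀(V)` on `⋀⁴V` in components
    (∀ (A : L₀ V) (T : ⋀[ℂ]^4 V) (i : Fin 4 → Fin 8),
      component e (action A T) i =
        ∑ a : Fin 4, ∑ s : Fin 8, LinearMap.toMatrix e e (A : Module.End ℂ V) (i a) s *
          component e T (Function.update i a s)) ∧
    -- `𝔤` is a Lie algebra, graded modulo 2
    ∃ _ : IsLieBracket e δ,
      Nonempty (GradedLieAlgebra (grading e δ)) ∧
      -- `𝔤` is simple of type `E₇`, `𝔡` is a Cartan subalgebra; roots and root spaces
      (∃ (_ : LieAlgebra.IsSimple ℂ (𝔤 e δ))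
          (_ : (𝔡 e δ).IsCartanSubalgebra),
        HasCartanMatrix (𝔡 e δ) CartanMatrix.E₇ ∧
        Set.range (LieAlgebra.IsKilling.rootSystem (𝔡 e δ)).root =
          {α | ∃ i j : Fin 8, i ≠ j ∧ α = ε e δ i - ε e δ j} ∪
          {α | ∃ i : Fin 4 → Fin 8, Function.Injective i ∧
            α = ∑ a : Fin 4, ε e δ (i a)} ∧
        (∀ (i j : Fin 8) (hij : i ≠ j),
          (∀ A : 𝔡 e δ,
            ⁅(A : 𝔤 e δ), inl e δ (matrixUnit e i j hij)⁆ =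
              (ε e δ i - ε e δ j) A •
                inl e δ (matrixUnit e i j hij)) ∧
          (LieAlgebra.rootSpace (𝔡 e δ)
              (ε e δ i - ε e δ j : 𝔡 e δ → ℂ)).toSubmodule =
            Submodule.span ℂ {inl e δ (matrixUnit e i j hij)}) ∧
        (∀ i : Fin 4 → Fin 8, Function.Injective i →
          (∀ A : 𝔡 e δ,
            ⁅(A : 𝔤 e δ), inr e δ (wedge e i)⁆ =
              (∑ a : Fin 4, ε e δ (i a)) A •
                inr e δ (wedge e i)) ∧
          (LieAlgebra.rootSpace (𝔡 e δ)
              (⇑(∑ a : Fin 4, ε e δ (i a)) : 𝔡 e δ → ℂ)).toSubmodule =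
            Submodule.span ℂ {inr e δ (wedge e i)})) ∧
      -- `𝔤₀ = L₀(V)` is simple of type `A₇` with the same Cartan subalgebra
      (∃ (_ : LieAlgebra.IsSimple ℂ (L₀ V))
          (_ : (diag e).IsCartanSubalgebra),
        HasCartanMatrix (diag e) (CartanMatrix.A 7) ∧
        Set.range (LieAlgebra.IsKilling.rootSystem (diag e)).root =
          {α | ∃ i j : Fin 8, i ≠ j ∧ α = ε₀ e i - ε₀ e j}) ∧
      -- for every connected Lie group `G` with Lie algebra `𝔤`, the orbits on `𝔤₁ = ⋀⁴V` of its
      -- connected subgroup `G₀` with Lie algebra `𝔤₀` are the orbits of `SL(V)`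
      ∀ (E : Type*) [NormedAddCommGroup E] [NormedSpace ℝ E] [FiniteDimensional ℝ E]
        (G : Type*) [TopologicalSpace G] [T2Space G] [ConnectedSpace G] [ChartedSpace E G]
        [Group G] [LieGroup 𝓘(ℝ, E) ∞ G]
        (φ : GroupLieAlgebra 𝓘(ℝ, E) G ≃ₗ[ℝ] 𝔤 e δ)
        (_ : ∀ x y, φ ⁅x, y⁆ = ⁅φ x, φ y⁆) (T : ⋀[ℂ]^4 V),
        {x | ∃ g ∈ connectedSubgroup (φ ⁻¹' Set.range (inl e δ)),
            φ (Ad g (φ.symm (inr e δ T))) = x} =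
          {x | ∃ a : SpecialLinearGroup ℂ V,
            inr e δ (exteriorPower.map 4 (a : V ≃ₗ[ℂ] V).toLinearMap T) = x} := by
  have := isLieBracket e δ
  have := isSimple_𝔤 e hδ
  have := isSimple_L₀ e
  refine ⟨fun A T i => component_action e A T i, isLieBracket e δ, nonempty_gradedLieAlgebra e δ,
    ⟨isSimple_𝔤 e hδ, isCartanSubalgebra_𝔡 e δ, hasCartanMatrix_𝔡 e δ hδ, range_root_𝔡 e δ,
      fun i j hij => ⟨lie_inl_matrixUnit e δ hij, ?_⟩, fun i hi => ⟨lie_inr_wedge e δ i, ?_⟩⟩,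
    ⟨isSimple_L₀ e, isCartanSubalgebra_diag e, hasCartanMatrix_diag e, range_root_diag e⟩,
    fun E _ _ _ G _ _ _ _ _ _ φ hφ T => orbit_eq e δ φ hφ T⟩
  · exact rootSpace_eq_span (ε_sub_ne_zero e δ hij) (inl_ne_zero e δ (matrixUnit_ne_zero e hij))
      (lie_inl_matrixUnit e δ hij)
  · exact rootSpace_eq_span (sum_ε_ne_zero e δ hi) (inr_ne_zero e δ (wedge_ne_zero e hi))
      (lie_inr_wedge e δ i)
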